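/- Let $k$ be a commutative ring in which $2$ is invertible, $J$ a finite set with an involution $c\colon J\to J$, $J^c$ its set of fixed points, and write $\mathrm{pr}(i)=\mathrm{pr}(j)$ if $i=j$ or $i=c(j)$. Let $Q=(Q_{i,j}(u,v))_{i,j\in J}$ be polynomials in $k[u,v]$ such that for all $i,j\in J$ $$Q_{j,i}(u,v)=Q_{i,j}(v,u),\qquad Q_{c(i),j}(-u,v)=Q_{i,c(j)}(u,-v)=Q_{i,j}(u,v),\qquad Q_{i,j}=0\ \text{ if }\ \mathrm{pr}(i)=\mathrm{pr}(j).$$ Let $n\ge 0$. The symmetric group $S_n$ acts on $J^n$ by place permutations, $s_a=(a,a+1)$, and $c_p\nu$ is obtained from $\nu\in J^n$ by applying $c$ to its $p$-th entry. **The algebra $RC_n$.** The quiver Hecke–Clifford superalgebra $RC_n$ is the $k$-superalgebra generated by even elements $y_p$ $(1\le p\le n)$, $\sigma_a$ $(1\le a<n)$, $e(\nu)$ $(\nu\in J^n)$ and odd elements $\mathsf c_p$ $(1\le p\le n)$ with the defining relations 1. $e(\mu)e(\nu)=\delta_{\mu\nu}e(\mu)$, $1=\sum_\nu e(\nu)$,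 $y_pe(\nu)=e(\nu)y_p$, $\mathsf c_pe(\nu)=e(c_p\nu)\mathsf c_p$; 2. $y_py_q=y_qy_p$, $\mathsf c_p\mathsf c_q+\mathsf c_q\mathsf c_p=2\delta_{pq}$; 3. $\mathsf c_py_q=(-1)^{\delta_{pq}}y_q\mathsf c_p$; 4. $\sigma_ae(\nu)=e(s_a\nu)\sigma_a$, $\sigma_a\mathsf c_p=\mathsf c_{s_a(p)}\sigma_a$; 5. $\sigma_ay_pe(\nu)=y_p\sigma_ae(\nu)$ if $p\ne a,a+1$; 6. $(\sigma_ay_{a+1}-y_a\sigma_a)e(\nu)=[\nu_a=\nu_{a+1}]\,e(\nu)-[\nu_a=c(\nu_{a+1})]\,\mathsf c_a\mathsf c_{a+1}e(\nu)$; 7. $(y_{a+1}\sigma_a-\sigma_ay_a)e(\nu)=[\nu_a=\nu_{a+1}]\,e(\nu)+[\nu_a=c(\nu_{a+1})]\,\mathsf c_a\mathsf c_{a+1}e(\nu)$; 8. $\sigma_a^2e(\nu)=Q_{\nu_a,\nu_{a+1}}(y_a,y_{a+1})e(\nu)$; 9. $\sigma_a\sigma_b=\sigma_b\sigma_a$ if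 $|a-b|>1$; 10. for $1\le a\le n-2$, $$(\sigma_{a+1}\sigma_a\sigma_{a+1}-\sigma_a\sigma_{a+1}\sigma_a)e(\nu)=[\nu_a=\nu_{a+2}]\,\frac{Q_{\nu_a,\nu_{a+1}}(y_{a+2},y_{a+1})-Q_{\nu_a,\nu_{a+1}}(y_a,y_{a+1})}{y_{a+2}-y_a}\,e(\nu)$$ $$\qquad+[\nu_a=c(\nu_{a+2})]\,\frac{Q_{\nu_a,\nu_{a+1}}(y_{a+2},y_{a+1})-Q_{\nu_a,\nu_{a+1}}(-y_a,y_{a+1})}{y_{a+2}+y_a}\,\mathsf c_a\mathsf c_{a+2}e(\nu).$$ Here $[P]$ is $1$ if $P$ holds and $0$ otherwise, and the quotients are the polynomials in $y_a,y_{a+1},y_{a+2}$ obtained by dividing. **The algebra $SK_n$.** Let $MA_n$ be the superalgebra generated by even $y_p$, $e(\nu)$ and odd $\mathsf c_p$ with the defining relations 1–3, and let $MK_n$ be its localization in which all $y_a-y_b$ and $y_a+y_b$ $(1\le a<b\le n)$ are inverted. The group $S_n$ acts on $MA_n$ and $MK_n$ by $w(y_p)=y_{w(p)}$, $w(\mathsf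 c_p)=\mathsf c_{w(p)}$, $w(e(\nu))=e(w\nu)$. For $a\neq b$ put $$R_{a,b}=\sum_{\nu\in J^n}\Bigl(Q_{\nu_a,\nu_b}(y_a,y_b)-[\nu_a=\nu_b](y_a-y_b)^{-2}-[\nu_a=c(\nu_b)](y_a+y_b)^{-2}\Bigr)e(\nu)\in MK_n .$$ Let $SK_n$ be the $k$-superalgebra generated by the superalgebra $MK_n$ and even elements $\tilde\tau_a$ $(1\le a<n)$ with the defining relations $\tilde\tau_a\tilde\tau_b=\tilde\tau_b\tilde\tau_a$ for $|a-b|>1$, $\tilde\tau_{a+1}\tilde\tau_a\tilde\tau_{a+1}=\tilde\tau_a\tilde\tau_{a+1}\tilde\tau_a$, $\tilde\tau_a^2=R_{a,a+1}$, and $\tilde\tau_a x=s_a(x)\tilde\tau_a$ for $x\in MK_n$. **Theorem.** Let $\sigma_a\in SK_n$ $(1\le a<n)$ be the element with $$\sigma_ae(\nu)=\begin{cases}\tilde\tau_ae(\nu)&\text{if }\mathrm{pr}(\nu_a)\ne\mathrm{pr}(\nu_{a+1}),\\ (\tilde\tau_a-(y_a-y_{a+1})^{-1})e(\nu)&\text{if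 }\nu_a=\nu_{a+1}\notin J^c,\\ (\tilde\tau_a+(y_a+y_{a+1})^{-1}\mathsf c_a\mathsf c_{a+1})e(\nu)&\text{if }\nu_a=c(\nu_{a+1})\notin J^c,\\ (\tilde\tau_a-(y_a-y_{a+1})^{-1}+(y_a+y_{a+1})^{-1}\mathsf c_a\mathsf c_{a+1})e(\nu)&\text{if }\nu_a=\nu_{a+1}\in J^c\end{cases}$$ for all $\nu\in J^n$. Then the elements $y_p,\mathsf c_p,e(\nu),\sigma_a$ of $SK_n$ satisfy the relations 1–10. Moreover, the superalgebra homomorphism $RC_n\to SK_n$ thus obtained, which sends $y_p,\mathsf c_p,e(\nu),\sigma_a$ to the elements of the same name, is injective. -/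

import Mathlib

open scoped BigOperators

noncomputable section

namespace QHC

universe u v w

/-! ### Superalgebras over a ring in which 2 is invertible -/

section Super

variable {k : Type u} [CommRing k] {A : Type v} [Ring A] [Algebra k A]

/-- The homogeneous part of parity `ε` determined by a parity automorphism `φ`:
`φ` acts by `1` on even elements and by `-1` on odd elements. -/
def parityPart (φ : A →ₐ[k] A) (ε : ZMod 2) : Submodule k A where
  carrier := {x | φ x = if ε = 0 then x else -x}
  zero_mem' := by simp
  add_mem' := by
    intro x y hx hy
    simp only [Set.mem_ofPred_eq] at hx hy ⊢
    rw [map_add, hx, hy]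
    split_ifs
    · rfl
    · abel
  smul_mem' := by
    intro r x hx
    simp only [Set.mem_ofPred_eq] at hx ⊢
    rw [map_smul, hx]
    split_ifs
    · rfl
    · rw [smul_neg]

theorem mem_parityPart {φ : A →ₐ[k] A} {ε : ZMod 2} {x : A} :
    x ∈ parityPart φ ε ↔ φ x = if ε = 0 then x else -x := Iff.rfl

theorem mem_parityPart_zero {φ : A →ₐ[k] A} {x : A} : x ∈ parityPart φ 0 ↔ φ x = x := by
  rw [mem_parityPart, if_pos rfl]

theorem mem_parityPart_one {φ : A →ₐ[k] A} {x : A} : x ∈ parityPart φ 1 ↔ φ x = -x := by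
  rw [mem_parityPart, if_neg (by decide)]

theorem parity_cases (ε : ZMod 2) : ε = 0 ∨ ε = 1 := by
  revert ε; decide

theorem parityPart_mul {φ : A →ₐ[k] A} {i j : ZMod 2} {x y : A}
    (hx : x ∈ parityPart φ i) (hy : y ∈ parityPart φ j) : x * y ∈ parityPart φ (i + j) := by
  obtain rfl | rfl := parity_cases i <;> obtain rfl | rfl := parity_cases j <;>
    simp only [mem_parityPart_zero, mem_parityPart_one] at hx hy
  · rw [add_zero, mem_parityPart_zero, map_mul, hx, hy]
  · rw [zero_add, mem_parityPart_one, map_mul, hx, hy, mul_neg]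
  · rw [add_zero, mem_parityPart_one, map_mul, hx, hy, neg_mul]
  · rw [show (1 + 1 : ZMod 2) = 0 by decide, mem_parityPart_zero, map_mul, hx, hy, neg_mul_neg]

/-- The even component `(x + φ x) / 2` of `x`. -/
def evenComponent [Invertible (2 : k)] (φ : A →ₐ[k] A) (hφ : ∀ x, φ (φ x) = x) :
    A →ₗ[k] parityPart φ 0 :=
  LinearMap.codRestrict _ ((⅟2 : k) • (LinearMap.id + φ.toLinearMap)) fun x => by
    simp only [mem_parityPart_zero, LinearMap.smul_apply, LinearMap.add_apply, LinearMap.id_apply,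
      AlgHom.toLinearMap_apply, map_smul, map_add, hφ, add_comm]

/-- The odd component `(x - φ x) / 2` of `x`. -/
def oddComponent [Invertible (2 : k)] (φ : A →ₐ[k] A) (hφ : ∀ x, φ (φ x) = x) :
    A →ₗ[k] parityPart φ 1 :=
  LinearMap.codRestrict _ ((⅟2 : k) • (LinearMap.id - φ.toLinearMap)) fun x => by
    simp only [mem_parityPart_one, LinearMap.smul_apply, LinearMap.sub_apply, LinearMap.id_apply,
      AlgHom.toLinearMap_apply, map_smul, map_sub, hφ, ← smul_neg, neg_sub]

theorem coe_evenComponent [Invertible (2 : k)] (φ : A →ₐ[k] A) (hφ : ∀ x, φ (φ x) = x) (x : A) :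
    (evenComponent φ hφ x : A) = (⅟2 : k) • (x + φ x) := rfl

theorem coe_oddComponent [Invertible (2 : k)] (φ : A →ₐ[k] A) (hφ : ∀ x, φ (φ x) = x) (x : A) :
    (oddComponent φ hφ x : A) = (⅟2 : k) • (x - φ x) := rfl

/-- Since `2` is invertible, an algebra with a parity involution is a superalgebra,
i.e. it is the direct sum of its even and odd parts. -/
@[reducible]
def superalgebra [Invertible (2 : k)] (φ : A →ₐ[k] A) (hφ : ∀ x, φ (φ x) = x) :
    GradedAlgebra (parityPart φ) where
  one_mem := by rw [mem_parityPart_zero, map_one]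
  mul_mem _ _ _ _ hx hy := parityPart_mul hx hy
  toDecomposition := DirectSum.Decomposition.ofLinearMap (parityPart φ)
    (DirectSum.lof k (ZMod 2) (fun ε => parityPart φ ε) 0 ∘ₗ evenComponent φ hφ +
      DirectSum.lof k (ZMod 2) (fun ε => parityPart φ ε) 1 ∘ₗ oddComponent φ hφ)
    (by
      ext x
      simp only [LinearMap.comp_apply, LinearMap.add_apply, map_add, DirectSum.coeLinearMap_lof,
        LinearMap.id_apply]
      rw [coe_evenComponent, coe_oddComponent, ← smul_add, add_add_sub_cancel, ← two_smul k x, smul_smul, invOf_mul_self, one_smul])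
    (by
      refine DirectSum.linearMap_ext k fun i => LinearMap.ext fun x => ?_
      simp only [LinearMap.comp_apply, LinearMap.add_apply, DirectSum.coeLinearMap_lof,
        LinearMap.id_apply]
      have h2 : ∀ z : A, (⅟2 : k) • (z + z) = z := fun z => by
        rw [← two_smul k z, smul_smul, invOf_mul_self, one_smul]
      obtain ⟨x, hx⟩ := x
      obtain rfl | rfl := parity_cases i
      · have hx' := mem_parityPart_zero.mp hx
        have e1 : evenComponent φ hφ x = ⟨x, hx⟩ := Subtype.ext <| by
          rw [coe_evenComponent, hx', h2]
        have e2 : oddComponent φ hφ x = 0 := Subtype.ext <| by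
          rw [coe_oddComponent, hx', sub_self, smul_zero]; rfl
        rw [e1, e2, map_zero, add_zero]
      · have hx' := mem_parityPart_one.mp hx
        have e1 : evenComponent φ hφ x = 0 := Subtype.ext <| by
          rw [coe_evenComponent, hx', add_neg_cancel, smul_zero]; rfl
        have e2 : oddComponent φ hφ x = ⟨x, hx⟩ := Subtype.ext <| by
          rw [coe_oddComponent, hx', sub_neg_eq_add, h2]
        rw [e1, e2, map_zero, zero_add])

end Super

/-! ### Polynomials in two variables, evaluated at elements of an algebra -/

section Poly

variable {k : Type u} [CommRing k] {A : Type v} [Ring A] [Algebra k A]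

/-- The value `P(s, t)` of `P = ∑ p_{ij} uⁱ vʲ` (variable `0` is `u`, variable `1` is `v`),
used for commuting elements `s`, `t`. -/
def evalAt (P : MvPolynomial (Fin 2) k) (s t : A) : A :=
  ∑ m ∈ P.support, P.coeff m • (s ^ m 0 * t ^ m 1)

/-- The divided difference `(P(s, z) - P(t, z)) / (s - t)`, as a polynomial expression in the
commuting elements `s`, `t`, `z`; see `divDiff_spec`. -/
def divDiff (P : MvPolynomial (Fin 2) k) (s t z : A) : A :=
  ∑ m ∈ P.support, P.coeff m •
    ((∑ i ∈ Finset.range (m 0), s ^ i * t ^ (m 0 - 1 - i)) * z ^ m 1)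

theorem divDiff_spec (P : MvPolynomial (Fin 2) k) {s t z : A} (hst : Commute s t) :
    (s - t) * divDiff P s t z = evalAt P s z - evalAt P t z := by
  unfold divDiff evalAt
  rw [Finset.mul_sum, ← Finset.sum_sub_distrib]
  refine Finset.sum_congr rfl fun m _ => ?_
  rw [mul_smul_comm, ← mul_assoc, hst.mul_geom_sum₂, ← smul_sub, sub_mul]

variable {B : Type w} [Ring B] [Algebra k B]

theorem map_evalAt (f : A →ₐ[k] B) (P : MvPolynomial (Fin 2) k) (s t : A) :
    f (evalAt P s t) = evalAt P (f s) (f t) := by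
  simp [evalAt, map_sum]

theorem map_divDiff (f : A →ₐ[k] B) (P : MvPolynomial (Fin 2) k) (s t z : A) :
    f (divDiff P s t z) = divDiff P (f s) (f t) (f z) := by
  simp [divDiff, map_sum]

end Poly

/-! ### The combinatorial data -/

section Data

variable {k : Type u} [CommRing k] {J : Type v} {n : ℕ}

/-- `pr i = pr j`: the indices `i` and `j` have the same class in `J / (j ∼ c j)`. -/
def SameClass (c : J → J) (i j : J) : Prop := i = j ∨ i = c j

/-- The conditions on the family of polynomials `Q i j (u, v)`. -/
structure IsAdmissible (c : J → J) (Q : J → J → MvPolynomial (Fin 2) k) : Prop where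
  /-- `Q_{j,i}(u,v) = Q_{i,j}(v,u)` -/
  symm : ∀ i j, Q j i = MvPolynomial.aeval ![MvPolynomial.X 1, MvPolynomial.X 0] (Q i j)
  /-- `Q_{ci,j}(-u,v) = Q_{i,j}(u,v)` -/
  neg_left : ∀ i j,
    MvPolynomial.aeval ![-MvPolynomial.X 0, MvPolynomial.X 1] (Q (c i) j) = Q i j
  /-- `Q_{i,cj}(u,-v) = Q_{i,j}(u,v)` -/
  neg_right : ∀ i j,
    MvPolynomial.aeval ![MvPolynomial.X 0, -MvPolynomial.X 1] (Q i (c j)) = Q i j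
  /-- `Q_{i,j} = 0` if `pr i = pr j` -/
  zero : ∀ i j, SameClass c i j → Q i j = 0

/-- `c_p ν`: apply the involution to the `p`-th entry of `ν`. -/
def flip (c : J → J) (p : Fin n) (ν : Fin n → J) : Fin n → J := Function.update ν p (c (ν p))

/-- The action of the symmetric group on sequences by place permutation,
`(w ν)_{w p} = ν_p`. -/
def permSeq (w : Equiv.Perm (Fin n)) (ν : Fin n → J) : Fin n → J := fun p => ν (w.symm p)

/-- An index `a : Fin (n - 1)` stands for one of the `n - 1` adjacent pairs of positions;
`lo a` and `hi a` are the positions `a`, `a + 1`. -/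
def lo (a : Fin (n - 1)) : Fin n := ⟨a.1, by omega⟩

/-- The upper position of the adjacent pair with index `a`. -/
def hi (a : Fin (n - 1)) : Fin n := ⟨a.1 + 1, by omega⟩

theorem lo_ne_hi (a : Fin (n - 1)) : lo a ≠ hi a := by
  simp [lo, hi]

/-- The simple transposition `s_a = (a, a + 1)`. -/
def simpleRefl (a : Fin (n - 1)) : Equiv.Perm (Fin n) := Equiv.swap (lo a) (hi a)

/-- `|a - b| > 1` -/
def Far (a b : Fin (n - 1)) : Prop := a.1 + 1 < b.1 ∨ b.1 + 1 < a.1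

end Data

/-! ### Defining relations

The relations are written for elements of an arbitrary algebra `A`. Taking the free algebra on
the generators one gets the presented algebras; for given elements of another algebra they say
which equations these elements have to fulfil. -/

section Relations

variable {k : Type u} [CommRing k] {J : Type v} [Fintype J] [DecidableEq J] {n : ℕ}

/-- The defining relations among the `y_p`, `c_p`, `e(ν)`. `c` is the involution of `J`. -/
inductive MARel {A : Type w} [Ring A] (c : J → J) (y cl : Fin n → A) (e : (Fin n → J) → A) :
    A → A → Prop
  | e_mul_e (μ ν : Fin n → J) : MARel c y cl e (e μ * e ν) (if μ = ν then e μ else 0)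
  | sum_e : MARel c y cl e 1 (∑ ν, e ν)
  | y_e (p : Fin n) (ν : Fin n → J) : MARel c y cl e (y p * e ν) (e ν * y p)
  | cl_e (p : Fin n) (ν : Fin n → J) : MARel c y cl e (cl p * e ν) (e (flip c p ν) * cl p)
  | y_y (p q : Fin n) : MARel c y cl e (y p * y q) (y q * y p)
  | cl_cl (p q : Fin n) :
      MARel c y cl e (cl p * cl q + cl q * cl p) (if p = q then 2 else 0)
  | cl_y (p q : Fin n) :
      MARel c y cl e (cl p * y q) (if p = q then -(y q * cl p) else y q * cl p)

/-- The defining relations of the quiver Hecke-Clifford superalgebra. -/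
inductive RCRel {A : Type w} [Ring A] [Algebra k A] (c : J → J)
    (Q : J → J → MvPolynomial (Fin 2) k) (y cl : Fin n → A) (e : (Fin n → J) → A)
    (σ : Fin (n - 1) → A) : A → A → Prop
  | ma (a b : A) : MARel c y cl e a b → RCRel c Q y cl e σ a b
  | σ_e (a : Fin (n - 1)) (ν : Fin n → J) :
      RCRel c Q y cl e σ (σ a * e ν) (e (permSeq (simpleRefl a) ν) * σ a)
  | σ_cl (a : Fin (n - 1)) (p : Fin n) :
      RCRel c Q y cl e σ (σ a * cl p) (cl (simpleRefl a p) * σ a)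
  | σ_y (a : Fin (n - 1)) (p : Fin n) (ν : Fin n → J) : p ≠ lo a → p ≠ hi a →
      RCRel c Q y cl e σ (σ a * y p * e ν) (y p * σ a * e ν)
  | σ_y_hi (a : Fin (n - 1)) (ν : Fin n → J) :
      RCRel c Q y cl e σ ((σ a * y (hi a) - y (lo a) * σ a) * e ν)
        ((if ν (lo a) = ν (hi a) then e ν else 0)
          - (if ν (lo a) = c (ν (hi a)) then cl (lo a) * cl (hi a) * e ν else 0))
  | y_hi_σ (a : Fin (n - 1)) (ν : Fin n → J) :
      RCRel c Q y cl e σ ((y (hi a) * σ a - σ a * y (lo a)) * e ν)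
        ((if ν (lo a) = ν (hi a) then e ν else 0)
          + (if ν (lo a) = c (ν (hi a)) then cl (lo a) * cl (hi a) * e ν else 0))
  | σ_sq (a : Fin (n - 1)) (ν : Fin n → J) :
      RCRel c Q y cl e σ (σ a ^ 2 * e ν)
        (evalAt (Q (ν (lo a)) (ν (hi a))) (y (lo a)) (y (hi a)) * e ν)
  | σ_σ (a b : Fin (n - 1)) : Far a b → RCRel c Q y cl e σ (σ a * σ b) (σ b * σ a)
  /- Here `b = a + 1`, and the positions `a`, `a + 1`, `a + 2` are `lo a`, `hi a`, `hi b`. -/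
  | braid (a b : Fin (n - 1)) (ν : Fin n → J) : b.1 = a.1 + 1 →
      RCRel c Q y cl e σ ((σ b * σ a * σ b - σ a * σ b * σ a) * e ν)
        ((if ν (lo a) = ν (hi b) then
            divDiff (Q (ν (lo a)) (ν (hi a))) (y (hi b)) (y (lo a)) (y (hi a)) * e ν else 0)
          + (if ν (lo a) = c (ν (hi b)) then
            divDiff (Q (ν (lo a)) (ν (hi a))) (y (hi b)) (-y (lo a)) (y (hi a))
              * (cl (lo a) * cl (hi b)) * e ν else 0))

variable {A : Type*} [Ring A] [Algebra k A] {B : Type*} [Ring B] [Algebra k B]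
  {c : J → J} {Q : J → J → MvPolynomial (Fin 2) k} {y cl : Fin n → A} {e : (Fin n → J) → A}
  {σ : Fin (n - 1) → A}

theorem MARel.map (f : A →ₐ[k] B) {a b : A} (h : MARel c y cl e a b) :
    MARel c (fun p => f (y p)) (fun p => f (cl p)) (fun ν => f (e ν)) (f a) (f b) := by
  cases h with
  | e_mul_e μ ν =>
    have := MARel.e_mul_e (c := c) (y := fun p => f (y p)) (cl := fun p => f (cl p))
      (e := fun ν => f (e ν)) μ ν
    rw [map_mul, apply_ite f, map_zero]; exact this
  | sum_e =>
    have := MARel.sum_e (c := c) (y := fun p => f (y p)) (cl := fun p => f (cl p))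
      (e := fun ν => f (e ν))
    rw [map_one, map_sum]; exact this
  | y_e p ν =>
    rw [map_mul, map_mul]; exact MARel.y_e (y := fun p => f (y p)) (e := fun ν => f (e ν)) p ν
  | cl_e p ν =>
    rw [map_mul, map_mul]; exact MARel.cl_e (cl := fun p => f (cl p)) (e := fun ν => f (e ν)) p ν
  | y_y p q => rw [map_mul, map_mul]; exact MARel.y_y (y := fun p => f (y p)) p q
  | cl_cl p q =>
    rw [map_add, map_mul, map_mul, apply_ite f, map_zero, map_ofNat]
    exact MARel.cl_cl (cl := fun p => f (cl p)) p q
  | cl_y p q =>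
    rw [map_mul, apply_ite f, map_neg, map_mul]
    exact MARel.cl_y (y := fun p => f (y p)) (cl := fun p => f (cl p)) p q

theorem RCRel.map (f : A →ₐ[k] B) {a b : A} (h : RCRel c Q y cl e σ a b) :
    RCRel c Q (fun p => f (y p)) (fun p => f (cl p)) (fun ν => f (e ν)) (fun i => f (σ i))
      (f a) (f b) := by
  cases h with
  | ma _ _ h => exact RCRel.ma _ _ (h.map f)
  | σ_e a ν =>
    rw [map_mul, map_mul]
    exact RCRel.σ_e (e := fun ν => f (e ν)) (σ := fun i => f (σ i)) a ν
  | σ_cl a p =>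
    rw [map_mul, map_mul]
    exact RCRel.σ_cl (cl := fun p => f (cl p)) (σ := fun i => f (σ i)) a p
  | σ_y a p ν h1 h2 =>
    simp only [map_mul]
    exact RCRel.σ_y (y := fun p => f (y p)) (e := fun ν => f (e ν)) (σ := fun i => f (σ i))
      a p ν h1 h2
  | σ_y_hi a ν =>
    simp only [map_mul, map_sub, apply_ite f, map_zero]
    exact RCRel.σ_y_hi (y := fun p => f (y p)) (cl := fun p => f (cl p)) (e := fun ν => f (e ν))
      (σ := fun i => f (σ i)) a ν
  | y_hi_σ a ν =>
    simp only [map_mul, map_sub, map_add, apply_ite f, map_zero]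
    exact RCRel.y_hi_σ (y := fun p => f (y p)) (cl := fun p => f (cl p)) (e := fun ν => f (e ν))
      (σ := fun i => f (σ i)) a ν
  | σ_sq a ν =>
    simp only [map_mul, map_pow, map_evalAt]
    exact RCRel.σ_sq (y := fun p => f (y p)) (e := fun ν => f (e ν)) (σ := fun i => f (σ i)) a ν
  | σ_σ a b h =>
    rw [map_mul, map_mul]
    exact RCRel.σ_σ (σ := fun i => f (σ i)) a b h
  | braid a b ν h =>
    simp only [map_mul, map_sub, map_add, apply_ite f, map_zero, map_divDiff, map_neg]
    exact RCRel.braid (y := fun p => f (y p)) (cl := fun p => f (cl p)) (e := fun ν => f (e ν))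
      (σ := fun i => f (σ i)) a b ν h

/-- Changing the sign of all the Clifford generators preserves the relations. -/
theorem MARel.eq_of_neg (H : ∀ a b, MARel c y cl e a b → a = b) {a b : A}
    (h : MARel c y (fun p => -cl p) e a b) : a = b := by
  cases h with
  | e_mul_e μ ν => exact H _ _ (.e_mul_e μ ν)
  | sum_e => exact H _ _ .sum_e
  | y_e p ν => exact H _ _ (.y_e p ν)
  | cl_e p ν => rw [neg_mul, mul_neg, H _ _ (.cl_e p ν)]
  | y_y p q => exact H _ _ (.y_y p q)
  | cl_cl p q => rw [neg_mul_neg, neg_mul_neg, H _ _ (.cl_cl p q)]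
  | cl_y p q =>
    have := H _ _ (.cl_y p q)
    rw [neg_mul, this]
    split_ifs <;> simp

theorem RCRel.eq_of_neg (H : ∀ a b, RCRel c Q y cl e σ a b → a = b) {a b : A}
    (h : RCRel c Q y (fun p => -cl p) e σ a b) : a = b := by
  cases h with
  | ma _ _ h => exact MARel.eq_of_neg (fun a b h => H a b (.ma a b h)) h
  | σ_e a ν => exact H _ _ (.σ_e a ν)
  | σ_cl a p => rw [neg_mul, mul_neg, H _ _ (.σ_cl a p)]
  | σ_y a p ν h1 h2 => exact H _ _ (.σ_y a p ν h1 h2)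
  | σ_y_hi a ν => rw [neg_mul_neg]; exact H _ _ (.σ_y_hi a ν)
  | y_hi_σ a ν => rw [neg_mul_neg]; exact H _ _ (.y_hi_σ a ν)
  | σ_sq a ν => exact H _ _ (.σ_sq a ν)
  | σ_σ a b h => exact H _ _ (.σ_σ a b h)
  | braid a b ν h => rw [neg_mul_neg]; exact H _ _ (.braid a b ν h)

end Relations

/-! ### The algebra generated by the `y_p`, `c_p`, `e(ν)` -/

section MA

/-- Generators `y_p`, `c_p`, `e(ν)`. -/
inductive MAGen (J : Type v) (n : ℕ) : Type v
  | y (p : Fin n)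
  | cl (p : Fin n)
  | e (ν : Fin n → J)

variable (k : Type u) [CommRing k] {J : Type v} [Fintype J] [DecidableEq J] (c : J → J) (n : ℕ)

/-- The defining relations, in the free algebra. -/
def maRel : FreeAlgebra k (MAGen J n) → FreeAlgebra k (MAGen J n) → Prop :=
  MARel c (fun p => FreeAlgebra.ι k (MAGen.y p)) (fun p => FreeAlgebra.ι k (MAGen.cl p))
    (fun ν => FreeAlgebra.ι k (MAGen.e ν))

/-- The algebra `MA_n` with generators `y_p`, `c_p`, `e(ν)`. -/
def MA : Type _ := RingQuot (maRel k c n)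

instance : Ring (MA k c n) := inferInstanceAs (Ring (RingQuot (maRel k c n)))

instance : Algebra k (MA k c n) := inferInstanceAs (Algebra k (RingQuot (maRel k c n)))

namespace MA

/-- The quotient map from the free algebra. -/
def mk : FreeAlgebra k (MAGen J n) →ₐ[k] MA k c n := RingQuot.mkAlgHom k (maRel k c n)

variable {n}

/-- The generator `y_p`. -/
def y (p : Fin n) : MA k c n := mk k c n (FreeAlgebra.ι k (MAGen.y p))

/-- The Clifford generator `c_p`. -/
def cl (p : Fin n) : MA k c n := mk k c n (FreeAlgebra.ι k (MAGen.cl p))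

/-- The idempotent `e(ν)`. -/
def e (ν : Fin n → J) : MA k c n := mk k c n (FreeAlgebra.ι k (MAGen.e ν))

theorem rel (a b : MA k c n) (h : MARel c (y k c) (cl k c) (e k c) a b) : a = b := by
  cases h with
  | e_mul_e μ ν =>
    have := RingQuot.mkAlgHom_rel k (s := maRel k c n) (.e_mul_e μ ν)
    rw [map_mul, apply_ite (RingQuot.mkAlgHom k _), map_zero] at this
    exact this
  | sum_e =>
    have := RingQuot.mkAlgHom_rel k (s := maRel k c n) .sum_e
    rw [map_one, map_sum] at this
    exact this
  | y_e p ν =>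
    have := RingQuot.mkAlgHom_rel k (s := maRel k c n) (.y_e p ν)
    rw [map_mul, map_mul] at this
    exact this
  | cl_e p ν =>
    have := RingQuot.mkAlgHom_rel k (s := maRel k c n) (.cl_e p ν)
    rw [map_mul, map_mul] at this
    exact this
  | y_y p q =>
    have := RingQuot.mkAlgHom_rel k (s := maRel k c n) (.y_y p q)
    rw [map_mul, map_mul] at this
    exact this
  | cl_cl p q =>
    have := RingQuot.mkAlgHom_rel k (s := maRel k c n) (.cl_cl p q)
    rw [map_add, map_mul, map_mul, apply_ite (RingQuot.mkAlgHom k _), map_zero, map_ofNat] at this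
    exact this
  | cl_y p q =>
    have := RingQuot.mkAlgHom_rel k (s := maRel k c n) (.cl_y p q)
    rw [map_mul, apply_ite (RingQuot.mkAlgHom k _), map_neg, map_mul] at this
    exact this

variable {k c}

/-- Algebra homomorphisms out of `MA_n` are given by elements satisfying the relations. -/
def lift {A : Type*} [Ring A] [Algebra k A] (y' cl' : Fin n → A) (e' : (Fin n → J) → A)
    (H : ∀ a b, MARel c y' cl' e' a b → a = b) : MA k c n →ₐ[k] A :=
  RingQuot.liftAlgHom k ⟨FreeAlgebra.lift k fun g => match g with
      | .y p => y' p
      | .cl p => cl' p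
      | .e ν => e' ν, fun a b h => H _ _ (by
        have := MARel.map (FreeAlgebra.lift k fun g : MAGen J n => match g with
          | .y p => y' p
          | .cl p => cl' p
          | .e ν => e' ν) h
        simpa only [FreeAlgebra.lift_ι_apply] using this)⟩

section lift

variable {A : Type*} [Ring A] [Algebra k A] (y' cl' : Fin n → A) (e' : (Fin n → J) → A)
    (H : ∀ a b, MARel c y' cl' e' a b → a = b)

@[simp] theorem lift_y (p : Fin n) : lift y' cl' e' H (y k c p) = y' p := by
  refine (RingQuot.liftAlgHom_mkAlgHom_apply _ _ _ _).trans ?_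
  rw [FreeAlgebra.lift_ι_apply]

@[simp] theorem lift_cl (p : Fin n) : lift y' cl' e' H (cl k c p) = cl' p := by
  refine (RingQuot.liftAlgHom_mkAlgHom_apply _ _ _ _).trans ?_
  rw [FreeAlgebra.lift_ι_apply]

@[simp] theorem lift_e (ν : Fin n → J) : lift y' cl' e' H (e k c ν) = e' ν := by
  refine (RingQuot.liftAlgHom_mkAlgHom_apply _ _ _ _).trans ?_
  rw [FreeAlgebra.lift_ι_apply]

end lift

theorem hom_ext {A : Type*} [Ring A] [Algebra k A] {f g : MA k c n →ₐ[k] A}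
    (hy : ∀ p, f (y k c p) = g (y k c p)) (hcl : ∀ p, f (cl k c p) = g (cl k c p))
    (he : ∀ ν, f (e k c ν) = g (e k c ν)) : f = g := by
  refine RingQuot.ringQuot_ext' k f g ?_
  refine FreeAlgebra.hom_ext ?_
  funext x
  cases x with
  | y p => exact hy p
  | cl p => exact hcl p
  | e ν => exact he ν

/-- An element commuting with all the generators is central. -/
theorem commute_of_gen {x : MA k c n} (hy : ∀ p, Commute x (y k c p))
    (hcl : ∀ p, Commute x (cl k c p)) (he : ∀ ν, Commute x (e k c ν)) (a : MA k c n) :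
    Commute x a := by
  obtain ⟨a, rfl⟩ := RingQuot.mkAlgHom_surjective k (maRel k c n) a
  induction a using FreeAlgebra.induction with
  | grade0 r => rw [AlgHom.commutes]; exact Algebra.commute_algebraMap_right r x
  | grade1 g =>
    cases g with
    | y p => exact hy p
    | cl p => exact hcl p
    | e ν => exact he ν
  | mul a b ha hb => rw [map_mul]; exact ha.mul_right hb
  | add a b ha hb => rw [map_add]; exact ha.add_right hb

theorem commute_y (p q : Fin n) : Commute (y k c p) (y k c q) := rel k c _ _ (.y_y p q)

theorem commute_sq_sub_sq (a b : Fin n) (x : MA k c n) :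
    Commute (y k c a ^ 2 - y k c b ^ 2) x := by
  have key : ∀ q p : Fin n, Commute (y k c q ^ 2) (cl k c p) := by
    intro q p
    have h := rel k c _ _ (.cl_y p q)
    change _ * _ = _ * _
    by_cases hpq : p = q
    · rw [if_pos hpq] at h
      rw [pow_two, mul_assoc, ← neg_eq_iff_eq_neg.mpr h, mul_neg, ← mul_assoc,
        ← neg_eq_iff_eq_neg.mpr h, neg_mul, neg_neg, mul_assoc]
    · rw [if_neg hpq] at h
      rw [pow_two, mul_assoc, ← h, ← mul_assoc, ← h, mul_assoc]
  refine commute_of_gen (fun p => ?_) (fun p => ?_) (fun ν => ?_) x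
  · exact ((commute_y a p).pow_left 2).sub_left ((commute_y b p).pow_left 2)
  · exact (key a p).sub_left (key b p)
  · have h : ∀ q, Commute (y k c q) (e k c ν) := fun q => rel k c _ _ (.y_e q ν)
    exact ((h a).pow_left 2).sub_left ((h b).pow_left 2)

/-- The parity automorphism: `y_p`, `e(ν)` are even, `c_p` is odd. -/
def parity : MA k c n →ₐ[k] MA k c n :=
  lift (y k c) (fun p => -cl k c p) (e k c) fun _ _ h => MARel.eq_of_neg (rel k c) h

theorem perm_rel (w : Equiv.Perm (Fin n)) (a b : MA k c n)
    (h : MARel c (fun p => y k c (w p)) (fun p => cl k c (w p))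
      (fun ν => e k c (permSeq w ν)) a b) : a = b := by
  have inj : Function.Injective (permSeq (J := J) w) := by
    intro μ ν h
    funext p
    have := congrFun h (w p)
    simpa [permSeq] using this
  cases h with
  | e_mul_e μ ν =>
    rw [rel k c _ _ (.e_mul_e _ _)]
    exact if_congr inj.eq_iff rfl rfl
  | sum_e =>
    rw [rel k c _ _ .sum_e]
    exact (Fintype.sum_bijective (permSeq w) (Finite.injective_iff_bijective.mp inj)
      _ _ fun _ => rfl).symm
  | y_e p ν => exact rel k c _ _ (.y_e _ _)
  | cl_e p ν =>
    rw [rel k c _ _ (.cl_e _ _)]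
    congr 2
    funext q
    by_cases hq : q = w p
    · subst hq
      simp [flip, permSeq]
    · have hq' : w.symm q ≠ p := fun h => hq (by rw [← h, Equiv.apply_symm_apply])
      simp [flip, permSeq, Function.update_of_ne hq, Function.update_of_ne hq']
  | y_y p q => exact rel k c _ _ (.y_y _ _)
  | cl_cl p q =>
    rw [rel k c _ _ (.cl_cl _ _)]
    exact if_congr w.injective.eq_iff rfl rfl
  | cl_y p q =>
    rw [rel k c _ _ (.cl_y _ _)]
    exact if_congr w.injective.eq_iff rfl rfl

/-- The action of a permutation `w` on `MA_n`:
`y_p ↦ y_{w p}`, `c_p ↦ c_{w p}`, `e(ν) ↦ e(w ν)`. -/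
def perm (w : Equiv.Perm (Fin n)) : MA k c n →ₐ[k] MA k c n :=
  lift (fun p => y k c (w p)) (fun p => cl k c (w p)) (fun ν => e k c (permSeq w ν)) (perm_rel w)

variable (k c n)

/-- The multiplicative set generated by the `y_a - y_b` and `y_a + y_b`, `a ≠ b`.
(Each `y_b - y_a` is the negative of `y_a - y_b`, so that it does not matter whether one takes
all pairs `a ≠ b` or only `a < b`.) -/
def denom : Submonoid (MA k c n) :=
  Submonoid.closure {x | ∃ a b : Fin n, a ≠ b ∧ (x = y k c a - y k c b ∨ x = y k c a + y k c b)}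

variable {k c n}

theorem sub_mem_denom {a b : Fin n} (h : a ≠ b) : y k c a - y k c b ∈ denom k c n :=
  Submonoid.subset_closure ⟨a, b, h, Or.inl rfl⟩

theorem add_mem_denom {a b : Fin n} (h : a ≠ b) : y k c a + y k c b ∈ denom k c n :=
  Submonoid.subset_closure ⟨a, b, h, Or.inr rfl⟩

theorem denom_commute {s t : MA k c n} (hs : s ∈ denom k c n) (ht : t ∈ denom k c n) :
    Commute s t := by
  have hy : ∀ p, Commute (y k c p) t := by
    intro p
    induction ht using Submonoid.closure_induction with
    | mem x hx =>
      obtain ⟨a, b, -, rfl | rfl⟩ := hx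
      · exact (commute_y p a).sub_right (commute_y p b)
      · exact (commute_y p a).add_right (commute_y p b)
    | one => exact Commute.one_right _
    | mul _ _ _ _ h₁ h₂ => exact h₁.mul_right h₂
  induction hs using Submonoid.closure_induction with
  | mem x hx =>
    obtain ⟨a, b, -, rfl | rfl⟩ := hx
    · exact (hy a).sub_left (hy b)
    · exact (hy a).add_left (hy b)
  | one => exact Commute.one_left _
  | mul _ _ _ _ h₁ h₂ => exact h₁.mul_left h₂

/-- Every denominator has a multiple among the denominators that is central. -/
theorem exists_central_mul {s : MA k c n} (hs : s ∈ denom k c n) :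
    ∃ t ∈ denom k c n, ∀ x, Commute (t * s) x := by
  induction hs using Submonoid.closure_induction with
  | mem x hx =>
    obtain ⟨a, b, hab, rfl | rfl⟩ := hx
    · refine ⟨y k c a + y k c b, add_mem_denom hab, fun x => ?_⟩
      rw [← (commute_y a b).sq_sub_sq]
      exact commute_sq_sub_sq a b x
    · refine ⟨y k c a - y k c b, sub_mem_denom hab, fun x => ?_⟩
      rw [(denom_commute (sub_mem_denom hab) (add_mem_denom hab)).eq,
        ← (commute_y a b).sq_sub_sq]
      exact commute_sq_sub_sq a b x
  | one => exact ⟨1, one_mem _, by simp⟩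
  | mul s₁ s₂ _ _ h₁ h₂ =>
    obtain ⟨t₁, ht₁, h₁⟩ := h₁
    obtain ⟨t₂, ht₂, h₂⟩ := h₂
    refine ⟨t₂ * t₁, mul_mem ht₂ ht₁, fun x => ?_⟩
    have : t₂ * t₁ * (s₁ * s₂) = (t₁ * s₁) * (t₂ * s₂) := by
      rw [← mul_assoc, mul_assoc t₂, mul_assoc, (h₁ s₂).eq, ← mul_assoc, (h₁ _).eq]
    rw [this]
    exact (h₁ x).mul_left (h₂ x)

/-- The denominators form a left Ore set. -/
instance oreSet : OreLocalization.OreSet (denom k c n) where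
  ore_right_cancel r₁ r₂ s h := by
    obtain ⟨t, ht, hc⟩ := exists_central_mul s.2
    refine ⟨⟨t * s, mul_mem ht s.2⟩, ?_⟩
    have key : ∀ r : MA k c n, t * (s : MA k c n) * r = r * s * t := fun r => by
      rw [(hc r).eq, (denom_commute ht s.2).eq, mul_assoc]
    change t * (s : MA k c n) * r₁ = t * (s : MA k c n) * r₂
    rw [key, key, h]
  oreNum r s := r * (exists_central_mul s.2).choose
  oreDenom _ s :=
    ⟨(exists_central_mul s.2).choose * s, mul_mem (exists_central_mul s.2).choose_spec.1 s.2⟩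
  ore_eq r s := ((exists_central_mul s.2).choose_spec.2 r).eq.trans (mul_assoc _ _ _).symm

theorem parity_mem_denom {s : MA k c n} (hs : s ∈ denom k c n) : parity s ∈ denom k c n := by
  induction hs using Submonoid.closure_induction with
  | mem x hx =>
    obtain ⟨a, b, hab, rfl | rfl⟩ := hx
    · simpa [parity] using sub_mem_denom hab
    · simpa [parity] using add_mem_denom hab
  | one => rw [map_one]; exact one_mem _
  | mul _ _ _ _ h₁ h₂ => rw [map_mul]; exact mul_mem h₁ h₂

theorem perm_mem_denom (w : Equiv.Perm (Fin n)) {s : MA k c n} (hs : s ∈ denom k c n) :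
    perm w s ∈ denom k c n := by
  induction hs using Submonoid.closure_induction with
  | mem x hx =>
    obtain ⟨a, b, hab, rfl | rfl⟩ := hx
    · simpa [perm] using sub_mem_denom (w.injective.ne hab)
    · simpa [perm] using add_mem_denom (w.injective.ne hab)
  | one => rw [map_one]; exact one_mem _
  | mul _ _ _ _ h₁ h₂ => rw [map_mul]; exact mul_mem h₁ h₂

theorem parity_parity (x : MA k c n) : parity (parity x) = x := by
  have : (parity (k := k) (c := c) (n := n)).comp parity = AlgHom.id k _ := by
    apply hom_ext <;> intro <;> simp [parity]
  exact DFunLike.congr_fun this x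

theorem parity_perm (w : Equiv.Perm (Fin n)) (x : MA k c n) :
    parity (perm w x) = perm w (parity x) := by
  have : (parity (k := k) (c := c) (n := n)).comp (perm w) = (perm w).comp parity := by
    apply hom_ext <;> intro <;> simp [parity, perm]
  exact DFunLike.congr_fun this x

end MA

end MA

/-! ### The localization -/

section MK

variable (k : Type u) [CommRing k] {J : Type v} [Fintype J] [DecidableEq J] (c : J → J) (n : ℕ)

/-- The algebra `MK_n`: the localization of `MA_n` inverting all `y_a - y_b` and `y_a + y_b`
with `a ≠ b`; its elements are the left fractions `s⁻¹ x`. -/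
abbrev MK : Type _ := OreLocalization (MA.denom k c n) (MA k c n)

namespace MK

/-- The canonical map `MA_n → MK_n`. -/
def of : MA k c n →ₐ[k] MK k c n :=
  { OreLocalization.numeratorRingHom with commutes' := fun _ => rfl }

variable {n}

/-- The generator `y_p`. -/
def y (p : Fin n) : MK k c n := of k c n (MA.y k c p)

/-- The Clifford generator `c_p`. -/
def cl (p : Fin n) : MK k c n := of k c n (MA.cl k c p)

/-- The idempotent `e(ν)`. -/
def e (ν : Fin n → J) : MK k c n := of k c n (MA.e k c ν)

/-- `(y_a - y_b)⁻¹` -/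
def invSub (a b : Fin n) (h : a ≠ b) : MK k c n :=
  OreLocalization.oreDiv 1 ⟨MA.y k c a - MA.y k c b, MA.sub_mem_denom h⟩

/-- `(y_a + y_b)⁻¹` -/
def invAdd (a b : Fin n) (h : a ≠ b) : MK k c n :=
  OreLocalization.oreDiv 1 ⟨MA.y k c a + MA.y k c b, MA.add_mem_denom h⟩

theorem invSub_mul (a b : Fin n) (h : a ≠ b) : invSub k c a b h * (y k c a - y k c b) = 1 := by
  have := OreLocalization.mul_inv (R := MA k c n) (S := MA.denom k c n) 1
    ⟨MA.y k c a - MA.y k c b, MA.sub_mem_denom h⟩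
  rw [y, y, ← map_sub]
  exact this

theorem invAdd_mul (a b : Fin n) (h : a ≠ b) : invAdd k c a b h * (y k c a + y k c b) = 1 := by
  have := OreLocalization.mul_inv (R := MA k c n) (S := MA.denom k c n) 1
    ⟨MA.y k c a + MA.y k c b, MA.add_mem_denom h⟩
  rw [y, y, ← map_add]
  exact this

variable {k c}

theorem hom_ext {A : Type*} [Ring A] [Algebra k A] {f g : MK k c n →ₐ[k] A}
    (h : ∀ x, f (of k c n x) = g (of k c n x)) : f = g := by
  refine AlgHom.ext fun x => ?_
  induction x using OreLocalization.ind with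
  | _ r s =>
    have hs : (of k c n s * OreLocalization.oreDiv 1 s : MK k c n) = 1 :=
      (OreLocalization.numeratorUnit s).mul_inv
    have hs' : (OreLocalization.oreDiv 1 s * of k c n s : MK k c n) = 1 :=
      (OreLocalization.numeratorUnit s).inv_mul
    have hr : OreLocalization.oreDiv r s = (OreLocalization.oreDiv 1 s * of k c n r : MK k c n) := by
      refine Eq.trans ?_ OreLocalization.mul_div_one.symm
      rw [one_mul]
    have key : f (OreLocalization.oreDiv 1 s) = g (OreLocalization.oreDiv 1 s) := by
      have h1 : f (OreLocalization.oreDiv 1 s) * f (of k c n s) = 1 := by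
        rw [← map_mul, hs', map_one]
      have h2 : f (of k c n s) * g (OreLocalization.oreDiv 1 s) = 1 := by
        rw [h, ← map_mul, hs, map_one]
      exact left_inv_eq_right_inv h1 h2
    rw [hr, map_mul, map_mul, key, h]

/-- The images of the denominators under an endomorphism of `MA_n` preserving them, as units of
`MK_n`. -/
def denomUnit (f : MA k c n →ₐ[k] MA k c n) (hf : ∀ s ∈ MA.denom k c n, f s ∈ MA.denom k c n) :
    MA.denom k c n →* (MK k c n)ˣ where
  toFun s := OreLocalization.numeratorUnit ⟨f s, hf s s.2⟩
  map_one' := Units.ext (map_one ((of k c n).comp f))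
  map_mul' s t := Units.ext (map_mul ((of k c n).comp f) (s : MA k c n) (t : MA k c n))

/-- The extension to `MK_n` of an endomorphism of `MA_n` preserving the denominators:
`s⁻¹ x ↦ f(s)⁻¹ f(x)`. -/
def map (f : MA k c n →ₐ[k] MA k c n) (hf : ∀ s ∈ MA.denom k c n, f s ∈ MA.denom k c n) :
    MK k c n →ₐ[k] MK k c n :=
  { OreLocalization.universalHom ((of k c n).comp f).toRingHom (denomUnit f hf)
      (fun _ => rfl) with
    commutes' := fun r =>
      (OreLocalization.universalHom_commutes ((of k c n).comp f).toRingHom (denomUnit f hf)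
        (fun _ => rfl)).trans (((of k c n).comp f).commutes r) }

theorem map_of (f : MA k c n →ₐ[k] MA k c n) (hf : ∀ s ∈ MA.denom k c n, f s ∈ MA.denom k c n)
    (x : MA k c n) : map f hf (of k c n x) = of k c n (f x) :=
  OreLocalization.universalHom_commutes ((of k c n).comp f).toRingHom (denomUnit f hf) fun _ => rfl

theorem map_inv (f : MA k c n →ₐ[k] MA k c n) (hf : ∀ s ∈ MA.denom k c n, f s ∈ MA.denom k c n)
    (s : MA.denom k c n) : map f hf (OreLocalization.oreDiv 1 s) =
      OreLocalization.oreDiv 1 ⟨f s, hf s s.2⟩ := by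
  refine (OreLocalization.universalHom_apply ((of k c n).comp f).toRingHom (denomUnit f hf)
    fun _ => rfl).trans ?_
  rw [map_one, mul_one]
  rfl

/-- The parity automorphism. -/
def parity : MK k c n →ₐ[k] MK k c n := map MA.parity fun _ => MA.parity_mem_denom

/-- The action of a permutation on `MK_n`. -/
def perm (w : Equiv.Perm (Fin n)) : MK k c n →ₐ[k] MK k c n :=
  map (MA.perm w) fun _ => MA.perm_mem_denom w

theorem parity_parity (x : MK k c n) : parity (parity x) = x := by
  have : (parity (k := k) (c := c) (n := n)).comp parity = AlgHom.id k _ :=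
    hom_ext fun x => by simp [parity, map_of, MA.parity_parity]
  exact DFunLike.congr_fun this x

theorem parity_perm (w : Equiv.Perm (Fin n)) (x : MK k c n) :
    parity (perm w x) = perm w (parity x) := by
  have : (parity (k := k) (c := c) (n := n)).comp (perm w) = (perm w).comp parity :=
    hom_ext fun x => by simp [parity, perm, map_of, MA.parity_perm]
  exact DFunLike.congr_fun this x

theorem parity_y (p : Fin n) : parity (y k c p) = y k c p := by
  simp [parity, y, map_of, MA.parity]

theorem parity_e (ν : Fin n → J) : parity (e k c ν) = e k c ν := by
  simp [parity, e, map_of, MA.parity]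

theorem parity_cl (p : Fin n) : parity (cl k c p) = -cl k c p := by
  simp [parity, cl, map_of, MA.parity]

theorem parity_invSub (a b : Fin n) (h : a ≠ b) :
    parity (invSub k c a b h) = invSub k c a b h := by
  rw [invSub, parity, map_inv]
  congr 2
  simp [MA.parity]

theorem parity_invAdd (a b : Fin n) (h : a ≠ b) :
    parity (invAdd k c a b h) = invAdd k c a b h := by
  rw [invAdd, parity, map_inv]
  congr 2
  simp [MA.parity]

/-- The element `R_{a,b} = ∑_ν (Q_{ν_a,ν_b}(y_a, y_b)
- [ν_a = ν_b] (y_a - y_b)⁻² - [ν_a = c ν_b] (y_a + y_b)⁻²) e(ν)`. -/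
def R (Q : J → J → MvPolynomial (Fin 2) k) (a b : Fin n) (h : a ≠ b) : MK k c n :=
  ∑ ν : Fin n → J, (evalAt (Q (ν a) (ν b)) (y k c a) (y k c b)
    - (if ν a = ν b then invSub k c a b h ^ 2 else 0)
    - (if ν a = c (ν b) then invAdd k c a b h ^ 2 else 0)) * e k c ν

theorem parity_R (Q : J → J → MvPolynomial (Fin 2) k) (a b : Fin n) (h : a ≠ b) :
    parity (R (c := c) Q a b h) = R Q a b h := by
  simp only [R, map_sum, map_mul, map_sub, map_evalAt, parity_y, parity_e, apply_ite parity,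
    map_pow, parity_invSub, parity_invAdd, map_zero]

end MK

end MK

/-! ### The twisted algebra -/

section SK

variable {k : Type u} [CommRing k] {J : Type v} [Fintype J] [DecidableEq J]

/-- The defining relations of `SK_n`: the map `ι` from `MK_n` is an algebra homomorphism,
the `τ_a` satisfy the braid relations, `τ_a² = R_{a,a+1}` and `τ_a x = (s_a x) τ_a` for `x` in
`MK_n`. -/
inductive SKRel {A : Type w} [Ring A] [Algebra k A] (c : J → J)
    (Q : J → J → MvPolynomial (Fin 2) k) (n : ℕ) (ι : MK k c n → A) (τ : Fin (n - 1) → A) :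
    A → A → Prop
  | map_add (x x' : MK k c n) : SKRel c Q n ι τ (ι (x + x')) (ι x + ι x')
  | map_mul (x x' : MK k c n) : SKRel c Q n ι τ (ι (x * x')) (ι x * ι x')
  | map_scalar (r : k) : SKRel c Q n ι τ (ι (algebraMap k _ r)) (algebraMap k A r)
  | τ_τ (a b : Fin (n - 1)) : Far a b → SKRel c Q n ι τ (τ a * τ b) (τ b * τ a)
  | braid (a b : Fin (n - 1)) : b.1 = a.1 + 1 →
      SKRel c Q n ι τ (τ b * τ a * τ b) (τ a * τ b * τ a)
  | τ_sq (a : Fin (n - 1)) :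
      SKRel c Q n ι τ (τ a ^ 2) (ι (MK.R Q (lo a) (hi a) (lo_ne_hi a)))
  | τ_ι (a : Fin (n - 1)) (x : MK k c n) :
      SKRel c Q n ι τ (τ a * ι x) (ι (MK.perm (simpleRefl a) x) * τ a)

variable (c : J → J) (Q : J → J → MvPolynomial (Fin 2) k) (n : ℕ)

/-- The defining relations, in the free algebra. -/
def skRel : FreeAlgebra k (MK k c n ⊕ Fin (n - 1)) → FreeAlgebra k (MK k c n ⊕ Fin (n - 1)) →
    Prop :=
  SKRel c Q n (fun x => FreeAlgebra.ι k (Sum.inl x)) (fun a => FreeAlgebra.ι k (Sum.inr a))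

/-- The algebra `SK_n` generated by the algebra `MK_n` and elements `τ_a`. -/
def SK : Type _ := RingQuot (skRel c Q n)

instance : Ring (SK c Q n) := inferInstanceAs (Ring (RingQuot (skRel c Q n)))

instance : Algebra k (SK c Q n) := inferInstanceAs (Algebra k (RingQuot (skRel c Q n)))

namespace SK

/-- The quotient map from the free algebra. -/
def mk : FreeAlgebra k (MK k c n ⊕ Fin (n - 1)) →ₐ[k] SK c Q n :=
  RingQuot.mkAlgHom k (skRel c Q n)

theorem mk_rel {x x' : FreeAlgebra k (MK k c n ⊕ Fin (n - 1))} (h : skRel c Q n x x') :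
    mk c Q n x = mk c Q n x' := RingQuot.mkAlgHom_rel k h

/-- The canonical homomorphism `MK_n → SK_n`. -/
def of : MK k c n →ₐ[k] SK c Q n where
  toFun x := mk c Q n (FreeAlgebra.ι k (Sum.inl x))
  map_one' := by
    have := mk_rel c Q n (.map_scalar 1)
    rwa [map_one, map_one, map_one] at this
  map_mul' x x' := by
    rw [mk_rel c Q n (.map_mul x x'), map_mul]
  map_zero' := by
    have := mk_rel c Q n (.map_scalar 0)
    rwa [map_zero, map_zero, map_zero] at this
  map_add' x x' := by
    rw [mk_rel c Q n (.map_add x x'), map_add]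
  commutes' r := by
    rw [mk_rel c Q n (.map_scalar r), AlgHom.commutes]

variable {n}

/-- The generator `τ_a`. -/
def τ (a : Fin (n - 1)) : SK c Q n := mk c Q n (FreeAlgebra.ι k (Sum.inr a))

/-- The generator `y_p`. -/
def y (p : Fin n) : SK c Q n := of c Q n (MK.y k c p)

/-- The Clifford generator `c_p`. -/
def cl (p : Fin n) : SK c Q n := of c Q n (MK.cl k c p)

/-- The idempotent `e(ν)`. -/
def e (ν : Fin n → J) : SK c Q n := of c Q n (MK.e k c ν)

/-- `(y_a - y_{a+1})⁻¹` -/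
def invSub (a : Fin (n - 1)) : SK c Q n := of c Q n (MK.invSub k c (lo a) (hi a) (lo_ne_hi a))

/-- `(y_a + y_{a+1})⁻¹` -/
def invAdd (a : Fin (n - 1)) : SK c Q n := of c Q n (MK.invAdd k c (lo a) (hi a) (lo_ne_hi a))

open Classical in
/-- The element that is multiplied with `e(ν)` to give `σ_a e(ν)`. -/
def sigmaAux (a : Fin (n - 1)) (ν : Fin n → J) : SK c Q n :=
  if ¬ SameClass c (ν (lo a)) (ν (hi a)) then τ c Q a
  else if c (ν (lo a)) ≠ ν (lo a) then
    (if ν (lo a) = ν (hi a) then τ c Q a - invSub c Q a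
    else τ c Q a + invAdd c Q a * (cl c Q (lo a) * cl c Q (hi a)))
  else τ c Q a - invSub c Q a + invAdd c Q a * (cl c Q (lo a) * cl c Q (hi a))

/-- The element `σ_a = ∑_ν σ_a e(ν)` of `SK_n`. -/
def sigma (a : Fin (n - 1)) : SK c Q n := ∑ ν : Fin n → J, sigmaAux c Q a ν * e c Q ν

theorem sigma_mul_e (a : Fin (n - 1)) (ν : Fin n → J) :
    sigma c Q a * e c Q ν = sigmaAux c Q a ν * e c Q ν := by
  have h : ∀ μ, e c Q μ * e c Q ν = if μ = ν then e c Q ν else 0 := by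
    intro μ
    have := congrArg (fun x => of c Q n (MK.of k c n x)) (MA.rel k c _ _ (.e_mul_e μ ν))
    simp only [map_mul, apply_ite (MK.of k c n), apply_ite (of c Q n), map_zero] at this
    refine this.trans ?_
    split_ifs with h
    · rw [h]; rfl
    · rfl
  simp only [sigma, Finset.sum_mul, mul_assoc, h, mul_ite, mul_zero, Finset.sum_ite_eq',
    Finset.mem_univ, if_true]

variable {c Q}

/-- Algebra homomorphisms out of `SK_n`. -/
def lift {A : Type*} [Ring A] [Algebra k A] (f : MK k c n →ₐ[k] A) (t : Fin (n - 1) → A)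
    (H : ∀ a b, SKRel c Q n f t a b → a = b) : SK c Q n →ₐ[k] A :=
  RingQuot.liftAlgHom k ⟨FreeAlgebra.lift k (Sum.elim f t), by
    intro a b h
    cases h with
    | map_add x x' => simp
    | map_mul x x' => simp
    | map_scalar r => simp
    | τ_τ a b h => simpa using H _ _ (.τ_τ a b h)
    | braid a b h => simpa using H _ _ (.braid a b h)
    | τ_sq a => simpa using H _ _ (.τ_sq a)
    | τ_ι a x => simpa using H _ _ (.τ_ι a x)⟩

section lift

variable {A : Type*} [Ring A] [Algebra k A] (f : MK k c n →ₐ[k] A) (t : Fin (n - 1) → A)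
    (H : ∀ a b, SKRel c Q n f t a b → a = b)

theorem lift_of (x : MK k c n) : lift f t H (of c Q n x) = f x := by
  refine (RingQuot.liftAlgHom_mkAlgHom_apply _ _ _ _).trans ?_
  rw [FreeAlgebra.lift_ι_apply, Sum.elim_inl]

theorem lift_τ (a : Fin (n - 1)) : lift f t H (τ c Q a) = t a := by
  refine (RingQuot.liftAlgHom_mkAlgHom_apply _ _ _ _).trans ?_
  rw [FreeAlgebra.lift_ι_apply, Sum.elim_inr]

end lift

theorem hom_ext {A : Type*} [Ring A] [Algebra k A] {f g : SK c Q n →ₐ[k] A}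
    (h : ∀ x, f (of c Q n x) = g (of c Q n x)) (hτ : ∀ a, f (τ c Q a) = g (τ c Q a)) :
    f = g := by
  refine RingQuot.ringQuot_ext' k f g ?_
  refine FreeAlgebra.hom_ext ?_
  funext x
  cases x with
  | inl x => exact h x
  | inr a => exact hτ a

theorem rel (a b : SK c Q n) (h : SKRel c Q n (of c Q n) (τ c Q) a b) : a = b := by
  cases h with
  | map_add x x' => simp
  | map_mul x x' => simp
  | map_scalar r => simp
  | τ_τ a b h => simpa [τ] using mk_rel c Q n (.τ_τ a b h)
  | braid a b h => simpa [τ] using mk_rel c Q n (.braid a b h)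
  | τ_sq a =>
    have := mk_rel c Q n (.τ_sq a)
    rw [map_pow] at this
    exact this
  | τ_ι a x =>
    have := mk_rel c Q n (.τ_ι a x)
    rw [map_mul, map_mul] at this
    exact this

theorem parity_rel (a b : SK c Q n)
    (h : SKRel c Q n ((of c Q n).comp MK.parity) (τ c Q) a b) : a = b := by
  cases h with
  | map_add x x' => simp
  | map_mul x x' => simp
  | map_scalar r => simp
  | τ_τ a b h => exact rel _ _ (.τ_τ a b h)
  | braid a b h => exact rel _ _ (.braid a b h)
  | τ_sq a =>
    rw [AlgHom.comp_apply, MK.parity_R]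
    exact rel _ _ (.τ_sq a)
  | τ_ι a x =>
    rw [AlgHom.comp_apply, AlgHom.comp_apply, MK.parity_perm]
    exact rel _ _ (.τ_ι a _)

/-- The parity automorphism: it extends the one of `MK_n`, and the `τ_a` are even. -/
def parity : SK c Q n →ₐ[k] SK c Q n := lift ((of c Q n).comp MK.parity) (τ c Q) parity_rel

theorem parity_parity (x : SK c Q n) : parity (parity x) = x := by
  have : (parity (c := c) (Q := Q) (n := n)).comp parity = AlgHom.id k _ := by
    apply hom_ext
    · intro x; simp [parity, lift_of, MK.parity_parity]
    · intro a; simp [parity, lift_τ]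
  exact DFunLike.congr_fun this x

variable (c Q n)

/-- The even part (`ε = 0`) and the odd part (`ε = 1`) of `SK_n`. -/
def part : ZMod 2 → Submodule k (SK c Q n) := parityPart parity

instance [Invertible (2 : k)] : GradedAlgebra (part c Q n) := superalgebra parity parity_parity

end SK

end SK

/-! ### The quiver Hecke-Clifford superalgebra -/

section RC

/-- Generators `y_p`, `c_p`, `e(ν)`, `σ_a`. -/
inductive RCGen (J : Type v) (n : ℕ) : Type v
  | y (p : Fin n)
  | cl (p : Fin n)
  | e (ν : Fin n → J)
  | σ (a : Fin (n - 1))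

variable {k : Type u} [CommRing k] {J : Type v} [Fintype J] [DecidableEq J]
  (c : J → J) (Q : J → J → MvPolynomial (Fin 2) k) (n : ℕ)

/-- The defining relations, in the free algebra. -/
def rcRel : FreeAlgebra k (RCGen J n) → FreeAlgebra k (RCGen J n) → Prop :=
  RCRel c Q (fun p => FreeAlgebra.ι k (RCGen.y p)) (fun p => FreeAlgebra.ι k (RCGen.cl p))
    (fun ν => FreeAlgebra.ι k (RCGen.e ν)) (fun a => FreeAlgebra.ι k (RCGen.σ a))

/-- The quiver Hecke-Clifford superalgebra `RC_n`. -/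
def RC : Type _ := RingQuot (rcRel c Q n)

instance : Ring (RC c Q n) := inferInstanceAs (Ring (RingQuot (rcRel c Q n)))

instance : Algebra k (RC c Q n) := inferInstanceAs (Algebra k (RingQuot (rcRel c Q n)))

namespace RC

/-- The quotient map from the free algebra. -/
def mk : FreeAlgebra k (RCGen J n) →ₐ[k] RC c Q n := RingQuot.mkAlgHom k (rcRel c Q n)

variable {n}

/-- The generator `y_p`. -/
def y (p : Fin n) : RC c Q n := mk c Q n (FreeAlgebra.ι k (RCGen.y p))

/-- The Clifford generator `c_p`. -/
def cl (p : Fin n) : RC c Q n := mk c Q n (FreeAlgebra.ι k (RCGen.cl p))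

/-- The idempotent `e(ν)`. -/
def e (ν : Fin n → J) : RC c Q n := mk c Q n (FreeAlgebra.ι k (RCGen.e ν))

/-- The generator `σ_a`. -/
def σ (a : Fin (n - 1)) : RC c Q n := mk c Q n (FreeAlgebra.ι k (RCGen.σ a))

theorem mk_rel {x x' : FreeAlgebra k (RCGen J n)} (h : rcRel c Q n x x') :
    mk c Q n x = mk c Q n x' := RingQuot.mkAlgHom_rel k h

variable {c Q}

theorem rel (a b : RC c Q n) (h : RCRel c Q (y c Q) (cl c Q) (e c Q) (σ c Q) a b) : a = b := by
  cases h with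
  | ma _ _ h =>
    cases h with
    | e_mul_e μ ν =>
      have := mk_rel c Q (.ma _ _ (.e_mul_e μ ν))
      rw [map_mul, apply_ite (mk c Q n), map_zero] at this
      exact this
    | sum_e =>
      have := mk_rel c Q (n := n) (.ma _ _ .sum_e)
      rw [map_one, map_sum] at this
      exact this
    | y_e p ν =>
      have := mk_rel c Q (.ma _ _ (.y_e p ν))
      rw [map_mul, map_mul] at this
      exact this
    | cl_e p ν =>
      have := mk_rel c Q (.ma _ _ (.cl_e p ν))
      rw [map_mul, map_mul] at this
      exact this
    | y_y p q =>
      have := mk_rel c Q (.ma _ _ (.y_y p q))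
      rw [map_mul, map_mul] at this
      exact this
    | cl_cl p q =>
      have := mk_rel c Q (.ma _ _ (.cl_cl p q))
      rw [map_add, map_mul, map_mul, apply_ite (mk c Q n), map_zero, map_ofNat] at this
      exact this
    | cl_y p q =>
      have := mk_rel c Q (.ma _ _ (.cl_y p q))
      rw [map_mul, apply_ite (mk c Q n), map_neg, map_mul] at this
      exact this
  | σ_e a ν =>
    have := mk_rel c Q (.σ_e a ν)
    rw [map_mul, map_mul] at this
    exact this
  | σ_cl a p =>
    have := mk_rel c Q (.σ_cl a p)
    rw [map_mul, map_mul] at this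
    exact this
  | σ_y a p ν h1 h2 =>
    have := mk_rel c Q (.σ_y a p ν h1 h2)
    simp only [map_mul] at this
    exact this
  | σ_y_hi a ν =>
    have := mk_rel c Q (.σ_y_hi a ν)
    simp only [map_mul, map_sub, apply_ite (mk c Q n), map_zero] at this
    exact this
  | y_hi_σ a ν =>
    have := mk_rel c Q (.y_hi_σ a ν)
    simp only [map_mul, map_sub, map_add, apply_ite (mk c Q n), map_zero] at this
    exact this
  | σ_sq a ν =>
    have := mk_rel c Q (.σ_sq a ν)
    simp only [map_mul, map_pow, map_evalAt] at this
    exact this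
  | σ_σ a b h =>
    have := mk_rel c Q (.σ_σ a b h)
    rw [map_mul, map_mul] at this
    exact this
  | braid a b ν h =>
    have := mk_rel c Q (.braid a b ν h)
    simp only [map_mul, map_sub, map_add, apply_ite (mk c Q n), map_zero, map_divDiff,
      map_neg] at this
    exact this

/-- Algebra homomorphisms out of `RC_n` are given by elements satisfying the relations. -/
def lift {A : Type*} [Ring A] [Algebra k A] (y' cl' : Fin n → A) (e' : (Fin n → J) → A)
    (σ' : Fin (n - 1) → A) (H : ∀ a b, RCRel c Q y' cl' e' σ' a b → a = b) : RC c Q n →ₐ[k] A :=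
  RingQuot.liftAlgHom k ⟨FreeAlgebra.lift k fun g => match g with
      | .y p => y' p
      | .cl p => cl' p
      | .e ν => e' ν
      | .σ a => σ' a, fun a b h => H _ _ (by
        have := RCRel.map (FreeAlgebra.lift k fun g : RCGen J n => match g with
          | .y p => y' p
          | .cl p => cl' p
          | .e ν => e' ν
          | .σ a => σ' a) h
        simpa only [FreeAlgebra.lift_ι_apply] using this)⟩

section lift

variable {A : Type*} [Ring A] [Algebra k A] (y' cl' : Fin n → A) (e' : (Fin n → J) → A)
    (σ' : Fin (n - 1) → A) (H : ∀ a b, RCRel c Q y' cl' e' σ' a b → a = b)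

@[simp] theorem lift_y (p : Fin n) : lift y' cl' e' σ' H (y c Q p) = y' p := by
  refine (RingQuot.liftAlgHom_mkAlgHom_apply _ _ _ _).trans ?_
  rw [FreeAlgebra.lift_ι_apply]

@[simp] theorem lift_cl (p : Fin n) : lift y' cl' e' σ' H (cl c Q p) = cl' p := by
  refine (RingQuot.liftAlgHom_mkAlgHom_apply _ _ _ _).trans ?_
  rw [FreeAlgebra.lift_ι_apply]

@[simp] theorem lift_e (ν : Fin n → J) : lift y' cl' e' σ' H (e c Q ν) = e' ν := by
  refine (RingQuot.liftAlgHom_mkAlgHom_apply _ _ _ _).trans ?_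
  rw [FreeAlgebra.lift_ι_apply]

@[simp] theorem lift_σ (a : Fin (n - 1)) : lift y' cl' e' σ' H (σ c Q a) = σ' a := by
  refine (RingQuot.liftAlgHom_mkAlgHom_apply _ _ _ _).trans ?_
  rw [FreeAlgebra.lift_ι_apply]

end lift

theorem hom_ext {A : Type*} [Ring A] [Algebra k A] {f g : RC c Q n →ₐ[k] A}
    (hy : ∀ p, f (y c Q p) = g (y c Q p)) (hcl : ∀ p, f (cl c Q p) = g (cl c Q p))
    (he : ∀ ν, f (e c Q ν) = g (e c Q ν)) (hσ : ∀ a, f (σ c Q a) = g (σ c Q a)) : f = g := by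
  refine RingQuot.ringQuot_ext' k f g ?_
  refine FreeAlgebra.hom_ext ?_
  funext x
  cases x with
  | y p => exact hy p
  | cl p => exact hcl p
  | e ν => exact he ν
  | σ a => exact hσ a

/-- The parity automorphism: `y_p`, `e(ν)`, `σ_a` are even, `c_p` is odd. -/
def parity : RC c Q n →ₐ[k] RC c Q n :=
  lift (y c Q) (fun p => -cl c Q p) (e c Q) (σ c Q) fun _ _ h => RCRel.eq_of_neg rel h

theorem parity_parity (x : RC c Q n) : parity (parity x) = x := by
  have : (parity (c := c) (Q := Q) (n := n)).comp parity = AlgHom.id k _ := by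
    apply hom_ext <;> intro <;> simp [parity]
  exact DFunLike.congr_fun this x

variable (c Q n)

/-- The even part (`ε = 0`) and the odd part (`ε = 1`) of `RC_n`. -/
def part : ZMod 2 → Submodule k (RC c Q n) := parityPart parity

instance [Invertible (2 : k)] : GradedAlgebra (part c Q n) := superalgebra parity parity_parity

end RC

end RC

end QHC
end

noncomputable section

namespace QHC

universe u v w

/-! ### The polynomial representations of `MA_n` -/

section PolynomialRepresentation

/-! The four cases in the definition of `σ_a` are one formula, `σ_a = τ_a + r_{a,a+1}`
(`SK.sigma_eq`), where `r_{p,q}` is the element `rMatrix` of `MK_n`. It is antisymmetric in `p, q`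
and equivariant for permutations, so `τ_a` anticommutes with `r_{a,a+1}`. Its square is the sum of
the inverse squares subtracted in `R_{p,q}`, so `R = q - r²` (`MK.R_eq`) with `q` the element `∑
Q_{ν_p,ν_q}(y_p, y_q) e(ν)`. Both `q` and `R` are central, by the sign rules for `Q` and because
conjugation by a Clifford generator exchanges `y_p - y_q` and `y_p + y_q` up to sign.

Hence `σ_a² = R + r² = q`. For the braid relation the main input is the associative Yang-Baxter
equation `r₁₂ r₁₃ + r₁₃ r₂₃ = r₂₃ r₁₂` (`MK.rMatrix_associative`), which is partial fractions with
Clifford signs. It cancels everything in `σ_b σ_a σ_b - σ_a σ_b σ_a` except `r₁₃ (q₂₃ - q₁₂)`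
(`braid_defect`), and this is the sum of the two divided differences in the relation
(`MK.rMatrix_mul_qElem_sub`). The other relations express how `r` moves past `y_p`, `c_p` and
`e(ν)`.

For injectivity, `SK_n` acts on functions from `S_n` to `MK_n` by explicit operators (`MK.tauOp`),
modelled on left multiplication on the elements `τ_w`. That these operators satisfy the defining
relations is checked directly, so no products `τ_w` need to be shown independent of a reduced word.
Pulling back along `RC_n → SK_n`, it suffices that an element of `RC_n` which kills the delta
function at `1` is zero (`RC.eq_zero_of_rep`).

This is proved along the chain of subalgebras generated by `MA_n` and `σ_0, …, σ_{r-1}` (indices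
from `0`). Each is spanned over the preceding one by the descending products `σ_r ⋯ σ_i`,
corresponding to coset representatives in the symmetric groups (`levelAlg_succ_le`). On the delta
function at `1` such a product gives the delta function of its permutation plus terms that are
larger for the value of `w⁻¹` at the last position (`RC.rep_descProd`). This triangularity removes
the coefficients one by one. At the bottom of the chain one needs `MA_n → MK_n` to be injective
(`MA.of_injective`), i.e. that the denominators are regular, which is visible in the polynomial
representations of `MA_n`. -/

/-- The substitution `X_a ↦ X_a - t X_b` is injective, with inverse `X_a ↦ X_a + t X_b`, and carries
the factor to the regular element `X_a`. This works over a ring `k` with zero divisors. -/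
theorem isLeftRegular_X_add_C_mul_X {k : Type*} [CommRing k] {ι : Type*}
    {a b : ι} (h : a ≠ b) (t : k) :
    IsLeftRegular (MvPolynomial.X a + MvPolynomial.C t * MvPolynomial.X b : MvPolynomial ι k) := by
  classical
  set shift : k → MvPolynomial ι k →ₐ[k] MvPolynomial ι k := fun s =>
    MvPolynomial.aeval fun i =>
      if i = a then MvPolynomial.X a + MvPolynomial.C s * MvPolynomial.X b else MvPolynomial.X i
    with hshift
  have shift_a : ∀ s, shift s (MvPolynomial.X a) =
      MvPolynomial.X a + MvPolynomial.C s * MvPolynomial.X b := fun s => by simp [hshift]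
  have shift_b : ∀ s, shift s (MvPolynomial.X b) = MvPolynomial.X b := fun s => by
    simp [hshift, h.symm]
  have shift_C : ∀ s r, shift s (MvPolynomial.C r) = MvPolynomial.C r := fun s r => by
    simp [hshift, MvPolynomial.algebraMap_eq]
  have hinj : Function.Injective (shift (-t)) := by
    have hcomp : (shift t).comp (shift (-t)) = AlgHom.id k _ := by
      refine MvPolynomial.algHom_ext fun i => ?_
      by_cases hi : i = a
      · subst hi
        simp [shift_a, shift_b, shift_C]
      · simp [hshift, hi]
    exact fun x y hxy => by
      simpa using (DFunLike.congr_fun hcomp x).symm.trans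
        ((congrArg (shift t) hxy).trans (DFunLike.congr_fun hcomp y))
  intro p q hpq
  apply hinj
  refine (MvPolynomial.isRegular_X (n := a)).left ?_
  have := congrArg (shift (-t)) hpq
  simpa [shift_a, shift_b, shift_C] using this

/-- The evaluation of polynomials at commuting elements of a not necessarily commutative
algebra. -/
def aevalOfCommute {k : Type*} [CommRing k] {A : Type*} [Ring A] [Algebra k A] {ι : Type*}
    (x : ι → A) (hx : ∀ i j, Commute (x i) (x j)) : MvPolynomial ι k →ₐ[k] A :=
  have comm := Algebra.isMulCommutative_adjoin k (s := Set.range x) (by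
    rintro _ ⟨i, rfl⟩ _ ⟨j, rfl⟩
    exact hx i j)
  letI : CommRing (Algebra.adjoin k (Set.range x)) :=
    { (inferInstance : Ring (Algebra.adjoin k (Set.range x))) with
      mul_comm := comm.is_comm.comm }
  (Algebra.adjoin k (Set.range x)).val.comp
    (MvPolynomial.aeval fun i => ⟨x i, Algebra.subset_adjoin ⟨i, rfl⟩⟩)

theorem aevalOfCommute_X {k : Type*} [CommRing k] {A : Type*} [Ring A] [Algebra k A] {ι : Type*}
    (x : ι → A) (hx : ∀ i j, Commute (x i) (x j)) (i : ι) :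
    aevalOfCommute (k := k) x hx (MvPolynomial.X i) = x i := by
  simp [aevalOfCommute]

/-! ### Subsets of positions, Clifford signs and the representation on the span of the `c_I y^m
e(ν)`. -/

variable {n : ℕ}

/-- Change the `p`-th entry of a subset, given by its indicator function. -/
def toggle (p : Fin n) (I : Fin n → Bool) : Fin n → Bool := Function.update I p (!I p)

@[simp] theorem toggle_self (p : Fin n) (I : Fin n → Bool) : toggle p I p = !I p := by
  simp [toggle]

theorem toggle_of_ne {p q : Fin n} (h : q ≠ p) (I : Fin n → Bool) : toggle p I q = I q := by
  simp [toggle, h]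

@[simp] theorem toggle_toggle (p : Fin n) (I : Fin n → Bool) : toggle p (toggle p I) = I := by
  funext q
  by_cases h : q = p
  · subst h; simp
  · simp [toggle_of_ne h]

theorem toggle_comm (p q : Fin n) (I : Fin n → Bool) :
    toggle p (toggle q I) = toggle q (toggle p I) := by
  by_cases h : p = q
  · rw [h]
  funext r
  by_cases hp : r = p
  · subst hp; rw [toggle_self, toggle_of_ne h, toggle_of_ne h, toggle_self]
  by_cases hq : r = q
  · subst hq; rw [toggle_self, toggle_of_ne (Ne.symm h), toggle_of_ne (Ne.symm h), toggle_self]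
  · simp only [toggle_of_ne hp, toggle_of_ne hq]

variable (k : Type u) [CommRing k]

/-- The sign in `c_p c_I = ± c_{I ∆ {p}}`, where `c_I` is ordered according to the list. -/
def cliffordSign (p : Fin n) (I : Fin n → Bool) : List (Fin n) → k
  | [] => 1
  | q :: l => if q = p then 1 else (if I q then -1 else 1) * cliffordSign p I l

variable {k}

theorem cliffordSign_mul_self (p : Fin n) (I : Fin n → Bool) (l : List (Fin n)) :
    cliffordSign k p I l * cliffordSign k p (toggle p I) l = 1 := by
  induction l with
  | nil => simp [cliffordSign]
  | cons q l ih =>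
    unfold cliffordSign
    by_cases h : q = p
    · simp [h]
    · rw [if_neg h, if_neg h, toggle_of_ne h, mul_mul_mul_comm, ih]
      split_ifs <;> simp

/-- The sign only counts the elements of `I` that precede `p`. -/
theorem cliffordSign_toggle (p : Fin n) (I : Fin n → Bool) (l : List (Fin n)) :
    cliffordSign k p (toggle p I) l = cliffordSign k p I l := by
  induction l with
  | nil => simp [cliffordSign]
  | cons q l ih =>
    unfold cliffordSign
    by_cases h : q = p
    · simp [h]
    · rw [if_neg h, if_neg h, toggle_of_ne h, ih]

theorem cliffordSign_toggle_of_notMem {p q : Fin n} {l : List (Fin n)} (h : q ∉ l)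
    (I : Fin n → Bool) : cliffordSign k p (toggle q I) l = cliffordSign k p I l := by
  induction l with
  | nil => simp [cliffordSign]
  | cons r l ih =>
    rw [List.mem_cons, not_or] at h
    unfold cliffordSign
    rw [ih h.2, toggle_of_ne (Ne.symm h.1)]

/-- Toggling the earlier of the two positions changes the sign attached to the later one; toggling
the later one does not affect the earlier. Exactly one of the two orders therefore picks up an extra
`-1`. -/
theorem cliffordSign_anticomm {p q : Fin n} (hpq : p ≠ q) (I : Fin n → Bool) {l : List (Fin n)}
    (hl : l.Nodup) (hp : p ∈ l) (hq : q ∈ l) :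
    cliffordSign k p I l * cliffordSign k q (toggle p I) l =
      -(cliffordSign k q I l * cliffordSign k p (toggle q I) l) := by
  induction l with
  | nil => simp at hp
  | cons r l ih =>
    rw [List.nodup_cons] at hl
    unfold cliffordSign
    by_cases h1 : r = p
    · subst h1
      rw [if_pos rfl, if_neg hpq, if_neg hpq, if_pos rfl, toggle_self,
        cliffordSign_toggle_of_notMem hl.1]
      cases I r <;> simp
    by_cases h2 : r = q
    · subst h2
      rw [if_pos rfl, if_neg (Ne.symm hpq), if_neg (Ne.symm hpq), if_pos rfl, toggle_self,
        cliffordSign_toggle_of_notMem hl.1]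
      cases I r <;> simp
    · rw [if_neg h1, if_neg h2, if_neg h1, if_neg h2, toggle_of_ne h1, toggle_of_ne h2,
        mul_mul_mul_comm, mul_mul_mul_comm _ (cliffordSign k q I l),
        ih hl.2 ((List.mem_cons.mp hp).resolve_left (Ne.symm h1))
        ((List.mem_cons.mp hq).resolve_left (Ne.symm h2)), mul_neg]

variable {J : Type v} (c : J → J)

theorem flip_flip (hc : Function.Involutive c) (p : Fin n) (ν : Fin n → J) :
    flip c p (flip c p ν) = ν := by
  funext q
  by_cases h : q = p
  · subst h; simp [flip, hc _]
  · simp [flip, h]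

/-- Apply the involution to the entries of `ν` at the places in `I` that occur in the list. -/
def flipOn (l : List (Fin n)) (I : Fin n → Bool) (ν : Fin n → J) : Fin n → J := fun q =>
  if q ∈ l ∧ I q then c (ν q) else ν q

theorem flipOn_toggle (hc : Function.Involutive c) {l : List (Fin n)} {p : Fin n} (hp : p ∈ l)
    (I : Fin n → Bool) (ν : Fin n → J) :
    flipOn c l (toggle p I) ν = flip c p (flipOn c l I ν) := by
  funext q
  by_cases h : q = p
  · subst h
    cases hI : I q <;> simp [flipOn, flip, hp, hI, hc _]
  · simp [flipOn, flip, h, toggle_of_ne h]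

variable [Fintype J] [DecidableEq J]

/-- The space of the polynomial representation attached to `ν`, with basis
`c_I y^m e(ν)`. -/
abbrev PolyRep (k : Type u) [CommRing k] (n : ℕ) : Type u :=
  (Fin n → Bool) → MvPolynomial (Fin n) k

namespace PolyRep

/-- The action of `y_p`. -/
def yOp (p : Fin n) : Module.End k (PolyRep k n) where
  toFun f I := if I p then -(MvPolynomial.X p * f I) else MvPolynomial.X p * f I
  map_add' f g := by
    funext I; simp only [Pi.add_apply]; split_ifs <;> ring
  map_smul' r f := by
    funext I; simp only [Pi.smul_apply, RingHom.id_apply]; split_ifs <;> simp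

/-- The action of `c_p`. -/
def clOp (p : Fin n) : Module.End k (PolyRep k n) where
  toFun f I := cliffordSign k p I (List.finRange n) • f (toggle p I)
  map_add' f g := by
    funext I; simp only [Pi.add_apply, smul_add]
  map_smul' r f := by
    funext I; simp only [Pi.smul_apply, RingHom.id_apply, smul_comm r]

/-- The action of `e(μ)`. -/
def eOp (ν μ : Fin n → J) : Module.End k (PolyRep k n) where
  toFun f I := if flipOn c (List.finRange n) I ν = μ then f I else 0
  map_add' f g := by
    funext I; simp only [Pi.add_apply]; split_ifs <;> simp
  map_smul' r f := by
    funext I; simp only [Pi.smul_apply, RingHom.id_apply]; split_ifs <;> simp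

/-- The operators imitate left multiplication on `∑ c_I f_I(y) e(ν)`: moving `y_p` past `c_I` gives
a sign when `p ∈ I`, and `c_I e(ν)` has left idempotent `flipOn c _ I ν`. -/
theorem maRel_eq (hc : Function.Involutive c) (ν : Fin n → J) (a b : Module.End k (PolyRep k n))
    (h : MARel c yOp clOp (eOp c ν) a b) : a = b := by
  refine LinearMap.ext fun f => funext fun I => ?_
  cases h with
  | e_mul_e μ μ' =>
    by_cases hμ : μ = μ'
    · subst hμ
      simp only [if_true, Module.End.mul_apply, eOp, LinearMap.coe_mk, AddHom.coe_mk]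
      split_ifs <;> rfl
    · simp only [if_neg hμ, Module.End.mul_apply, eOp, LinearMap.coe_mk, AddHom.coe_mk]
      split_ifs with h1 h2
      · exact absurd (h1.symm.trans h2) hμ
      · rfl
      · rfl
  | sum_e => simp [eOp, LinearMap.sum_apply, Finset.sum_apply]
  | y_e p μ =>
    simp only [Module.End.mul_apply, eOp, yOp, LinearMap.coe_mk, AddHom.coe_mk]
    split_ifs <;> simp
  | cl_e p μ =>
    simp only [Module.End.mul_apply, eOp, clOp, LinearMap.coe_mk, AddHom.coe_mk]
    rw [flipOn_toggle c hc (List.mem_finRange p)]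
    have : flip c p (flipOn c (List.finRange n) I ν) = μ ↔
        flipOn c (List.finRange n) I ν = flip c p μ :=
      ⟨fun h => by rw [← h, flip_flip c hc], fun h => by rw [h, flip_flip c hc]⟩
    rw [if_congr this rfl rfl]
    split_ifs <;> simp
  | y_y p q =>
    simp only [Module.End.mul_apply, yOp, LinearMap.coe_mk, AddHom.coe_mk]
    split_ifs <;> ring
  | cl_cl p q =>
    by_cases hpq : p = q
    · subst hpq
      rw [if_pos rfl]
      simp only [Module.End.mul_apply, LinearMap.add_apply, Pi.add_apply, clOp, LinearMap.coe_mk,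
        AddHom.coe_mk, smul_smul, cliffordSign_mul_self, toggle_toggle, one_smul]
      rw [← one_add_one_eq_two, LinearMap.add_apply]; rfl
    · rw [if_neg hpq]
      simp only [Module.End.mul_apply, LinearMap.add_apply, Pi.add_apply, clOp, LinearMap.coe_mk,
        AddHom.coe_mk, smul_smul, LinearMap.zero_apply, Pi.zero_apply]
      rw [cliffordSign_anticomm hpq I (List.nodup_finRange n) (List.mem_finRange p)
        (List.mem_finRange q), toggle_comm, neg_smul, neg_add_cancel]
  | cl_y p q =>
    by_cases hpq : p = q
    · subst hpq
      rw [if_pos rfl]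
      simp only [Module.End.mul_apply, LinearMap.neg_apply, Pi.neg_apply, clOp, yOp,
        LinearMap.coe_mk, AddHom.coe_mk, toggle_self]
      cases I p <;> simp
    · rw [if_neg hpq]
      simp only [Module.End.mul_apply, clOp, yOp, LinearMap.coe_mk, AddHom.coe_mk,
        toggle_of_ne (Ne.symm hpq)]
      split_ifs <;> simp

/-- The polynomial representation of `MA_n` attached to `ν`. -/
def rep (hc : Function.Involutive c) (ν : Fin n → J) : MA k c n →ₐ[k] Module.End k (PolyRep k n) :=
  MA.lift yOp clOp (eOp c ν) (maRel_eq c hc ν)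

end PolyRep

/-! ### Joint faithfulness of the polynomial representations and regularity of the denominators. -/

namespace MA

variable (k)

theorem mk_surjective : Function.Surjective (mk k c n) :=
  RingQuot.mkAlgHom_surjective k (maRel k c n)

theorem y_mul_cl (p q : Fin n) :
    y k c q * cl k c p = if p = q then -(cl k c p * y k c q) else cl k c p * y k c q := by
  have := rel k c _ _ (.cl_y p q)
  split_ifs with h
  · rw [this, if_pos h, neg_neg]
  · rw [this, if_neg h]

theorem cl_mul_cl_self [Invertible (2 : k)] (p : Fin n) : cl k c p * cl k c p = 1 := by
  have := rel k c _ _ (.cl_cl p p)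
  rw [if_pos rfl, ← two_smul k] at this
  have h2 := congrArg (fun x => (⅟2 : k) • x) this
  simp only [smul_smul, invOf_mul_self, one_smul] at h2
  rw [h2, ← map_ofNat (algebraMap k (MA k c n)) 2, Algebra.smul_def, ← map_mul, invOf_mul_self,
    map_one]

theorem cl_mul_cl_of_ne {p q : Fin n} (h : p ≠ q) : cl k c p * cl k c q = -(cl k c q * cl k c p) := by
  have := rel k c _ _ (.cl_cl p q)
  rw [if_neg h] at this
  exact eq_neg_of_add_eq_zero_left this

/-- The ordered product of the `c_p` with `p ∈ I`, `p` running through the list. -/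
def clProd (l : List (Fin n)) (I : Fin n → Bool) : MA k c n :=
  (l.map fun q => if I q then cl k c q else 1).prod

variable {k}

theorem clProd_cons (q : Fin n) (l : List (Fin n)) (I : Fin n → Bool) :
    clProd k c (q :: l) I = (if I q then cl k c q else 1) * clProd k c l I := by
  simp [clProd]

theorem clProd_toggle_of_notMem {p : Fin n} {l : List (Fin n)} (h : p ∉ l) (I : Fin n → Bool) :
    clProd k c l (toggle p I) = clProd k c l I := by
  unfold clProd
  congr 1
  refine List.map_congr_left fun q hq => ?_
  rw [toggle_of_ne]
  rintro rfl
  exact h hq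

/-- Moving `c_p` to its place in the ordered product costs a sign for each factor passed, which is
the recursion of `cliffordSign`; at its place it is inserted or cancels by `c_p² = 1`. -/
theorem cl_mul_clProd [Invertible (2 : k)] (p : Fin n) (I : Fin n → Bool) {l : List (Fin n)}
    (hl : l.Nodup) (hp : p ∈ l) :
    cl k c p * clProd k c l I = cliffordSign k p I l • clProd k c l (toggle p I) := by
  induction l with
  | nil => simp at hp
  | cons q l ih =>
    rw [List.nodup_cons] at hl
    rw [clProd_cons, clProd_cons, cliffordSign]
    by_cases h : q = p
    · subst h
      rw [if_pos rfl, one_smul, toggle_self, clProd_toggle_of_notMem c hl.1, ← mul_assoc]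
      cases I q <;> simp [cl_mul_cl_self]
    · rw [if_neg h, toggle_of_ne h, mul_smul]
      have ih' := ih hl.2 ((List.mem_cons.mp hp).resolve_left (Ne.symm h))
      cases I q
      · simpa using ih'
      · simp only [if_true]
        rw [← mul_assoc, cl_mul_cl_of_ne k c (Ne.symm h), neg_mul, mul_assoc, ih', mul_smul_comm,
          neg_one_smul]

theorem y_mul_clProd (p : Fin n) (I : Fin n → Bool) {l : List (Fin n)} (hl : l.Nodup) :
    y k c p * clProd k c l I =
      if p ∈ l ∧ I p then -(clProd k c l I * y k c p) else clProd k c l I * y k c p := by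
  induction l with
  | nil => simp [clProd]
  | cons q l ih =>
    rw [List.nodup_cons] at hl
    rw [clProd_cons, ← mul_assoc]
    have h1 : y k c p * (if I q then cl k c q else 1) =
        if q = p ∧ I p then -((if I q then cl k c q else 1) * y k c p)
          else (if I q then cl k c q else 1) * y k c p := by
      by_cases h : q = p
      · subst h
        cases I q <;> simp [y_mul_cl]
      · cases I q <;> simp [y_mul_cl, h]
    rw [h1]
    by_cases h : q = p
    · subst h
      have ih' := ih hl.2
      rw [if_neg (fun h => hl.1 h.1)] at ih'
      cases I q <;> simp [mul_assoc, ih']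
    · rw [if_neg (fun h' => h h'.1), mul_assoc, ih hl.2]
      have : (p ∈ q :: l ∧ I p) ↔ (p ∈ l ∧ I p) := by simp [Ne.symm h]
      rw [if_congr this rfl rfl]
      split_ifs <;> simp [mul_assoc]

theorem clProd_mul_e (ν : Fin n → J) (I : Fin n → Bool) {l : List (Fin n)} (hl : l.Nodup) :
    clProd k c l I * e k c ν = e k c (flipOn c l I ν) * clProd k c l I := by
  induction l with
  | nil =>
    have : flipOn c [] I ν = ν := by funext; simp [flipOn]
    simp [clProd, this]
  | cons q l ih =>
    rw [List.nodup_cons] at hl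
    rw [clProd_cons, mul_assoc, ih hl.2, ← mul_assoc, ← mul_assoc]
    congr 1
    cases hq : I q
    · have : flipOn c (q :: l) I ν = flipOn c l I ν := by
        funext r
        by_cases h : r = q
        · subst h; simp [flipOn, hq]
        · simp [flipOn, h]
      simp [this]
    · have : flipOn c (q :: l) I ν = flip c q (flipOn c l I ν) := by
        funext r
        by_cases h : r = q
        · subst h; simp [flipOn, flip, hq, hl.1]
        · simp [flipOn, flip, h]
      simp only [if_true, this]
      exact rel k c _ _ (.cl_e _ _)

theorem e_mul_e (μ ν : Fin n → J) : e k c μ * e k c ν = if μ = ν then e k c ν else 0 := by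
  rw [rel k c _ _ (.e_mul_e μ ν)]
  split_ifs with h
  · rw [h]
  · rfl

variable (k) in
/-- The evaluation of polynomials at `y_1, …, y_n`. -/
def ofPoly : MvPolynomial (Fin n) k →ₐ[k] MA k c n :=
  aevalOfCommute (y k c) fun p q => commute_y p q

theorem ofPoly_X (p : Fin n) : ofPoly k c (MvPolynomial.X p) = y k c p :=
  aevalOfCommute_X _ _ p

theorem commute_ofPoly_e (P : MvPolynomial (Fin n) k) (ν : Fin n → J) :
    Commute (ofPoly k c P) (e k c ν) := by
  induction P using MvPolynomial.induction_on with
  | C r =>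
    rw [← MvPolynomial.algebraMap_eq, AlgHom.commutes]
    exact Algebra.commute_algebraMap_left _ _
  | add P P' h h' => rw [map_add]; exact h.add_left h'
  | mul_X P p h =>
    rw [map_mul, ofPoly_X]
    exact h.mul_left (rel k c _ _ (.y_e p ν))

/-- The map from the polynomial representation attached to `ν` to `MA_n e(ν)`. -/
def ofPolyRep (ν : Fin n → J) : PolyRep k n →ₗ[k] MA k c n where
  toFun f := ∑ I, clProd k c (List.finRange n) I * ofPoly k c (f I) * e k c ν
  map_add' f g := by
    rw [← Finset.sum_add_distrib]
    exact Finset.sum_congr rfl fun I _ => by rw [Pi.add_apply, map_add, mul_add, add_mul]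
  map_smul' r f := by
    rw [RingHom.id_apply, Finset.smul_sum]
    exact Finset.sum_congr rfl fun I _ => by
      rw [Pi.smul_apply, map_smul, mul_smul_comm, smul_mul_assoc]

theorem ofPolyRep_apply (ν : Fin n → J) (f : PolyRep k n) : ofPolyRep c ν f =
    ∑ I, clProd k c (List.finRange n) I * ofPoly k c (f I) * e k c ν := rfl

/-- This intertwining property makes the representations jointly faithful without a basis of `MA_n`:
the action on the cyclic vector determines `x e(ν)`. -/
theorem ofPolyRep_rep [Invertible (2 : k)] (hc : Function.Involutive c) (ν : Fin n → J)
    (x : MA k c n) (f : PolyRep k n) :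
    ofPolyRep c ν (PolyRep.rep c hc ν x f) = x * ofPolyRep c ν f := by
  obtain ⟨x, rfl⟩ := mk_surjective k c x
  induction x using FreeAlgebra.induction generalizing f with
  | grade0 r =>
    rw [AlgHom.commutes, AlgHom.commutes, Module.algebraMap_end_apply, map_smul,
      Algebra.smul_def]
  | add a b ha hb => rw [map_add, map_add, LinearMap.add_apply, map_add, ha, hb, add_mul]
  | mul a b ha hb => rw [map_mul, map_mul, Module.End.mul_apply, ha, hb, mul_assoc]
  | grade1 g =>
    cases g with
    | y p =>
      change ofPolyRep c ν (PolyRep.rep c hc ν (y k c p) f) = y k c p * _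
      rw [PolyRep.rep, lift_y, ofPolyRep_apply, ofPolyRep_apply, Finset.mul_sum]
      refine Finset.sum_congr rfl fun I _ => ?_
      rw [← mul_assoc, ← mul_assoc, y_mul_clProd c p I (List.nodup_finRange n)]
      simp only [PolyRep.yOp, LinearMap.coe_mk, AddHom.coe_mk, List.mem_finRange, true_and]
      split_ifs <;> simp [ofPoly_X, mul_assoc]
    | cl p =>
      change ofPolyRep c ν (PolyRep.rep c hc ν (cl k c p) f) = cl k c p * _
      rw [PolyRep.rep, lift_cl, ofPolyRep_apply, ofPolyRep_apply, Finset.mul_sum]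
      -- `clOp` reads the function at the toggled index, so the sum is reindexed by the involution
      -- `toggle p`.
      refine Fintype.sum_bijective (toggle p)
        (Function.Involutive.bijective (toggle_toggle p)) _ _ fun I => ?_
      rw [← mul_assoc, ← mul_assoc, cl_mul_clProd c p _ (List.nodup_finRange n)
        (List.mem_finRange p), toggle_toggle, cliffordSign_toggle]
      simp only [PolyRep.clOp, LinearMap.coe_mk, AddHom.coe_mk, map_smul, mul_smul_comm,
        smul_mul_assoc]
    | e μ =>
      change ofPolyRep c ν (PolyRep.rep c hc ν (e k c μ) f) = e k c μ * _
      rw [PolyRep.rep, lift_e, ofPolyRep_apply, ofPolyRep_apply, Finset.mul_sum]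
      refine Finset.sum_congr rfl fun I _ => ?_
      rw [mul_assoc _ _ (e k c ν), mul_assoc _ _ (e k c ν), (commute_ofPoly_e c _ ν).eq,
        (commute_ofPoly_e c _ ν).eq, ← mul_assoc, ← mul_assoc,
        clProd_mul_e c ν I (List.nodup_finRange n), ← mul_assoc,
        mul_assoc (e k c μ), clProd_mul_e c ν I (List.nodup_finRange n), ← mul_assoc (e k c μ),
        e_mul_e]
      simp only [PolyRep.eOp, LinearMap.coe_mk, AddHom.coe_mk]
      by_cases h : flipOn c (List.finRange n) I ν = μ
      · rw [if_pos h, if_pos h.symm]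
      · rw [if_neg h, if_neg (Ne.symm h), map_zero, mul_zero, zero_mul, zero_mul]

/-- The vector corresponding to `e(ν)`. -/
def cyclicVector (k : Type u) [CommRing k] (n : ℕ) : PolyRep k n := Pi.single (fun _ => false) 1

theorem ofPolyRep_cyclicVector (ν : Fin n → J) :
    ofPolyRep c ν (cyclicVector k n) = e k c ν := by
  rw [ofPolyRep_apply, Finset.sum_eq_single (fun _ => false)]
  · simp [cyclicVector, clProd]
  · intro I _ hI
    simp [cyclicVector, hI]
  · simp

theorem eq_zero_of_rep [Invertible (2 : k)] (hc : Function.Involutive c) {x : MA k c n}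
    (h : ∀ ν, PolyRep.rep c hc ν x (cyclicVector k n) = 0) : x = 0 := by
  rw [← mul_one x, rel k c _ _ .sum_e, Finset.mul_sum]
  refine Finset.sum_eq_zero fun ν _ => ?_
  rw [← ofPolyRep_cyclicVector, ← ofPolyRep_rep c hc, h, map_zero]

/-- On the component `I` the element `y_a ± y_b` acts as multiplication by `±X_a ± X_b`, with signs
depending on whether `a` and `b` lie in `I`; all these linear forms are regular. -/
theorem denom_le_nonZeroDivisorsLeft [Invertible (2 : k)] (hc : Function.Involutive c) :
    denom k c n ≤ nonZeroDivisorsLeft (MA k c n) := by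
  refine Submonoid.closure_le.mpr ?_
  rintro x ⟨a, b, hab, hx⟩
  refine fun z hz => eq_zero_of_rep c hc fun ν => ?_
  have h0 := LinearMap.congr_fun (congrArg (PolyRep.rep c hc ν) hz) (cyclicVector k n)
  rw [map_mul, Module.End.mul_apply, map_zero, LinearMap.zero_apply] at h0
  set f := PolyRep.rep c hc ν z (cyclicVector k n)
  funext I
  have hI := congrFun h0 I
  have key : ∀ t : k, (MvPolynomial.X a + MvPolynomial.C t * MvPolynomial.X b) * f I = 0 →
      f I = 0 := fun t ht =>
    (isLeftRegular_X_add_C_mul_X hab t) (ht.trans (mul_zero _).symm)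
  have k1 := key 1
  have k2 := key (-1)
  simp only [map_one, one_mul, map_neg, neg_mul, ← sub_eq_add_neg] at k1 k2
  change f I = 0
  obtain rfl | rfl := hx <;>
    simp only [PolyRep.rep, map_sub, map_add, lift_y, LinearMap.sub_apply, LinearMap.add_apply,
      Pi.sub_apply, Pi.add_apply, PolyRep.yOp, LinearMap.coe_mk, AddHom.coe_mk,
      Pi.zero_apply] at hI <;> split_ifs at hI
  -- The eight cases are the two kinds of denominator times the four possibilities for `I a` and `I
  -- b`; `k1` treats `X_a + X_b` and `k2` treats `X_a - X_b`, up to a global sign.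
  · exact k2 (by linear_combination -hI)
  · exact k1 (by linear_combination -hI)
  · exact k1 (by linear_combination hI)
  · exact k2 (by linear_combination hI)
  · exact k1 (by linear_combination -hI)
  · exact k2 (by linear_combination -hI)
  · exact k2 (by linear_combination hI)
  · exact k1 (by linear_combination hI)

theorem of_injective [Invertible (2 : k)] (hc : Function.Involutive c) :
    Function.Injective (MK.of k c n) :=
  OreLocalization.numeratorHom_inj (denom_le_nonZeroDivisorsLeft c hc)

end MA
end PolynomialRepresentation

/-! ### Substitutions in `evalAt` -/

section EvalAt

variable {k : Type u} [CommRing k] {A : Type v} [Ring A] [Algebra k A]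

theorem evalAt_X_X (P : MvPolynomial (Fin 2) k) :
    evalAt P (MvPolynomial.X 0) (MvPolynomial.X 1) = P := by
  conv_rhs => rw [P.as_sum]
  refine Finset.sum_congr rfl fun m _ => ?_
  rw [MvPolynomial.monomial_eq, Finsupp.prod_fintype _ _ (fun _ => pow_zero _), Fin.prod_univ_two,
    MvPolynomial.smul_eq_C_mul]

/-- For commuting `s, t` evaluation is the algebra homomorphism `f` below. Composing it with the
substitution and evaluating the generic polynomial gives the claim; it turns the identities of
`IsAdmissible` into identities of values. -/
theorem evalAt_aeval (P p q : MvPolynomial (Fin 2) k) {s t s' t' : A} (h : Commute s t)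
    (hs : evalAt p s t = s') (ht : evalAt q s t = t') :
    evalAt (MvPolynomial.aeval ![p, q] P) s t = evalAt P s' t' := by
  have comm : ∀ i j, Commute (![s, t] i) (![s, t] j) := by
    intro i j
    fin_cases i <;> fin_cases j
    exacts [Commute.refl _, h, h.symm, Commute.refl _]
  set f := aevalOfCommute (k := k) ![s, t] comm with hf
  have f0 : f (MvPolynomial.X 0) = s := aevalOfCommute_X _ _ 0
  have f1 : f (MvPolynomial.X 1) = t := aevalOfCommute_X _ _ 1
  have ev : ∀ P, f P = evalAt P s t := fun P => by
    conv_lhs => rw [← evalAt_X_X P]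
    rw [map_evalAt, f0, f1]
  have ev' := map_evalAt (f.comp (MvPolynomial.aeval ![p, q])) P (MvPolynomial.X 0)
    (MvPolynomial.X 1)
  rw [evalAt_X_X] at ev'
  simpa [ev, hs, ht] using ev'

theorem evalAt_X_zero (s t : A) : evalAt (MvPolynomial.X 0 : MvPolynomial (Fin 2) k) s t = s := by
  -- Over the zero ring the variable has empty support and both sides vanish because `A` is zero;
  -- otherwise the support is a single monomial.
  by_cases h : (1 : k) = 0
  · have : ∀ x : A, x = 0 := fun x => by rw [← one_smul k x, h, zero_smul]
    rw [this s, this (evalAt _ _ _)]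
  · have : Nontrivial k := ⟨1, 0, h⟩
    simp [evalAt, MvPolynomial.support_X]

theorem evalAt_X_one (s t : A) : evalAt (MvPolynomial.X 1 : MvPolynomial (Fin 2) k) s t = t := by
  by_cases h : (1 : k) = 0
  · have : ∀ x : A, x = 0 := fun x => by rw [← one_smul k x, h, zero_smul]
    rw [this t, this (evalAt _ _ _)]
  · have : Nontrivial k := ⟨1, 0, h⟩
    simp [evalAt, MvPolynomial.support_X]

theorem evalAt_neg (P : MvPolynomial (Fin 2) k) (s t : A) : evalAt (-P) s t = -evalAt P s t := by
  simp [evalAt, MvPolynomial.support_neg]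

variable {J : Type*} {c : J → J} {Q : J → J → MvPolynomial (Fin 2) k}

theorem IsAdmissible.evalAt_symm (hQ : IsAdmissible c Q) (i j : J) {s t : A} (h : Commute s t) :
    evalAt (Q j i) t s = evalAt (Q i j) s t := by
  rw [hQ.symm i j]
  exact evalAt_aeval _ _ _ h.symm (evalAt_X_one _ _) (evalAt_X_zero _ _)

theorem IsAdmissible.evalAt_neg_left (hQ : IsAdmissible c Q) (i j : J) {s t : A}
    (h : Commute s t) : evalAt (Q (c i) j) (-s) t = evalAt (Q i j) s t := by
  rw [← hQ.neg_left i j]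
  exact (evalAt_aeval _ _ _ h (by rw [evalAt_neg, evalAt_X_zero]) (evalAt_X_one _ _)).symm

theorem IsAdmissible.evalAt_neg_right (hQ : IsAdmissible c Q) (i j : J) {s t : A}
    (h : Commute s t) : evalAt (Q i (c j)) s (-t) = evalAt (Q i j) s t := by
  rw [← hQ.neg_right i j]
  exact (evalAt_aeval _ _ _ h (evalAt_X_zero _ _) (by rw [evalAt_neg, evalAt_X_one])).symm

theorem evalAt_semiconj (P : MvPolynomial (Fin 2) k) {x s t s' t' : A} (hs : x * s = s' * x)
    (ht : x * t = t' * x) : x * evalAt P s t = evalAt P s' t' * x := by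
  unfold evalAt
  rw [Finset.mul_sum, Finset.sum_mul]
  refine Finset.sum_congr rfl fun m _ => ?_
  have h : SemiconjBy x (s ^ m 0 * t ^ m 1) (s' ^ m 0 * t' ^ m 1) :=
    (SemiconjBy.pow_right (show SemiconjBy x s s' from hs) _).mul_right
      (SemiconjBy.pow_right (show SemiconjBy x t t' from ht) _)
  rw [mul_smul_comm, smul_mul_assoc, h.eq]

end EvalAt

/-! ### Calculations in the localization -/

section LocalizationCalculus

variable {n : ℕ} {J : Type v} (c : J → J)

@[simp] theorem flip_self (p : Fin n) (ν : Fin n → J) : flip c p ν p = c (ν p) := by simp [flip]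

theorem flip_of_ne {p q : Fin n} (h : q ≠ p) (ν : Fin n → J) : flip c p ν q = ν q := by
  simp [flip, h]

theorem inv_semiconj {A : Type*} [Ring A] {x a b a' b' : A} (h : x * a = b * x) (hb : b' * b = 1)
    (ha : a * a' = 1) : x * a' = b' * x := by
  calc x * a' = b' * b * (x * a') := by rw [hb, one_mul]
    _ = b' * (x * a) * a' := by rw [h]; noncomm_ring
    _ = b' * x := by rw [mul_assoc, mul_assoc, ha, mul_one]

/-- The partial fraction `1/(ab) = 1/(az) + 1/(bz)` for `z = a + b`, with only the one-sided
inverses and the one commutation that the calculation uses. -/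
theorem inv_mul_inv_of_add_eq {A : Type*} [Ring A] {a b z a' b' z' : A} (h : a + b = z)
    (ha : a' * a = 1) (hb : b * b' = 1) (hz : z * z' = 1) (hbz : z' * b' = b' * z') :
    a' * b' = a' * z' + b' * z' := by
  calc a' * b' = a' * (z * z') * b' := by rw [hz, mul_one]
    _ = a' * z * (z' * b') := by noncomm_ring
    _ = a' * (a + b) * (b' * z') := by rw [hbz, h]
    _ = a' * a * b' * z' + a' * (b * b') * z' := by noncomm_ring
    _ = a' * z' + b' * z' := by rw [ha, hb, one_mul, mul_one, add_comm]

variable {k : Type u} [CommRing k] [Fintype J] [DecidableEq J]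

namespace MK

theorem of_rel {x x' : MA k c n} (h : MARel c (MA.y k c) (MA.cl k c) (MA.e k c) x x') :
    of k c n x = of k c n x' := congrArg _ (MA.rel k c x x' h)

variable (k)

theorem commute_y (p q : Fin n) : Commute (y k c p) (y k c q) := by
  have := of_rel (k := k) c (.y_y p q)
  rwa [map_mul, map_mul] at this

theorem commute_y_e (p : Fin n) (ν : Fin n → J) : Commute (y k c p) (e k c ν) := by
  have := of_rel (k := k) c (.y_e p ν)
  rwa [map_mul, map_mul] at this

theorem cl_mul_e (p : Fin n) (ν : Fin n → J) :
    cl k c p * e k c ν = e k c (flip c p ν) * cl k c p := by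
  have := of_rel (k := k) c (.cl_e p ν)
  rwa [map_mul, map_mul] at this

theorem e_mul_e (μ ν : Fin n → J) : e k c μ * e k c ν = if μ = ν then e k c ν else 0 := by
  have := congrArg (of k c n) (MA.e_mul_e (k := k) c μ ν)
  rwa [map_mul, apply_ite (of k c n), map_zero] at this

theorem sum_e : ∑ ν, e k c ν = (1 : MK k c n) := by
  have := of_rel (k := k) (n := n) c .sum_e
  rw [map_one, map_sum] at this
  exact this.symm

theorem cl_mul_y_self (p : Fin n) : cl k c p * y k c p = -(y k c p * cl k c p) := by
  have := of_rel (k := k) c (.cl_y p p)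
  rwa [map_mul, if_pos rfl, map_neg, map_mul] at this

theorem commute_cl_y {p q : Fin n} (h : p ≠ q) : Commute (cl k c p) (y k c q) := by
  have := of_rel (k := k) c (.cl_y p q)
  rwa [map_mul, if_neg h, map_mul] at this

theorem cl_mul_cl_self [Invertible (2 : k)] (p : Fin n) : cl k c p * cl k c p = 1 := by
  have := congrArg (of k c n) (MA.cl_mul_cl_self k c p)
  rwa [map_mul, map_one] at this

theorem cl_mul_cl_of_ne {p q : Fin n} (h : p ≠ q) :
    cl k c p * cl k c q = -(cl k c q * cl k c p) := by
  have := congrArg (of k c n) (MA.cl_mul_cl_of_ne k c h)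
  rwa [map_mul, map_neg, map_mul] at this

variable {k c}

theorem ext_mul_e {x x' : MK k c n} (h : ∀ ν, x * e k c ν = x' * e k c ν) : x = x' := by
  rw [← mul_one x, ← mul_one x', ← sum_e, Finset.mul_sum, Finset.mul_sum]
  exact Finset.sum_congr rfl fun ν _ => h ν

theorem sum_mul_e (f : (Fin n → J) → MK k c n) (ν : Fin n → J) :
    (∑ μ, f μ * e k c μ) * e k c ν = f ν * e k c ν := by
  simp only [Finset.sum_mul, mul_assoc, e_mul_e, mul_ite, mul_zero, Finset.sum_ite_eq',
    Finset.mem_univ, if_true]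

theorem commute_of_gen {x : MK k c n} (hy : ∀ p, Commute x (y k c p))
    (hcl : ∀ p, Commute x (cl k c p)) (he : ∀ ν, Commute x (e k c ν)) (z : MK k c n) :
    Commute x z := by
  have hof : ∀ a, Commute x (of k c n a) := by
    intro a
    obtain ⟨a, rfl⟩ := MA.mk_surjective k c a
    induction a using FreeAlgebra.induction with
    | grade0 r => rw [AlgHom.commutes, AlgHom.commutes]; exact Algebra.commute_algebraMap_right r x
    | grade1 g =>
      cases g with
      | y p => exact hy p
      | cl p => exact hcl p
      | e ν => exact he ν
    | mul a b ha hb => rw [map_mul, map_mul]; exact ha.mul_right hb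
    | add a b ha hb => rw [map_add, map_add]; exact ha.add_right hb
  induction z using OreLocalization.ind with
  | _ r s =>
    have hs : (of k c n s * OreLocalization.oreDiv 1 s : MK k c n) = 1 :=
      (OreLocalization.numeratorUnit s).mul_inv
    have hs' : (OreLocalization.oreDiv 1 s * of k c n s : MK k c n) = 1 :=
      (OreLocalization.numeratorUnit s).inv_mul
    have hr : OreLocalization.oreDiv r s = (OreLocalization.oreDiv 1 s * of k c n r : MK k c n) := by
      refine Eq.trans ?_ OreLocalization.mul_div_one.symm
      rw [one_mul]
    rw [hr]
    exact Commute.mul_right (inv_semiconj (hof s) hs' hs) (hof r)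

theorem mul_invSub (a b : Fin n) (h : a ≠ b) : (y k c a - y k c b) * invSub k c a b h = 1 := by
  have := (OreLocalization.numeratorUnit (R := MA k c n) (S := MA.denom k c n)
    ⟨MA.y k c a - MA.y k c b, MA.sub_mem_denom h⟩).mul_inv
  rw [y, y, ← map_sub]
  exact this

theorem mul_invAdd (a b : Fin n) (h : a ≠ b) : (y k c a + y k c b) * invAdd k c a b h = 1 := by
  have := (OreLocalization.numeratorUnit (R := MA k c n) (S := MA.denom k c n)
    ⟨MA.y k c a + MA.y k c b, MA.add_mem_denom h⟩).mul_inv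
  rw [y, y, ← map_add]
  exact this

theorem commute_invSub {x : MK k c n} {a b : Fin n} (h : a ≠ b) (ha : Commute x (y k c a))
    (hb : Commute x (y k c b)) : Commute x (invSub k c a b h) :=
  inv_semiconj (ha.sub_right hb) (invSub_mul k c a b h) (mul_invSub a b h)

theorem commute_invAdd {x : MK k c n} {a b : Fin n} (h : a ≠ b) (ha : Commute x (y k c a))
    (hb : Commute x (y k c b)) : Commute x (invAdd k c a b h) :=
  inv_semiconj (ha.add_right hb) (invAdd_mul k c a b h) (mul_invAdd a b h)

theorem commute_y_invSub (p : Fin n) {a b : Fin n} (h : a ≠ b) :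
    Commute (y k c p) (invSub k c a b h) :=
  commute_invSub h (commute_y _ _ _ _) (commute_y _ _ _ _)

theorem commute_y_invAdd (p : Fin n) {a b : Fin n} (h : a ≠ b) :
    Commute (y k c p) (invAdd k c a b h) :=
  commute_invAdd h (commute_y _ _ _ _) (commute_y _ _ _ _)

theorem commute_e_invSub (ν : Fin n → J) {a b : Fin n} (h : a ≠ b) :
    Commute (e k c ν) (invSub k c a b h) :=
  commute_invSub h (commute_y_e _ _ _ _).symm (commute_y_e _ _ _ _).symm

theorem commute_e_invAdd (ν : Fin n → J) {a b : Fin n} (h : a ≠ b) :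
    Commute (e k c ν) (invAdd k c a b h) :=
  commute_invAdd h (commute_y_e _ _ _ _).symm (commute_y_e _ _ _ _).symm

theorem commute_cl_invSub {p a b : Fin n} (h : a ≠ b) (ha : p ≠ a) (hb : p ≠ b) :
    Commute (cl k c p) (invSub k c a b h) :=
  commute_invSub h (commute_cl_y c k ha) (commute_cl_y c k hb)

theorem commute_cl_invAdd {p a b : Fin n} (h : a ≠ b) (ha : p ≠ a) (hb : p ≠ b) :
    Commute (cl k c p) (invAdd k c a b h) :=
  commute_invAdd h (commute_cl_y c k ha) (commute_cl_y c k hb)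

theorem commute_invSub_invSub {a b p q : Fin n} (h : a ≠ b) (h' : p ≠ q) :
    Commute (invSub k c a b h) (invSub k c p q h') :=
  commute_invSub h' (commute_y_invSub _ _).symm (commute_y_invSub _ _).symm

theorem commute_invAdd_invSub {a b p q : Fin n} (h : a ≠ b) (h' : p ≠ q) :
    Commute (invAdd k c a b h) (invSub k c p q h') :=
  commute_invSub h' (commute_y_invAdd _ _).symm (commute_y_invAdd _ _).symm

theorem commute_invAdd_invAdd {a b p q : Fin n} (h : a ≠ b) (h' : p ≠ q) :
    Commute (invAdd k c a b h) (invAdd k c p q h') :=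
  commute_invAdd h' (commute_y_invAdd _ _).symm (commute_y_invAdd _ _).symm

/-- Conjugation by `c_p` sends `y_p` to `-y_p`, hence `y_p - y_q` to `-(y_p + y_q)`. The next lemmas
are the variants for `c_q` and for the other denominator. -/
theorem cl_mul_invSub_left {p q : Fin n} (h : p ≠ q) :
    cl k c p * invSub k c p q h = -(invAdd k c p q h * cl k c p) := by
  rw [← neg_mul]
  refine inv_semiconj (b := -(y k c p + y k c q)) ?_ ?_ (mul_invSub p q h)
  · rw [mul_sub, cl_mul_y_self, (commute_cl_y c k h).eq]; noncomm_ring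
  · rw [neg_mul_neg, invAdd_mul]

theorem cl_mul_invSub_right {p q : Fin n} (h : p ≠ q) :
    cl k c q * invSub k c p q h = invAdd k c p q h * cl k c q := by
  refine inv_semiconj (b := y k c p + y k c q) ?_ (invAdd_mul k c p q h) (mul_invSub p q h)
  rw [mul_sub, cl_mul_y_self, (commute_cl_y c k h.symm).eq]; noncomm_ring

theorem cl_mul_invAdd_left {p q : Fin n} (h : p ≠ q) :
    cl k c p * invAdd k c p q h = -(invSub k c p q h * cl k c p) := by
  rw [← neg_mul]
  refine inv_semiconj (b := -(y k c p - y k c q)) ?_ ?_ (mul_invAdd p q h)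
  · rw [mul_add, cl_mul_y_self, (commute_cl_y c k h).eq]; noncomm_ring
  · rw [neg_mul_neg, invSub_mul]

theorem cl_mul_invAdd_right {p q : Fin n} (h : p ≠ q) :
    cl k c q * invAdd k c p q h = invSub k c p q h * cl k c q := by
  refine inv_semiconj (b := y k c p - y k c q) ?_ (invSub_mul k c p q h) (mul_invAdd p q h)
  rw [mul_add, cl_mul_y_self, (commute_cl_y c k h.symm).eq]; noncomm_ring

theorem invSub_swap {p q : Fin n} (h : p ≠ q) :
    invSub k c q p h.symm = -invSub k c p q h := by
  refine left_inv_eq_right_inv (invSub_mul k c q p h.symm) ?_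
  rw [mul_neg, ← neg_mul, neg_sub, mul_invSub]

theorem invAdd_swap {p q : Fin n} (h : p ≠ q) :
    invAdd k c q p h.symm = invAdd k c p q h := by
  refine left_inv_eq_right_inv (invAdd_mul k c q p h.symm) ?_
  rw [add_comm, mul_invAdd]

theorem perm_y (w : Equiv.Perm (Fin n)) (p : Fin n) : perm w (y k c p) = y k c (w p) := by
  simp [perm, y, map_of, MA.perm]

theorem perm_cl (w : Equiv.Perm (Fin n)) (p : Fin n) : perm w (cl k c p) = cl k c (w p) := by
  simp [perm, cl, map_of, MA.perm]

theorem perm_e (w : Equiv.Perm (Fin n)) (ν : Fin n → J) :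
    perm w (e k c ν) = e k c (permSeq w ν) := by
  simp [perm, e, map_of, MA.perm]

theorem perm_invSub (w : Equiv.Perm (Fin n)) {p q : Fin n} (h : p ≠ q) :
    perm w (invSub k c p q h) = invSub k c (w p) (w q) (w.injective.ne h) := by
  rw [invSub, perm, map_inv]
  congr 2
  simp [MA.perm]

theorem perm_invAdd (w : Equiv.Perm (Fin n)) {p q : Fin n} (h : p ≠ q) :
    perm w (invAdd k c p q h) = invAdd k c (w p) (w q) (w.injective.ne h) := by
  rw [invAdd, perm, map_inv]
  congr 2
  simp [MA.perm]

theorem perm_perm (w w' : Equiv.Perm (Fin n)) (x : MK k c n) :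
    perm w (perm w' x) = perm (w * w') x := by
  have : (perm (k := k) (c := c) w).comp (perm w') = perm (w * w') := by
    refine hom_ext fun x => ?_
    simp only [AlgHom.comp_apply, perm, map_of]
    refine congrArg (of k c n) ?_
    have : (MA.perm (k := k) (c := c) w).comp (MA.perm w') = MA.perm (w * w') := by
      apply MA.hom_ext <;> intro <;> simp [MA.perm]
      rfl
    exact DFunLike.congr_fun this x
  exact DFunLike.congr_fun this x

theorem perm_one (x : MK k c n) : perm 1 x = x := by
  have : perm (k := k) (c := c) (n := n) 1 = AlgHom.id k _ := by
    refine hom_ext fun x => ?_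
    simp only [AlgHom.id_apply, perm, map_of]
    refine congrArg (of k c n) ?_
    have : (MA.perm (k := k) (c := c) (n := n) 1) = AlgHom.id k _ := by
      apply MA.hom_ext <;> intro <;> simp [MA.perm]
      rfl
    exact DFunLike.congr_fun this x
  exact DFunLike.congr_fun this x

end MK
end LocalizationCalculus

/-! ### The elements of the localization that describe the intertwiners -/

section RMatrix

theorem permSeq_bijective {n : ℕ} {J : Type v} (w : Equiv.Perm (Fin n)) :
    Function.Bijective (permSeq (J := J) w) := by
  refine Function.bijective_iff_has_inverse.mpr ⟨permSeq w.symm, ?_, ?_⟩ <;>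
    intro ν <;> funext p <;> simp [permSeq]

variable {n : ℕ} {k : Type u} [CommRing k] {J : Type v} {c : J → J} [Fintype J] [DecidableEq J]

namespace MK

/-- `c_p c_q` -/
def clcl (k : Type u) [CommRing k] {J : Type v} [Fintype J] [DecidableEq J] (c : J → J)
    (p q : Fin n) : MK k c n := cl k c p * cl k c q

theorem clcl_mul_e (p q : Fin n) (ν : Fin n → J) :
    clcl k c p q * e k c ν = e k c (flip c p (flip c q ν)) * clcl k c p q := by
  rw [clcl, mul_assoc, cl_mul_e, ← mul_assoc, cl_mul_e, mul_assoc]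

/-- Conjugation by `c_p c_q` negates both `y_p` and `y_q`. -/
theorem clcl_mul_invSub {p q : Fin n} (h : p ≠ q) :
    clcl k c p q * invSub k c p q h = -(invSub k c p q h * clcl k c p q) := by
  rw [clcl, mul_assoc, cl_mul_invSub_right, ← mul_assoc, cl_mul_invAdd_left, neg_mul, mul_assoc]

theorem clcl_mul_invAdd {p q : Fin n} (h : p ≠ q) :
    clcl k c p q * invAdd k c p q h = -(invAdd k c p q h * clcl k c p q) := by
  rw [clcl, mul_assoc, cl_mul_invAdd_right, ← mul_assoc, cl_mul_invSub_left, neg_mul, mul_assoc]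

theorem clcl_mul_clcl_self [Invertible (2 : k)] {p q : Fin n} (h : p ≠ q) :
    clcl k c p q * clcl k c p q = -1 := by
  rw [clcl, mul_assoc, ← mul_assoc (cl k c q), cl_mul_cl_of_ne c k h.symm, neg_mul, mul_neg,
    mul_assoc (cl k c p), cl_mul_cl_self, mul_one, cl_mul_cl_self]

/-- The coefficient of `e(ν)` in `rMatrix`. -/
def rCoeff (k : Type u) [CommRing k] {J : Type v} [Fintype J] [DecidableEq J] (c : J → J)
    (p q : Fin n) (h : p ≠ q) (ν : Fin n → J) : MK k c n :=
  (if ν p = c (ν q) then invAdd k c p q h * clcl k c p q else 0)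
    - (if ν p = ν q then invSub k c p q h else 0)

variable (k c) in
/-- The element
`∑_ν (-[ν_p = ν_q] (y_p - y_q)⁻¹ + [ν_p = c ν_q] (y_p + y_q)⁻¹ c_p c_q) e(ν)`. -/
def rMatrix (p q : Fin n) (h : p ≠ q) : MK k c n := ∑ ν, rCoeff k c p q h ν * e k c ν

theorem rMatrix_mul_e (p q : Fin n) (h : p ≠ q) (ν : Fin n → J) :
    rMatrix k c p q h * e k c ν = rCoeff k c p q h ν * e k c ν := sum_mul_e _ _

theorem rMatrix_swap (hc : Function.Involutive c) {p q : Fin n} (h : p ≠ q) :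
    rMatrix k c q p h.symm = -rMatrix k c p q h := by
  unfold rMatrix
  rw [← Finset.sum_neg_distrib]
  refine Finset.sum_congr rfl fun ν _ => ?_
  rw [← neg_mul]
  congr 1
  unfold rCoeff clcl
  have h1 : ν q = c (ν p) ↔ ν p = c (ν q) := ⟨fun h => by rw [h, hc _], fun h => by rw [h, hc _]⟩
  rw [invAdd_swap h, invSub_swap h, cl_mul_cl_of_ne c k h.symm, if_congr h1 rfl rfl,
    if_congr (eq_comm (a := ν q)) rfl rfl]
  split_ifs <;> noncomm_ring

theorem perm_rMatrix (w : Equiv.Perm (Fin n)) {p q : Fin n} (h : p ≠ q) :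
    perm w (rMatrix k c p q h) = rMatrix k c (w p) (w q) (w.injective.ne h) := by
  unfold rMatrix
  rw [map_sum]
  refine Fintype.sum_bijective (permSeq w) (permSeq_bijective w) _ _ fun ν => ?_
  simp only [rCoeff, clcl, map_mul, map_sub, apply_ite (perm w), map_zero, perm_invAdd,
    perm_invSub, perm_cl, perm_e, permSeq, Equiv.symm_apply_apply]

/-- The expansion of a product of two elements `rMatrix`. -/
theorem rMatrix_mul_rMatrix_mul_e {p q s t : Fin n} (h : p ≠ q) (h' : s ≠ t) (ν : Fin n → J) :
    rMatrix k c p q h * rMatrix k c s t h' * e k c ν =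
      ((if ν s = ν t ∧ ν p = ν q then invSub k c p q h * invSub k c s t h' else 0)
      - (if ν s = ν t ∧ ν p = c (ν q) then
          invAdd k c p q h * clcl k c p q * invSub k c s t h' else 0)
      - (if ν s = c (ν t) ∧ flip c s (flip c t ν) p = flip c s (flip c t ν) q then
          invSub k c p q h * (invAdd k c s t h' * clcl k c s t) else 0)
      + (if ν s = c (ν t) ∧ flip c s (flip c t ν) p = c (flip c s (flip c t ν) q) then
          invAdd k c p q h * clcl k c p q * (invAdd k c s t h' * clcl k c s t) else 0))
        * e k c ν := by
  have e1 : rMatrix k c p q h * (invSub k c s t h' * e k c ν) =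
      rCoeff k c p q h ν * (invSub k c s t h' * e k c ν) := by
    rw [← (commute_e_invSub ν h').eq, ← mul_assoc, rMatrix_mul_e, mul_assoc]
  -- The Clifford term of the right factor changes the idempotent, so the left factor sees the
  -- sequence with the entries at `s` and `t` flipped.
  have e2 : rMatrix k c p q h * (invAdd k c s t h' * clcl k c s t * e k c ν) =
      rCoeff k c p q h (flip c s (flip c t ν)) * (invAdd k c s t h' * clcl k c s t * e k c ν) := by
    have : invAdd k c s t h' * clcl k c s t * e k c ν =
        e k c (flip c s (flip c t ν)) * (invAdd k c s t h' * clcl k c s t) := by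
      rw [mul_assoc, clcl_mul_e, ← mul_assoc, ← (commute_e_invAdd _ h').eq, mul_assoc]
    rw [this, ← mul_assoc, rMatrix_mul_e, mul_assoc]
  rw [mul_assoc, rMatrix_mul_e]
  rw [rCoeff, sub_mul, mul_sub]
  simp only [ite_mul, mul_ite, zero_mul, mul_zero, e1, e2]
  simp only [rCoeff, ite_and]
  split_ifs <;> noncomm_ring

/-- The mixed terms cancel because `c_p c_q` anticommutes with `(y_p - y_q)⁻¹`. In the square of the
Clifford term the sign from this anticommutation, now with `(y_p + y_q)⁻¹`, cancels that of `(c_p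
c_q)² = -1`. -/
theorem rMatrix_sq [Invertible (2 : k)] (hc : Function.Involutive c) {p q : Fin n} (h : p ≠ q)
    (ν : Fin n → J) :
    rMatrix k c p q h * rMatrix k c p q h * e k c ν =
      ((if ν p = ν q then invSub k c p q h ^ 2 else 0)
        + (if ν p = c (ν q) then invAdd k c p q h ^ 2 else 0)) * e k c ν := by
  rw [rMatrix_mul_rMatrix_mul_e]
  have hp : flip c p (flip c q ν) p = c (ν p) := by rw [flip_self, flip_of_ne c h]
  have hq : flip c p (flip c q ν) q = c (ν q) := by rw [flip_of_ne c h.symm, flip_self]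
  have e1 : invAdd k c p q h * clcl k c p q * invSub k c p q h =
      -(invSub k c p q h * (invAdd k c p q h * clcl k c p q)) := by
    rw [mul_assoc, clcl_mul_invSub, mul_neg, ← mul_assoc, (commute_invAdd_invSub h h).eq,
      mul_assoc]
  have e2 : invAdd k c p q h * clcl k c p q * (invAdd k c p q h * clcl k c p q) =
      invAdd k c p q h ^ 2 := by
    rw [mul_assoc, ← mul_assoc (clcl k c p q), clcl_mul_invAdd, neg_mul, mul_assoc (invAdd k c p q h),
      clcl_mul_clcl_self h, mul_neg_one, neg_neg, pow_two]
  rw [hp, hq, e1, e2, if_congr (and_congr_right fun _ => hc.injective.eq_iff) rfl rfl,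
    if_congr (and_congr_right fun _ => hc.injective.eq_iff) rfl rfl]
  congr 1
  simp only [ite_and]
  split_ifs <;> noncomm_ring

/-- On each `e(ν)` the terms are sorted by their Clifford part, one of `1`, `c_p c_q`, `c_p c_s`,
`c_q c_s`. Terms with the same Clifford part carry equivalent conditions on `ν`, and their
coefficients agree by partial fractions. If entries are fixed by `c`, several groups occur together,
but each one cancels separately. -/
theorem rMatrix_associative [Invertible (2 : k)] (hc : Function.Involutive c) {p q s : Fin n}
    (hpq : p ≠ q) (hps : p ≠ s) (hqs : q ≠ s) :
    rMatrix k c p q hpq * rMatrix k c p s hps + rMatrix k c p s hps * rMatrix k c q s hqs =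
      rMatrix k c q s hqs * rMatrix k c p q hpq := by
  refine ext_mul_e fun ν => ?_
  rw [add_mul, rMatrix_mul_rMatrix_mul_e, rMatrix_mul_rMatrix_mul_e, rMatrix_mul_rMatrix_mul_e,
    ← add_mul]
  congr 1
  simp only [flip_self, flip_of_ne c hpq, flip_of_ne c hpq.symm, flip_of_ne c hps,
    flip_of_ne c hps.symm, flip_of_ne c hqs, flip_of_ne c hqs.symm]
  have inj : ∀ {i j : J}, c i = c j ↔ i = j := fun {i j} => hc.injective.eq_iff
  have swap : ∀ {i j : J}, c i = j ↔ i = c j := fun {i j} =>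
    ⟨fun h => by rw [← h, hc _], fun h => by rw [h, hc _]⟩
  simp only [inj, swap, hc _]
  -- `r0` to `r3` are the identities of the four groups: `1`, `c_p c_q`, `c_p c_s` and `c_q c_s`, in
  -- this order; `a1` to `a3` are the partial fractions behind the last three.
  have r0 : invSub k c p q hpq * invSub k c p s hps + invSub k c p s hps * invSub k c q s hqs =
      invSub k c q s hqs * invSub k c p q hpq := by
    rw [inv_mul_inv_of_add_eq (a := y k c q - y k c s) (b := y k c p - y k c q)
      (z := y k c p - y k c s) (by abel) (invSub_mul ..) (mul_invSub ..) (mul_invSub ..)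
      (commute_invSub_invSub ..).eq, (commute_invSub_invSub hqs hps).eq, add_comm]
  have a1 := inv_mul_inv_of_add_eq (a := y k c p + y k c s) (b := y k c q - y k c s)
      (z := y k c p + y k c q) (by abel) (invAdd_mul k c p s hps) (mul_invSub q s hqs)
      (mul_invAdd p q hpq) (commute_invAdd_invSub hpq hqs).eq
  have a2 := inv_mul_inv_of_add_eq (a := y k c q + y k c s) (b := y k c p - y k c q)
      (z := y k c p + y k c s) (by abel) (invAdd_mul k c q s hqs) (mul_invSub p q hpq)
      (mul_invAdd p s hps) (commute_invAdd_invSub hps hpq).eq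
  have a3 := inv_mul_inv_of_add_eq (a := y k c p - y k c s) (b := y k c q + y k c s)
      (z := y k c p + y k c q) (by abel) (invSub_mul k c p s hps) (mul_invAdd q s hqs)
      (mul_invAdd p q hpq) (commute_invAdd_invAdd hpq hqs).eq
  have r1 : invAdd k c p s hps * clcl k c p s * (invAdd k c q s hqs * clcl k c q s)
      - invAdd k c p q hpq * clcl k c p q * invSub k c p s hps =
      - (invSub k c q s hqs * (invAdd k c p q hpq * clcl k c p q)) := by
    have h1 : clcl k c p s * invAdd k c q s hqs = invSub k c q s hqs * clcl k c p s := by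
      rw [clcl, mul_assoc, cl_mul_invAdd_right, ← mul_assoc, (commute_cl_invSub hqs hpq hps).eq,
        mul_assoc]
    have h2 : clcl k c p s * clcl k c q s = -clcl k c p q := by
      rw [clcl, mul_assoc, clcl, ← mul_assoc (cl k c s), cl_mul_cl_of_ne c k hqs.symm, neg_mul,
        mul_assoc (cl k c q), cl_mul_cl_self, mul_one, mul_neg, clcl]
    have h3 : clcl k c p q * invSub k c p s hps = -(invAdd k c p s hps * clcl k c p q) := by
      rw [clcl, mul_assoc, (commute_cl_invSub hps hpq.symm hqs).eq, ← mul_assoc,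
        cl_mul_invSub_left, neg_mul, mul_assoc]
    rw [mul_assoc (invAdd k c p s hps), ← mul_assoc (clcl k c p s), h1,
      mul_assoc (invSub k c q s hqs), h2, mul_assoc _ _ (invSub k c p s hps), h3, mul_neg, mul_neg,
      mul_neg, ← mul_assoc, a1, ← mul_assoc, ← mul_assoc, (commute_invAdd_invAdd hpq hps).eq]
    noncomm_ring
  have r2 : invSub k c p q hpq * (invAdd k c p s hps * clcl k c p s) +
      invAdd k c p s hps * clcl k c p s * invSub k c q s hqs =
      -(invAdd k c q s hqs * clcl k c q s * (invAdd k c p q hpq * clcl k c p q)) := by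
    have h1 : clcl k c p s * invSub k c q s hqs = invAdd k c q s hqs * clcl k c p s := by
      rw [clcl, mul_assoc, cl_mul_invSub_right, ← mul_assoc, (commute_cl_invAdd hqs hpq hps).eq,
        mul_assoc]
    have h2 : clcl k c q s * clcl k c p q = -clcl k c p s := by
      rw [clcl, clcl, cl_mul_cl_of_ne c k hpq, mul_neg, mul_assoc, ← mul_assoc (cl k c s),
        cl_mul_cl_of_ne c k hqs.symm, neg_mul, mul_neg, neg_neg, mul_assoc (cl k c q),
        ← mul_assoc, cl_mul_cl_self, one_mul, cl_mul_cl_of_ne c k hps.symm, clcl]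
    have h3 : clcl k c q s * invAdd k c p q hpq = invSub k c p q hpq * clcl k c q s := by
      rw [clcl, mul_assoc, (commute_cl_invAdd hpq hps.symm hqs.symm).eq, ← mul_assoc,
        cl_mul_invAdd_right, mul_assoc]
    rw [mul_assoc (invAdd k c p s hps), h1, mul_assoc (invAdd k c q s hqs),
      ← mul_assoc (clcl k c q s), h3, mul_assoc _ _ (clcl k c p q), h2, mul_neg, mul_neg, neg_neg,
      ← mul_assoc (invAdd k c q s hqs), a2, ← mul_assoc, ← mul_assoc,
      (commute_invAdd_invAdd hps hqs).eq]
    noncomm_ring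
  have r3 : invAdd k c p q hpq * clcl k c p q * (invAdd k c p s hps * clcl k c p s)
      - invSub k c p s hps * (invAdd k c q s hqs * clcl k c q s) =
      -(invAdd k c q s hqs * clcl k c q s * invSub k c p q hpq) := by
    have h1 : clcl k c p q * invAdd k c p s hps = -(invSub k c p s hps * clcl k c p q) := by
      rw [clcl, mul_assoc, (commute_cl_invAdd hps hpq.symm hqs).eq, ← mul_assoc,
        cl_mul_invAdd_left, neg_mul, mul_assoc]
    have h2 : clcl k c p q * clcl k c p s = -clcl k c q s := by
      rw [clcl, clcl, cl_mul_cl_of_ne c k hpq, neg_mul, mul_assoc, ← mul_assoc (cl k c p),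
        cl_mul_cl_self, one_mul, clcl]
    have h3 : clcl k c q s * invSub k c p q hpq = invAdd k c p q hpq * clcl k c q s := by
      rw [clcl, mul_assoc, (commute_cl_invSub hpq hps.symm hqs.symm).eq, ← mul_assoc,
        cl_mul_invSub_right, mul_assoc]
    rw [mul_assoc (invAdd k c p q hpq), ← mul_assoc (clcl k c p q), h1, neg_mul,
      mul_assoc (invSub k c p s hps), h2, mul_neg, mul_neg, mul_neg, neg_neg, ← mul_assoc (invSub k c p s hps), a3,
      mul_assoc (invAdd k c q s hqs), h3, ← mul_assoc, (commute_invAdd_invSub hpq hps).eq]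
    noncomm_ring
  generalize ν p = i, ν q = j, ν s = l
  -- The three conditions of each group are brought to one form, so that `split_ifs` treats a group
  -- as a whole.
  have c1 : (j = l ∧ i = l) ↔ (i = l ∧ i = j) := by grind
  have c2 : (i = j ∧ j = l) ↔ (i = l ∧ i = j) := by grind
  have c3 : (j = c l ∧ i = l) ↔ (i = l ∧ i = c j) := by
    constructor <;> rintro ⟨rfl, rfl⟩ <;> simp [hc _]
  have c4 : (i = c j ∧ j = c l) ↔ (i = l ∧ i = c j) := by
    constructor <;> rintro ⟨rfl, rfl⟩ <;> simp [hc _]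
  have c5 : (j = l ∧ i = c l) ↔ (i = c l ∧ i = c j) := by
    constructor <;> rintro ⟨rfl, h⟩
    · exact ⟨h, h⟩
    · exact ⟨(inj.mp h).symm, rfl⟩
  have c6 : (i = c j ∧ j = l) ↔ (i = c l ∧ i = c j) := by rw [and_comm, ← c5]; grind
  have c7 : (j = c l ∧ i = c l) ↔ (i = c l ∧ i = j) := by grind
  have c8 : (i = j ∧ j = c l) ↔ (i = c l ∧ i = j) := by grind
  simp only [c1, c2, c3, c4, c5, c6, c7, c8]
  rw [← r0]
  rw [← neg_eq_iff_eq_neg] at r1 r2 r3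
  rw [← r1, ← r2, ← r3]
  split_ifs <;> abel

/-- The element `∑_ν Q_{ν_p,ν_q}(y_p, y_q) e(ν)`. -/
def qElem (c : J → J) (Q : J → J → MvPolynomial (Fin 2) k) (p q : Fin n) : MK k c n :=
  ∑ ν, evalAt (Q (ν p) (ν q)) (y k c p) (y k c q) * e k c ν

/-! ### Central elements of `MK_n`, and commutation of `rMatrix` with the generators. -/

variable {Q : J → J → MvPolynomial (Fin 2) k}

theorem qElem_mul_e (p q : Fin n) (ν : Fin n → J) :
    qElem c Q p q * e k c ν = evalAt (Q (ν p) (ν q)) (y k c p) (y k c q) * e k c ν :=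
  sum_mul_e _ _

theorem R_mul_e (p q : Fin n) (h : p ≠ q) (ν : Fin n → J) :
    R Q p q h * e k c ν = (evalAt (Q (ν p) (ν q)) (y k c p) (y k c q)
      - (if ν p = ν q then invSub k c p q h ^ 2 else 0)
      - (if ν p = c (ν q) then invAdd k c p q h ^ 2 else 0)) * e k c ν :=
  sum_mul_e _ _

theorem R_eq [Invertible (2 : k)] (hc : Function.Involutive c) (p q : Fin n) (h : p ≠ q) :
    R Q p q h = qElem c Q p q - rMatrix k c p q h * rMatrix k c p q h := by
  refine ext_mul_e fun ν => ?_
  rw [R_mul_e, sub_mul (qElem c Q p q), qElem_mul_e, rMatrix_sq hc]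
  noncomm_ring

theorem cl_mul_evalAt (hQ : IsAdmissible c Q) {p q : Fin n} (h : p ≠ q) (r : Fin n)
    (ν : Fin n → J) :
    cl k c r * evalAt (Q (ν p) (ν q)) (y k c p) (y k c q) =
      evalAt (Q (flip c r ν p) (flip c r ν q)) (y k c p) (y k c q) * cl k c r := by
  by_cases hp : r = p
  · subst hp
    rw [evalAt_semiconj _ ((cl_mul_y_self c k r).trans (neg_mul _ _).symm) (commute_cl_y c k h),
      flip_self, flip_of_ne c h.symm,
      ← hQ.evalAt_neg_left (ν r) (ν q) (commute_y c k _ _).neg_left, neg_neg]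
  by_cases hq : r = q
  · subst hq
    rw [evalAt_semiconj _ (commute_cl_y c k h.symm)
      ((cl_mul_y_self c k r).trans (neg_mul _ _).symm), flip_self, flip_of_ne c h,
      ← hQ.evalAt_neg_right (ν p) (ν r) (commute_y c k _ _).neg_right, neg_neg]
  · rw [evalAt_semiconj _ (commute_cl_y c k hp) (commute_cl_y c k hq), flip_of_ne c (Ne.symm hp),
      flip_of_ne c (Ne.symm hq)]

theorem commute_sum_e {x : MK k c n} {f : (Fin n → J) → MK k c n} (h : ∀ ν, Commute (f ν) x)
    (he : ∀ ν, Commute (e k c ν) x) : Commute (∑ ν, f ν * e k c ν) x :=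
  Commute.sum_left _ _ _ fun ν _ => (h ν).mul_left (he ν)

theorem commute_e_e (μ ν : Fin n → J) : Commute (e k c μ) (e k c ν) := by
  change _ * _ = _ * _
  rw [e_mul_e, e_mul_e]
  by_cases h : μ = ν
  · rw [h]
  · rw [if_neg h, if_neg (Ne.symm h)]

theorem commute_evalAt {P : MvPolynomial (Fin 2) k} {s t x : MK k c n} (hs : Commute s x)
    (ht : Commute t x) : Commute (evalAt P s t) x :=
  (evalAt_semiconj P hs.symm ht.symm : Commute x (evalAt P s t)).symm

/-- Only the Clifford generators need an argument: `c_r` flips the index at `r` and negates `y_r`,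
and the two effects compensate by the sign rules for `Q`. -/
theorem commute_qElem (hQ : IsAdmissible c Q) {p q : Fin n}
    (h : p ≠ q) (x : MK k c n) : Commute (qElem c Q p q) x := by
  refine commute_of_gen (fun r => ?_) (fun r => ?_) (fun ν => ?_) x
  · exact commute_sum_e (fun ν => commute_evalAt (commute_y c k _ _) (commute_y c k _ _))
      fun ν => (commute_y_e c k _ _).symm
  · refine ext_mul_e fun ν => ?_
    rw [mul_assoc, cl_mul_e, ← mul_assoc, qElem_mul_e, mul_assoc, ← cl_mul_e, mul_assoc,
      qElem_mul_e, ← mul_assoc, ← mul_assoc, cl_mul_evalAt hQ h]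
  · exact commute_sum_e (fun ν => commute_evalAt (commute_y_e c k _ _) (commute_y_e c k _ _))
      fun μ => commute_e_e _ _

theorem perm_R (w : Equiv.Perm (Fin n)) (p q : Fin n) (h : p ≠ q) :
    perm w (R (c := c) Q p q h) = R Q (w p) (w q) (w.injective.ne h) := by
  unfold R
  rw [map_sum]
  refine Fintype.sum_bijective (permSeq w) (permSeq_bijective w) _ _ fun ν => ?_
  simp only [map_mul, map_sub, map_pow, apply_ite (perm w), map_zero, map_evalAt, perm_y, perm_e,
    perm_invSub, perm_invAdd, permSeq, Equiv.symm_apply_apply]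

theorem R_swap (hc : Function.Involutive c) (hQ : IsAdmissible c Q) {p q : Fin n} (h : p ≠ q) :
    R (c := c) Q q p h.symm = R Q p q h := by
  refine Finset.sum_congr rfl fun ν _ => ?_
  have h1 : ν q = c (ν p) ↔ ν p = c (ν q) := ⟨fun h => by rw [h, hc _], fun h => by rw [h, hc _]⟩
  rw [hQ.evalAt_symm _ _ (commute_y c k p q), invSub_swap, invAdd_swap, neg_sq,
    if_congr h1 rfl rfl, if_congr (eq_comm (a := ν q)) rfl rfl]

/-- Multiplying by `c_p` interchanges the two kinds of terms: it flips `ν_p`, which exchanges the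
two conditions, and it turns `(y_p + y_q)⁻¹ c_p c_q` into a multiple of `(y_p - y_q)⁻¹`. -/
theorem rMatrix_mul_cl_left [Invertible (2 : k)] (hc : Function.Involutive c) {p q : Fin n}
    (h : p ≠ q) : rMatrix k c p q h * cl k c p = cl k c q * rMatrix k c p q h := by
  refine ext_mul_e fun ν => ?_
  have h1 : ν q = c (ν p) ↔ ν p = c (ν q) := ⟨fun h => by rw [h, hc _], fun h => by rw [h, hc _]⟩
  have h2 : c (ν p) = ν q ↔ ν p = c (ν q) := ⟨fun h => by rw [← h, hc _], fun h => by rw [h, hc _]⟩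
  rw [mul_assoc, cl_mul_e, ← mul_assoc, rMatrix_mul_e, mul_assoc, ← cl_mul_e, mul_assoc,
    rMatrix_mul_e, ← mul_assoc, ← mul_assoc, rCoeff, rCoeff, flip_self, flip_of_ne c h.symm,
    if_congr h2 rfl rfl, if_congr (hc.injective.eq_iff) rfl rfl]
  congr 1
  have e1 : invAdd k c p q h * clcl k c p q * cl k c p = -(cl k c q * invSub k c p q h) := by
    rw [clcl, cl_mul_cl_of_ne c k h, cl_mul_invSub_right, mul_neg, neg_mul, mul_assoc, mul_assoc,
      cl_mul_cl_self, mul_one]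
  have e2 : cl k c q * (invAdd k c p q h * clcl k c p q) = -(invSub k c p q h * cl k c p) := by
    rw [clcl, cl_mul_cl_of_ne c k h, ← mul_assoc, cl_mul_invAdd_right, mul_neg, mul_assoc,
      ← mul_assoc (cl k c q), cl_mul_cl_self, one_mul]
  simp only [sub_mul, mul_sub, ite_mul, mul_ite, zero_mul, mul_zero, e1, e2]
  split_ifs <;> noncomm_ring

theorem rMatrix_mul_cl_right [Invertible (2 : k)] (hc : Function.Involutive c) {p q : Fin n}
    (h : p ≠ q) : rMatrix k c p q h * cl k c q = cl k c p * rMatrix k c p q h := by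
  have := rMatrix_mul_cl_left (k := k) hc h.symm
  rw [rMatrix_swap hc h] at this
  simpa using this

theorem commute_rMatrix_cl {p q r : Fin n}
    (h : p ≠ q) (hp : r ≠ p) (hq : r ≠ q) : Commute (rMatrix k c p q h) (cl k c r) := by
  refine ext_mul_e fun ν => ?_
  have e1 : Commute (clcl k c p q) (cl k c r) := by
    change _ * _ = _ * _
    rw [clcl, mul_assoc, cl_mul_cl_of_ne c k hq.symm, mul_neg, ← mul_assoc,
      cl_mul_cl_of_ne c k hp.symm, neg_mul, neg_neg, mul_assoc]
  have e2 : Commute (rCoeff k c p q h ν) (cl k c r) := by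
    unfold rCoeff
    have e3 := ((commute_cl_invAdd h hp hq).symm).mul_left e1
    have e4 := (commute_cl_invSub (k := k) (c := c) h hp hq).symm
    split_ifs
    · exact e3.sub_left e4
    · exact e3.sub_left (Commute.zero_left _)
    · exact (Commute.zero_left _).sub_left e4
    · exact (Commute.zero_left _).sub_left (Commute.zero_left _)
  rw [mul_assoc, cl_mul_e, ← mul_assoc, rMatrix_mul_e, mul_assoc, ← cl_mul_e, mul_assoc,
    rMatrix_mul_e, ← mul_assoc, ← mul_assoc, ← e2.eq, rCoeff, rCoeff, flip_of_ne c hp.symm,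
    flip_of_ne c hq.symm]

/-- `R` has coefficients in the `y`'s, so it commutes with `y_r` and `e(ν)`. For Clifford generators
`R = q - r²` is used: `r` exchanges `c_p` and `c_q` and commutes with the others, so `r²` commutes
with all of them. -/
theorem commute_R [Invertible (2 : k)] (hc : Function.Involutive c) (hQ : IsAdmissible c Q)
    {p q : Fin n} (h : p ≠ q) (x : MK k c n) : Commute (R Q p q h) x := by
  have hdiag : ∀ x, (∀ r, Commute (y k c r) x) → (∀ ν, Commute (e k c ν) x) →
      Commute (R Q p q h) x := by
    intro x hy he
    refine commute_sum_e (fun ν => ((commute_evalAt (hy _) (hy _)).sub_left ?_).sub_left ?_) he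
    · split_ifs
      · exact (commute_invSub h (hy p).symm (hy q).symm).symm.pow_left 2
      · exact Commute.zero_left _
    · split_ifs
      · exact (commute_invAdd h (hy p).symm (hy q).symm).symm.pow_left 2
      · exact Commute.zero_left _
  refine commute_of_gen (fun r => ?_) (fun r => ?_) (fun ν => ?_) x
  · exact hdiag _ (fun r' => commute_y c k _ _) fun ν => (commute_y_e c k _ _).symm
  · rw [R_eq hc]
    refine (commute_qElem hQ h _).sub_left ?_
    by_cases hp : r = p
    · subst hp
      change _ * _ = _ * _
      rw [mul_assoc, rMatrix_mul_cl_left hc, ← mul_assoc, rMatrix_mul_cl_right hc, mul_assoc]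
    by_cases hq : r = q
    · subst hq
      change _ * _ = _ * _
      rw [mul_assoc, rMatrix_mul_cl_right hc, ← mul_assoc, rMatrix_mul_cl_left hc, mul_assoc]
    · exact (commute_rMatrix_cl h hp hq).mul_left (commute_rMatrix_cl h hp hq)
  · exact hdiag _ (fun r' => commute_y_e c k _ _) fun μ => commute_e_e _ _

theorem commute_rMatrix_y {p q r : Fin n} (h : p ≠ q) (hp : r ≠ p) (hq : r ≠ q) :
    Commute (rMatrix k c p q h) (y k c r) := by
  refine Commute.sum_left _ _ _ fun ν _ => Commute.mul_left ?_ (commute_y_e c k _ _).symm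
  have e1 : Commute (clcl k c p q) (y k c r) :=
    (commute_cl_y c k hp.symm).mul_left (commute_cl_y c k hq.symm)
  have e3 := ((commute_y_invAdd r h).symm).mul_left e1
  have e4 := (commute_y_invSub (k := k) (c := c) r h).symm
  unfold rCoeff
  split_ifs
  · exact e3.sub_left e4
  · exact e3.sub_left (Commute.zero_left _)
  · exact (Commute.zero_left _).sub_left e4
  · exact (Commute.zero_left _).sub_left (Commute.zero_left _)

/-- Since `τ_a y_{a+1} = y_a τ_a`, the whole right-hand side of the relation between `σ_a` and
`y_{a+1}` comes from `r`; its denominators cancel here. -/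
theorem rMatrix_mul_y_right {p q : Fin n} (h : p ≠ q) (ν : Fin n → J) :
    (rMatrix k c p q h * y k c q - y k c p * rMatrix k c p q h) * e k c ν =
      (if ν p = ν q then e k c ν else 0)
        - (if ν p = c (ν q) then cl k c p * cl k c q * e k c ν else 0) := by
  have e1 : clcl k c p q * y k c q = -(y k c q * clcl k c p q) := by
    rw [clcl, mul_assoc, cl_mul_y_self, mul_neg, ← mul_assoc, (commute_cl_y c k h).eq, mul_assoc]
  have e2 : rCoeff k c p q h ν * y k c q - y k c p * rCoeff k c p q h ν =
      (if ν p = ν q then 1 else 0) - (if ν p = c (ν q) then clcl k c p q else 0) := by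
    have e3 : invAdd k c p q h * clcl k c p q * y k c q
        - y k c p * (invAdd k c p q h * clcl k c p q) = -clcl k c p q := by
      rw [mul_assoc, e1, mul_neg, ← mul_assoc, ← mul_assoc, (commute_y_invAdd p h).eq, ← neg_mul,
        ← sub_mul, ← neg_add', ← mul_add, add_comm, invAdd_mul, neg_one_mul]
    have e4 : y k c p * invSub k c p q h - invSub k c p q h * y k c q = 1 := by
      rw [(commute_y_invSub p h).eq, ← mul_sub, invSub_mul]
    unfold rCoeff
    generalize invAdd k c p q h * clcl k c p q = X at e3 ⊢
    rw [← neg_eq_iff_eq_neg.mpr e3, ← e4]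
    split_ifs <;> noncomm_ring
  calc _ = (rCoeff k c p q h ν * y k c q - y k c p * rCoeff k c p q h ν) * e k c ν := by
        rw [sub_mul, sub_mul, mul_assoc, (commute_y_e c k q ν).eq, ← mul_assoc, rMatrix_mul_e,
          mul_assoc, mul_assoc, mul_assoc, mul_assoc, rMatrix_mul_e, (commute_y_e c k q ν).eq]
    _ = _ := by
        rw [e2, sub_mul, ite_mul, ite_mul, one_mul, zero_mul, clcl]

theorem y_right_mul_rMatrix {p q : Fin n} (h : p ≠ q) (ν : Fin n → J) :
    (y k c q * rMatrix k c p q h - rMatrix k c p q h * y k c p) * e k c ν =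
      (if ν p = ν q then e k c ν else 0)
        + (if ν p = c (ν q) then cl k c p * cl k c q * e k c ν else 0) := by
  have e1 : clcl k c p q * y k c p = -(y k c p * clcl k c p q) := by
    rw [clcl, mul_assoc, (commute_cl_y c k h.symm).eq, ← mul_assoc, cl_mul_y_self, neg_mul,
      mul_assoc]
  have e2 : y k c q * rCoeff k c p q h ν - rCoeff k c p q h ν * y k c p =
      (if ν p = ν q then 1 else 0) + (if ν p = c (ν q) then clcl k c p q else 0) := by
    have e3 : y k c q * (invAdd k c p q h * clcl k c p q)
        - invAdd k c p q h * clcl k c p q * y k c p = clcl k c p q := by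
      rw [mul_assoc, e1, mul_neg, ← mul_assoc, ← mul_assoc, (commute_y_invAdd q h).eq, sub_neg_eq_add,
        ← add_mul, ← mul_add, add_comm, invAdd_mul, one_mul]
    have e4 : invSub k c p q h * y k c p - y k c q * invSub k c p q h = 1 := by
      rw [(commute_y_invSub q h).eq, ← mul_sub, invSub_mul]
    unfold rCoeff
    generalize invAdd k c p q h * clcl k c p q = X at e3 ⊢
    rw [← e3, ← e4]
    split_ifs <;> noncomm_ring
  calc _ = (y k c q * rCoeff k c p q h ν - rCoeff k c p q h ν * y k c p) * e k c ν := by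
        rw [sub_mul, sub_mul, mul_assoc, rMatrix_mul_e, mul_assoc, (commute_y_e c k p ν).eq,
          ← mul_assoc (rMatrix k c p q h), rMatrix_mul_e, mul_assoc, mul_assoc, mul_assoc,
          (commute_y_e c k p ν).eq]
    _ = _ := by
        rw [e2, add_mul, ite_mul, ite_mul, one_mul, zero_mul, clcl]

end MK

end RMatrix

/-! ### The relations of `RC_n` in `SK_n` -/

section Intertwiners

/-- Here `ta, tb` stand for `τ_a, τ_{a+1}` and `gij` for `r_{i,j}`. All `g`'s are moved to the left.
The cubic and quadratic terms in `t` agree on both sides, the linear ones agree by `assoc` and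
`assoc'`, and what remains has no `t`. -/
theorem braid_defect {A : Type*} [Ring A] {ta tb g12 g13 g23 q12 q23 : A}
    (hbraid : tb * ta * tb = ta * tb * ta)
    (a12 : ta * g12 = -(g12 * ta)) (a13 : ta * g13 = g23 * ta) (a23 : ta * g23 = g13 * ta)
    (b12 : tb * g12 = g13 * tb) (b13 : tb * g13 = g12 * tb) (b23 : tb * g23 = -(g23 * tb))
    (ha : ta * ta = q12 - g12 * g12) (hb : tb * tb = q23 - g23 * g23)
    (assoc : g12 * g13 + g13 * g23 = g23 * g12) (assoc' : g23 * g13 + g13 * g12 = g12 * g23)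
    (comm : g23 * g23 * g13 = g13 * (g23 * g23)) :
    (tb + g23) * (ta + g12) * (tb + g23) - (ta + g12) * (tb + g23) * (ta + g12) =
      g13 * (q23 - q12) := by
  have e1 : (tb + g23) * (ta + g12) * (tb + g23) = tb * ta * tb + g12 * (tb * ta) +
      g13 * (q23 - g23 * g23) - g13 * g23 * tb + g23 * (ta * tb) + g23 * g13 * ta +
      g23 * g12 * tb + g23 * g12 * g23 := by
    have h1 : tb * ta * g23 = g12 * (tb * ta) := by
      rw [mul_assoc, a23, ← mul_assoc, b13, mul_assoc]
    have h2 : tb * g12 * tb = g13 * (q23 - g23 * g23) := by rw [b12, mul_assoc, hb]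
    have h3 : tb * g12 * g23 = -(g13 * g23 * tb) := by
      rw [b12, mul_assoc, b23, mul_neg, mul_assoc]
    have h4 : g23 * ta * g23 = g23 * g13 * ta := by rw [mul_assoc, a23, mul_assoc]
    calc _ = tb * ta * tb + tb * ta * g23 + tb * g12 * tb + tb * g12 * g23 + g23 * ta * tb +
          g23 * ta * g23 + g23 * g12 * tb + g23 * g12 * g23 := by noncomm_ring
      _ = _ := by rw [h1, h2, h3, h4]; noncomm_ring
  have e2 : (ta + g12) * (tb + g23) * (ta + g12) = ta * tb * ta + g23 * (ta * tb) +
      g13 * (q12 - g12 * g12) - g13 * g12 * ta + g12 * (tb * ta) + g12 * g13 * tb +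
      g12 * g23 * ta + g12 * g23 * g12 := by
    have h1 : ta * tb * g12 = g23 * (ta * tb) := by
      rw [mul_assoc, b12, ← mul_assoc, a13, mul_assoc]
    have h2 : ta * g23 * ta = g13 * (q12 - g12 * g12) := by rw [a23, mul_assoc, ha]
    have h3 : ta * g23 * g12 = -(g13 * g12 * ta) := by
      rw [a23, mul_assoc, a12, mul_neg, mul_assoc]
    have h4 : g12 * tb * g12 = g12 * g13 * tb := by rw [mul_assoc, b12, mul_assoc]
    calc _ = ta * tb * ta + ta * tb * g12 + ta * g23 * ta + ta * g23 * g12 + g12 * tb * ta +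
          g12 * tb * g12 + g12 * g23 * ta + g12 * g23 * g12 := by noncomm_ring
      _ = _ := by rw [h1, h2, h3, h4]; noncomm_ring
  -- The cubic terms in `g` cancel the contributions `-g13 g23²` and `g13 g12²` that come from `tb²`
  -- and `ta²`.
  have e3 : g23 * g12 * g23 - g12 * g23 * g12 = g13 * (g23 * g23) - g13 * (g12 * g12) := by
    have h1 : g12 * g13 * g23 = g23 * g12 * g23 - g13 * (g23 * g23) := by
      rw [← assoc]; noncomm_ring
    have h2 : g23 * g13 * g12 = g23 * g12 * g23 - g13 * (g23 * g23) := by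
      rw [mul_assoc, eq_sub_iff_add_eq'.mpr assoc', ← comm]; noncomm_ring
    have h3 : g12 * g23 * g12 = g23 * g13 * g12 + g13 * (g12 * g12) := by
      rw [← assoc']; noncomm_ring
    rw [h3, h2]; noncomm_ring
  have h23 : g23 * g12 * tb = g12 * g13 * tb + g13 * g23 * tb := by rw [← assoc, add_mul]
  have h12 : g12 * g23 * ta = g23 * g13 * ta + g13 * g12 * ta := by rw [← assoc', add_mul]
  rw [e1, e2, hbraid, h23, h12, ← sub_eq_zero]
  rw [← sub_eq_zero] at e3
  rw [← e3]
  noncomm_ring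

variable {n : ℕ} {k : Type u} [CommRing k] {J : Type v} {c : J → J} [Fintype J] [DecidableEq J]
  {Q : J → J → MvPolynomial (Fin 2) k}

namespace MK

/-- If `ν_p = c(ν_q)`, flipping both entries by `c_p c_q` is the same as swapping them; if `ν_p =
ν_q`, swapping does nothing. So both terms move `e(ν)` as the transposition does, hence as `τ_a`
does for adjacent positions. -/
theorem rCoeff_mul_e (hc : Function.Involutive c) {p q : Fin n} (h : p ≠ q) (ν : Fin n → J) :
    rCoeff k c p q h ν * e k c ν = e k c (permSeq (Equiv.swap p q) ν) * rCoeff k c p q h ν := by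
  have e1 : (if ν p = c (ν q) then invAdd k c p q h * clcl k c p q else 0) * e k c ν =
      e k c (permSeq (Equiv.swap p q) ν) *
        (if ν p = c (ν q) then invAdd k c p q h * clcl k c p q else 0) := by
    split_ifs with h1
    · have : permSeq (Equiv.swap p q) ν = flip c p (flip c q ν) := by
        funext r
        by_cases hp : r = p
        · subst hp
          simp [permSeq, flip_of_ne c h, h1, hc _]
        by_cases hq : r = q
        · subst hq
          simp [permSeq, flip_of_ne c hp, h1]
        · simp [permSeq, flip_of_ne c hp, flip_of_ne c hq, Equiv.swap_apply_of_ne_of_ne hp hq]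
      rw [this, mul_assoc, clcl_mul_e, ← mul_assoc, ← (commute_e_invAdd _ h).eq, mul_assoc]
    · rw [zero_mul, mul_zero]
  have e2 : (if ν p = ν q then invSub k c p q h else 0) * e k c ν =
      e k c (permSeq (Equiv.swap p q) ν) * (if ν p = ν q then invSub k c p q h else 0) := by
    split_ifs with h1
    · have : permSeq (Equiv.swap p q) ν = ν := by
        funext r
        by_cases hp : r = p
        · subst hp; simp [permSeq, h1]
        by_cases hq : r = q
        · subst hq; simp [permSeq, h1]
        · simp [permSeq, Equiv.swap_apply_of_ne_of_ne hp hq]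
      rw [this, (commute_e_invSub ν h).eq]
    · rw [zero_mul, mul_zero]
  rw [rCoeff, sub_mul, mul_sub, e1, e2]

theorem rMatrix_mul_e' (hc : Function.Involutive c) {p q : Fin n} (h : p ≠ q) (ν : Fin n → J) :
    rMatrix k c p q h * e k c ν = e k c (permSeq (Equiv.swap p q) ν) * rMatrix k c p q h := by
  rw [rMatrix_mul_e, rCoeff_mul_e hc, rMatrix, Finset.mul_sum, Finset.sum_eq_single ν]
  · rw [rCoeff_mul_e hc, ← mul_assoc, e_mul_e, if_pos rfl]
  · intro μ _ hμ
    rw [rCoeff_mul_e hc, ← mul_assoc, e_mul_e, if_neg, zero_mul]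
    exact fun h => hμ ((permSeq_bijective (Equiv.swap p q)).injective h).symm
  · simp

theorem commute_rMatrix_rMatrix (hc : Function.Involutive c) {p q s t : Fin n} (h : p ≠ q)
    (h' : s ≠ t) (h1 : s ≠ p) (h2 : s ≠ q) (h3 : t ≠ p) (h4 : t ≠ q) :
    Commute (rMatrix k c p q h) (rMatrix k c s t h') := by
  refine ext_mul_e fun ν => ?_
  have e1 : rCoeff k c s t h' (permSeq (Equiv.swap p q) ν) = rCoeff k c s t h' ν := by
    simp only [rCoeff, permSeq, Equiv.symm_swap, Equiv.swap_apply_of_ne_of_ne h1 h2,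
      Equiv.swap_apply_of_ne_of_ne h3 h4]
  have e2 : Commute (rMatrix k c p q h) (rCoeff k c s t h' ν) := by
    have e3 := (commute_invAdd h' (commute_rMatrix_y (k := k) (c := c) h h1 h2)
      (commute_rMatrix_y h h3 h4)).mul_right ((commute_rMatrix_cl (k := k) (c := c) h h1 h2).mul_right
        (commute_rMatrix_cl h h3 h4))
    have e4 := commute_invSub h' (commute_rMatrix_y (k := k) (c := c) h h1 h2)
      (commute_rMatrix_y h h3 h4)
    unfold rCoeff clcl
    split_ifs
    · exact e3.sub_right e4
    · exact e3.sub_right (Commute.zero_right _)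
    · exact (Commute.zero_right _).sub_right e4
    · exact (Commute.zero_right _).sub_right (Commute.zero_right _)
  rw [mul_assoc, rMatrix_mul_e, ← mul_assoc, e2.eq, mul_assoc, mul_assoc, rMatrix_mul_e' hc,
    ← mul_assoc, ← mul_assoc, rMatrix_mul_e, e1]

/-- The numerators of the two divided differences appear after `e(ν)` has replaced `q₂₃ - q₁₂` by
values of `Q`, with the symmetry of `Q` used to put the middle variable second. In the second term
`c_p c_s` is moved to the right and negates `y_p` and `y_s`; the sign rule then replaces the index
`ν_s` by `ν_p`. -/
theorem rMatrix_mul_qElem_sub (hc : Function.Involutive c) (hQ : IsAdmissible c Q)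
    {p q s : Fin n} (hpq : p ≠ q) (hps : p ≠ s) (hqs : q ≠ s) (ν : Fin n → J) :
    rMatrix k c p s hps * (qElem c Q q s - qElem c Q p q) * e k c ν =
      (if ν p = ν s then divDiff (Q (ν p) (ν q)) (y k c s) (y k c p) (y k c q) * e k c ν else 0)
      + (if ν p = c (ν s) then divDiff (Q (ν p) (ν q)) (y k c s) (-y k c p) (y k c q)
          * (cl k c p * cl k c s) * e k c ν else 0) := by
  have hX : ∀ x, Commute (qElem c Q q s - qElem c Q p q) x := fun x =>
    (commute_qElem hQ hqs x).sub_left (commute_qElem hQ hpq x)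
  rw [mul_assoc, (hX _).eq, ← mul_assoc, rMatrix_mul_e, mul_assoc, ← (hX _).eq, sub_mul,
    qElem_mul_e, qElem_mul_e, hQ.evalAt_symm (ν s) (ν q) (commute_y c k s q), ← sub_mul,
    ← mul_assoc]
  have e1 : ν p = ν s → invSub k c p s hps * (evalAt (Q (ν s) (ν q)) (y k c s) (y k c q) -
      evalAt (Q (ν p) (ν q)) (y k c p) (y k c q)) =
      -divDiff (Q (ν p) (ν q)) (y k c s) (y k c p) (y k c q) := fun h => by
    rw [← h, ← divDiff_spec _ (commute_y c k s p), ← mul_assoc, ← neg_sub (y k c p), mul_neg,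
      invSub_mul, neg_one_mul]
  have e2 : ν p = c (ν s) → invAdd k c p s hps * clcl k c p s *
      (evalAt (Q (ν s) (ν q)) (y k c s) (y k c q) - evalAt (Q (ν p) (ν q)) (y k c p) (y k c q)) =
      divDiff (Q (ν p) (ν q)) (y k c s) (-y k c p) (y k c q) * clcl k c p s := fun h => by
    have y1 : clcl k c p s * y k c s = -y k c s * clcl k c p s := by
      rw [clcl, mul_assoc, cl_mul_y_self, mul_neg, ← mul_assoc, (commute_cl_y c k hps).eq,
        mul_assoc, neg_mul]
    have y2 : clcl k c p s * y k c p = -y k c p * clcl k c p s := by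
      rw [clcl, mul_assoc, (commute_cl_y c k hps.symm).eq, ← mul_assoc, cl_mul_y_self, neg_mul,
        neg_mul, mul_assoc]
    have y3 : clcl k c p s * y k c q = y k c q * clcl k c p s :=
      (commute_cl_y c k hpq).mul_left (commute_cl_y c k hqs.symm)
    have hneg := hQ.evalAt_neg_left (c (ν s)) (ν q) (commute_y c k s q)
    rw [hc] at hneg
    rw [mul_assoc, mul_sub, evalAt_semiconj _ y1 y3, evalAt_semiconj _ y2 y3, hneg, ← h, ← sub_mul,
      ← divDiff_spec _ (commute_y c k s p).neg_right, ← mul_assoc, ← mul_assoc, sub_neg_eq_add,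
      add_comm (y k c s), invAdd_mul, one_mul]
  rw [rCoeff, sub_mul]
  split_ifs with h1 h2 h2
  · rw [e1 h2, e2 h1, clcl]; noncomm_ring
  · rw [e2 h1, clcl]; noncomm_ring
  · rw [e1 h2]; noncomm_ring
  · noncomm_ring

end MK

/-! ### The elements `σ_a` of `SK_n` satisfy the defining relations of `RC_n`. -/

namespace SK

theorem τ_mul_of (a : Fin (n - 1)) (x : MK k c n) :
    τ c Q a * of c Q n x = of c Q n (MK.perm (simpleRefl a) x) * τ c Q a := rel _ _ (.τ_ι a x)

variable (c Q) in
/-- The image in `SK_n` of the element `rMatrix` for the positions `a`, `a + 1`. -/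
def rElem (a : Fin (n - 1)) : SK c Q n := of c Q n (MK.rMatrix k c (lo a) (hi a) (lo_ne_hi a))

/-- The cases are the possible truth values of `ν_a = ν_{a+1}` and `ν_a = c(ν_{a+1})`: both hold
exactly when the two entries are equal and fixed by `c`. -/
theorem sigma_eq (hc : Function.Involutive c) (a : Fin (n - 1)) :
    sigma c Q a = τ c Q a + rElem c Q a := by
  have h1 : ∑ ν, e c Q ν = (1 : SK c Q n) := by
    have := congrArg (of c Q n) (MK.sum_e c k (n := n))
    rwa [map_sum, map_one] at this
  rw [← mul_one (τ c Q a + _), ← h1, Finset.mul_sum, sigma]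
  refine Finset.sum_congr rfl fun ν _ => ?_
  have h2 : rElem c Q a * e c Q ν =
      ((if ν (lo a) = c (ν (hi a)) then invAdd c Q a * (cl c Q (lo a) * cl c Q (hi a)) else 0)
        - (if ν (lo a) = ν (hi a) then invSub c Q a else 0)) * e c Q ν := by
    have := congrArg (of c Q n) (MK.rMatrix_mul_e (k := k) (c := c) (lo a) (hi a) (lo_ne_hi a) ν)
    simp only [map_mul, MK.rCoeff, MK.clcl, map_sub, apply_ite (of c Q n), map_zero] at this
    exact this
  rw [add_mul, h2, ← add_mul]
  congr 1
  unfold sigmaAux SameClass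
  generalize ν (lo a) = i, ν (hi a) = j
  by_cases h3 : i = j
  · subst h3
    by_cases h4 : c i = i
    · simp [h4]; abel
    · simp [h4, Ne.symm h4]; abel
  · by_cases h4 : i = c j
    · subst h4
      have h5 : c (c j) ≠ c j := by rw [hc]; exact Ne.symm h3
      simp [h3, h5]
    · simp [h3, h4]

theorem maRel_eq (x x' : SK c Q n) (h : MARel c (y c Q) (cl c Q) (e c Q) x x') : x = x' := by
  have key : ∀ {z z' : MA k c n}, MARel c (MA.y k c) (MA.cl k c) (MA.e k c) z z' →
      of c Q n (MK.of k c n z) = of c Q n (MK.of k c n z') := fun h => by rw [MA.rel k c _ _ h]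
  cases h with
  | e_mul_e μ ν =>
    have := key (.e_mul_e μ ν)
    simp only [map_mul, apply_ite (MK.of k c n), apply_ite (of c Q n), map_zero] at this
    exact this
  | sum_e =>
    have := key .sum_e
    simp only [map_sum, map_one] at this
    exact this
  | y_e p ν =>
    have := key (.y_e p ν)
    simp only [map_mul] at this
    exact this
  | cl_e p ν =>
    have := key (.cl_e p ν)
    simp only [map_mul] at this
    exact this
  | y_y p q =>
    have := key (.y_y p q)
    simp only [map_mul] at this
    exact this
  | cl_cl p q =>
    have := key (.cl_cl p q)
    simp only [map_mul, map_add, apply_ite (MK.of k c n), apply_ite (of c Q n), map_zero,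
      map_ofNat] at this
    exact this
  | cl_y p q =>
    have := key (.cl_y p q)
    simp only [map_mul, map_neg, apply_ite (MK.of k c n), apply_ite (of c Q n)] at this
    exact this

theorem τ_mul_of_rMatrix (a : Fin (n - 1)) {p q p' q' : Fin n} (h : p ≠ q) (h' : p' ≠ q')
    (hp : simpleRefl a p = p') (hq : simpleRefl a q = q') :
    τ c Q a * of c Q n (MK.rMatrix k c p q h) =
      of c Q n (MK.rMatrix k c p' q' h') * τ c Q a := by
  subst hp hq
  rw [τ_mul_of, MK.perm_rMatrix]

theorem τ_mul_rElem (hc : Function.Involutive c) (a : Fin (n - 1)) :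
    τ c Q a * rElem c Q a = -(rElem c Q a * τ c Q a) := by
  rw [rElem, τ_mul_of_rMatrix a _ (lo_ne_hi a).symm (Equiv.swap_apply_left _ _)
    (Equiv.swap_apply_right _ _), MK.rMatrix_swap hc, map_neg, neg_mul]

theorem τ_mul_τ [Invertible (2 : k)] (hc : Function.Involutive c) (a : Fin (n - 1)) :
    τ c Q a * τ c Q a =
      of c Q n (MK.qElem c Q (lo a) (hi a)) - rElem c Q a * rElem c Q a := by
  rw [← pow_two, rel _ _ (.τ_sq a), MK.R_eq hc, map_sub, map_mul, rElem]

theorem simpleRefl_apply_of_ne {a : Fin (n - 1)} {p : Fin n} (h1 : p ≠ lo a) (h2 : p ≠ hi a) :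
    simpleRefl a p = p := Equiv.swap_apply_of_ne_of_ne h1 h2

theorem Far.ne {a b : Fin (n - 1)} (h : Far a b) :
    lo b ≠ lo a ∧ lo b ≠ hi a ∧ hi b ≠ lo a ∧ hi b ≠ hi a := by
  unfold Far at h
  simp only [lo, hi, ne_eq, Fin.mk.injEq]
  omega

theorem rcRel_eq [Invertible (2 : k)] (hc : Function.Involutive c) (hQ : IsAdmissible c Q)
    (x x' : SK c Q n) (h : RCRel c Q (y c Q) (cl c Q) (e c Q) (sigma c Q) x x') : x = x' := by
  cases h with
  | ma _ _ h => exact maRel_eq _ _ h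
  | σ_e a ν =>
    rw [sigma_eq hc, add_mul, mul_add, e, τ_mul_of, MK.perm_e, rElem, ← map_mul,
      MK.rMatrix_mul_e' hc, map_mul]
    rfl
  | σ_cl a p =>
    rw [sigma_eq hc, add_mul, mul_add, cl, τ_mul_of, MK.perm_cl, rElem, ← map_mul]
    rw [cl, ← map_mul]
    congr 2
    by_cases h1 : p = lo a
    · rw [h1, MK.rMatrix_mul_cl_left hc, simpleRefl, Equiv.swap_apply_left]
    by_cases h2 : p = hi a
    · rw [h2, MK.rMatrix_mul_cl_right hc, simpleRefl, Equiv.swap_apply_right]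
    · rw [simpleRefl_apply_of_ne h1 h2, (MK.commute_rMatrix_cl _ h1 h2).eq]
  | σ_y a p ν h1 h2 =>
    congr 1
    rw [sigma_eq hc, add_mul, mul_add, y, τ_mul_of, MK.perm_y, simpleRefl_apply_of_ne h1 h2, rElem,
      ← map_mul, (MK.commute_rMatrix_y _ h1 h2).eq, map_mul]
  | σ_y_hi a ν =>
    have h1 : τ c Q a * y c Q (hi a) = y c Q (lo a) * τ c Q a := by
      rw [y, τ_mul_of, MK.perm_y, simpleRefl, Equiv.swap_apply_right]; rfl
    have h2 := congrArg (of c Q n)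
      (MK.rMatrix_mul_y_right (k := k) (c := c) (lo_ne_hi a) ν)
    simp only [map_mul, map_sub, apply_ite (of c Q n), map_zero] at h2
    rw [sigma_eq hc, add_mul, mul_add, h1, add_sub_add_left_eq_sub]
    exact h2
  | y_hi_σ a ν =>
    have h1 : τ c Q a * y c Q (lo a) = y c Q (hi a) * τ c Q a := by
      rw [y, τ_mul_of, MK.perm_y, simpleRefl, Equiv.swap_apply_left]; rfl
    have h2 := congrArg (of c Q n)
      (MK.y_right_mul_rMatrix (k := k) (c := c) (lo_ne_hi a) ν)
    simp only [map_mul, map_sub, map_add, apply_ite (of c Q n), map_zero] at h2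
    rw [sigma_eq hc, add_mul, mul_add, h1, add_sub_add_left_eq_sub]
    exact h2
  | σ_sq a ν =>
    -- In `(τ + r)²` the mixed terms cancel and `τ² = q - r²`.
    have h1 : sigma c Q a ^ 2 = of c Q n (MK.qElem c Q (lo a) (hi a)) := by
      rw [sigma_eq hc, pow_two, add_mul, mul_add, mul_add, τ_mul_rElem hc, τ_mul_τ hc]
      abel
    have h2 := congrArg (of c Q n) (MK.qElem_mul_e (c := c) (Q := Q) (lo a) (hi a) ν)
    rw [map_mul, map_mul, map_evalAt] at h2
    rw [h1]
    exact h2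
  | σ_σ a b h =>
    obtain ⟨h1, h2, h3, h4⟩ := Far.ne h
    have e1 : τ c Q a * rElem c Q b = rElem c Q b * τ c Q a :=
      τ_mul_of_rMatrix a _ _ (simpleRefl_apply_of_ne h1 h2) (simpleRefl_apply_of_ne h3 h4)
    have e2 : τ c Q b * rElem c Q a = rElem c Q a * τ c Q b :=
      τ_mul_of_rMatrix b _ _ (simpleRefl_apply_of_ne h1.symm h3.symm)
        (simpleRefl_apply_of_ne h2.symm h4.symm)
    have e3 : rElem c Q a * rElem c Q b = rElem c Q b * rElem c Q a := by
      rw [rElem, rElem, ← map_mul, ← map_mul,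
        (MK.commute_rMatrix_rMatrix hc _ _ h1 h2 h3 h4).eq]
    rw [sigma_eq hc, sigma_eq hc, add_mul, mul_add, mul_add, add_mul, mul_add, mul_add,
      rel _ _ (.τ_τ a b h), e1, e3, e2]
    abel
  | braid a b ν h =>
    have hab : lo b = hi a := Fin.ext h
    have hps : lo a ≠ hi b := by simp only [lo, hi, ne_eq, Fin.mk.injEq]; omega
    have hqs : hi a ≠ hi b := by simp only [hi, ne_eq, Fin.mk.injEq]; omega
    have hb : rElem c Q b = of c Q n (MK.rMatrix k c (hi a) (hi b) hqs) := by
      unfold rElem; congr 2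
    have sa1 : simpleRefl a (lo a) = hi a := Equiv.swap_apply_left _ _
    have sa2 : simpleRefl a (hi a) = lo a := Equiv.swap_apply_right _ _
    have sa3 : simpleRefl a (hi b) = hi b := simpleRefl_apply_of_ne hps.symm hqs.symm
    have sb1 : simpleRefl b (lo a) = lo a :=
      simpleRefl_apply_of_ne (by rw [hab]; exact lo_ne_hi a) hps
    have sb2 : simpleRefl b (hi a) = hi b := by
      rw [← hab]; exact Equiv.swap_apply_left _ _
    have sb3 : simpleRefl b (hi b) = hi a := by
      rw [← hab]; exact Equiv.swap_apply_right _ _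
    have assoc := MK.rMatrix_associative (k := k) hc (lo_ne_hi a) hps hqs
    -- The same equation for the three positions in reverse order, rewritten by antisymmetry.
    have assoc' := MK.rMatrix_associative (k := k) hc hqs.symm hps.symm (lo_ne_hi a).symm
    rw [MK.rMatrix_swap hc hqs, MK.rMatrix_swap hc hps, MK.rMatrix_swap hc (lo_ne_hi a),
      neg_mul_neg, neg_mul_neg, neg_mul_neg] at assoc'
    have comm : MK.rMatrix k c (hi a) (hi b) hqs * MK.rMatrix k c (hi a) (hi b) hqs *
        MK.rMatrix k c (lo a) (hi b) hps = MK.rMatrix k c (lo a) (hi b) hps *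
        (MK.rMatrix k c (hi a) (hi b) hqs * MK.rMatrix k c (hi a) (hi b) hqs) := by
      -- `r²` is central, as the difference `q - R` of central elements.
      have h1 := (MK.commute_qElem hQ hqs (MK.rMatrix k c (lo a) (hi b) hps)).sub_left
        (MK.commute_R hc hQ hqs (MK.rMatrix k c (lo a) (hi b) hps))
      rw [MK.R_eq hc, sub_sub_cancel] at h1
      exact h1
    have ha2 := τ_mul_τ (Q := Q) hc a
    have hb2 := τ_mul_τ (Q := Q) hc b
    have hba := τ_mul_rElem (Q := Q) hc b
    have assocS := congrArg (of c Q n) assoc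
    have assocS' := congrArg (of c Q n) assoc'
    have commS := congrArg (of c Q n) comm
    simp only [map_mul, map_add] at assocS assocS' commS
    rw [hb, hab] at hb2
    rw [hb] at hba
    have key := braid_defect (rel _ _ (.braid a b h)) (τ_mul_rElem (Q := Q) hc a)
      (τ_mul_of_rMatrix a hps hqs sa1 sa3) (τ_mul_of_rMatrix a hqs hps sa2 sa3)
      (τ_mul_of_rMatrix b (lo_ne_hi a) hps sb1 sb2) (τ_mul_of_rMatrix b hps (lo_ne_hi a) sb1 sb3)
      hba ha2 hb2 assocS assocS' commS
    have fin := congrArg (of c Q n) (MK.rMatrix_mul_qElem_sub hc hQ (lo_ne_hi a) hps hqs ν)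
    simp only [map_mul, map_add, map_sub, apply_ite (of c Q n), map_zero, map_divDiff,
      map_neg] at fin
    rw [sigma_eq hc, sigma_eq hc, hb, key]
    exact fin

end SK
end Intertwiners

/-! ### The regular representation of `SK_n` -/

section RegularRepresentation

variable {n : ℕ} {k : Type u} [CommRing k] {J : Type v} {c : J → J} [Fintype J] [DecidableEq J]
  {Q : J → J → MvPolynomial (Fin 2) k}

theorem simpleRefl_mul_self (a : Fin (n - 1)) : simpleRefl a * simpleRefl a = 1 :=
  Equiv.swap_mul_self _ _

theorem simpleRefl_inv (a : Fin (n - 1)) : (simpleRefl a)⁻¹ = simpleRefl a :=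
  Equiv.swap_inv _ _

theorem simpleRefl_mul_cancel (a : Fin (n - 1)) (w : Equiv.Perm (Fin n)) :
    simpleRefl a * (simpleRefl a * w) = w := by
  rw [← mul_assoc, simpleRefl_mul_self, one_mul]

theorem simpleRefl_comm {a b : Fin (n - 1)} (h : Far a b) :
    simpleRefl a * simpleRefl b = simpleRefl b * simpleRefl a := by
  obtain ⟨h1, h2, h3, h4⟩ := SK.Far.ne h
  rw [simpleRefl, simpleRefl, Equiv.mul_swap_eq_swap_mul,
    Equiv.swap_apply_of_ne_of_ne h1 h2, Equiv.swap_apply_of_ne_of_ne h3 h4]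

/-- For three positions `lo a`, `hi a = lo b`, `hi b`: the values of the simple reflections. -/
theorem simpleRefl_adjacent {a b : Fin (n - 1)} (h : b.1 = a.1 + 1) :
    lo a ≠ hi b ∧ hi a ≠ hi b ∧ lo b = hi a ∧
    simpleRefl a (lo a) = hi a ∧ simpleRefl a (hi a) = lo a ∧ simpleRefl a (hi b) = hi b ∧
    simpleRefl b (lo a) = lo a ∧ simpleRefl b (hi a) = hi b ∧ simpleRefl b (hi b) = hi a := by
  have hab : lo b = hi a := Fin.ext h
  have hps : lo a ≠ hi b := by simp only [lo, hi, ne_eq, Fin.mk.injEq]; omega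
  have hqs : hi a ≠ hi b := by simp only [hi, ne_eq, Fin.mk.injEq]; omega
  refine ⟨hps, hqs, hab, Equiv.swap_apply_left _ _, Equiv.swap_apply_right _ _,
    SK.simpleRefl_apply_of_ne hps.symm hqs.symm,
    SK.simpleRefl_apply_of_ne (by rw [hab]; exact lo_ne_hi a) hps, ?_, ?_⟩
  · rw [← hab]; exact Equiv.swap_apply_left _ _
  · rw [← hab]; exact Equiv.swap_apply_right _ _

theorem simpleRefl_braid {a b : Fin (n - 1)} (h : b.1 = a.1 + 1) :
    simpleRefl b * simpleRefl a * simpleRefl b = simpleRefl a * simpleRefl b * simpleRefl a := by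
  obtain ⟨-, -, hab, -, a2, a3, b1, b2, -⟩ := simpleRefl_adjacent h
  have e1 : simpleRefl b * simpleRefl a = Equiv.swap (lo a) (hi b) * simpleRefl b := by
    conv_lhs => rw [simpleRefl, simpleRefl, Equiv.mul_swap_eq_swap_mul]
    change Equiv.swap (simpleRefl b (lo a)) (simpleRefl b (hi a)) * _ = _
    rw [b1, b2]; rfl
  have e2 : simpleRefl a * simpleRefl b = Equiv.swap (lo a) (hi b) * simpleRefl a := by
    conv_lhs => rw [simpleRefl, simpleRefl, Equiv.mul_swap_eq_swap_mul]
    change Equiv.swap (simpleRefl a (lo b)) (simpleRefl a (hi b)) * _ = _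
    rw [hab, a2, a3]; rfl
  rw [e1, e2, mul_assoc, mul_assoc, simpleRefl_mul_self, simpleRefl_mul_self]

/-! ### The operators of the regular representation and their relations. -/

namespace MK

/-- The factor in the product of `τ_{p,q}` with the basis element of `w`. -/
def factor (c : J → J) (Q : J → J → MvPolynomial (Fin 2) k) (p q : Fin n) (h : p ≠ q)
    (w : Equiv.Perm (Fin n)) : MK k c n :=
  if w⁻¹ p < w⁻¹ q then R Q p q h else 1

theorem commute_factor [Invertible (2 : k)] (hc : Function.Involutive c)
    (hQ : IsAdmissible c Q) {p q : Fin n} (h : p ≠ q) (w : Equiv.Perm (Fin n)) (x : MK k c n) :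
    Commute (factor c Q p q h w) x := by
  unfold factor
  split_ifs
  · exact commute_R hc hQ h x
  · exact Commute.one_left x

/-- The factor is defined for arbitrary pairs of positions so that composites of the operators again
have factors as coefficients, attached to transformed pairs. -/
theorem perm_factor (a : Fin (n - 1)) {p q p' q' : Fin n} (h : p ≠ q) (h' : p' ≠ q')
    (hp : simpleRefl a p = p') (hq : simpleRefl a q = q') (w : Equiv.Perm (Fin n)) :
    perm (simpleRefl a) (factor c Q p q h (simpleRefl a * w)) = factor c Q p' q' h' w := by
  subst hp hq
  simp only [factor, mul_inv_rev, simpleRefl_inv, Equiv.Perm.mul_apply,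
    apply_ite (perm (simpleRefl a)), map_one, perm_R]

/-- Exactly one of the two orders of `p, q` is increasing under `w⁻¹`, and `R` is symmetric in them.
-/
theorem factor_mul_factor (hc : Function.Involutive c)
    (hQ : IsAdmissible c Q) {p q : Fin n} (h : p ≠ q) (w : Equiv.Perm (Fin n)) :
    factor c Q p q h w * factor c Q q p h.symm w = R Q p q h := by
  unfold factor
  rcases lt_or_gt_of_ne (w⁻¹.injective.ne h) with h1 | h1
  · rw [if_pos h1, if_neg h1.asymm, mul_one]
  · rw [if_neg h1.asymm, if_pos h1, one_mul, R_swap hc hQ h]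

/-- The action of `τ_a` in the regular representation. -/
def tauOp (c : J → J) (Q : J → J → MvPolynomial (Fin 2) k) (a : Fin (n - 1)) :
    Module.End k (Equiv.Perm (Fin n) → MK k c n) where
  toFun f w := factor c Q (lo a) (hi a) (lo_ne_hi a) w *
    perm (simpleRefl a) (f (simpleRefl a * w))
  map_add' f g := by
    funext w; simp only [Pi.add_apply, map_add, mul_add]
  map_smul' r f := by
    funext w; simp only [Pi.smul_apply, map_smul, RingHom.id_apply, mul_smul_comm]

theorem tauOp_apply (a : Fin (n - 1)) (f : Equiv.Perm (Fin n) → MK k c n)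
    (w : Equiv.Perm (Fin n)) :
    tauOp c Q a f w = factor c Q (lo a) (hi a) (lo_ne_hi a) w *
      perm (simpleRefl a) (f (simpleRefl a * w)) := rfl

theorem tauOp_tauOp_apply (a b : Fin (n - 1)) {p q : Fin n} (h : p ≠ q)
    (hp : simpleRefl a (lo b) = p) (hq : simpleRefl a (hi b) = q)
    (f : Equiv.Perm (Fin n) → MK k c n) (w : Equiv.Perm (Fin n)) :
    tauOp c Q a (tauOp c Q b f) w = factor c Q (lo a) (hi a) (lo_ne_hi a) w *
      factor c Q p q h w *
      perm (simpleRefl a * simpleRefl b) (f (simpleRefl b * simpleRefl a * w)) := by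
  rw [tauOp_apply, tauOp_apply, map_mul, perm_factor a (lo_ne_hi b) h hp hq, perm_perm, mul_assoc,
    mul_assoc]

theorem tauOp_tauOp_tauOp_apply (a b d : Fin (n - 1)) {p q p' q' p'' q'' : Fin n} (h : p ≠ q)
    (h' : p' ≠ q') (hp : simpleRefl a (lo b) = p) (hq : simpleRefl a (hi b) = q)
    (hp' : simpleRefl b (lo d) = p'') (hq' : simpleRefl b (hi d) = q'')
    (hp'' : simpleRefl a p'' = p') (hq'' : simpleRefl a q'' = q')
    (f : Equiv.Perm (Fin n) → MK k c n) (w : Equiv.Perm (Fin n)) :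
    tauOp c Q a (tauOp c Q b (tauOp c Q d f)) w = factor c Q (lo a) (hi a) (lo_ne_hi a) w *
      factor c Q p q h w * factor c Q p' q' h' w *
      perm (simpleRefl a * simpleRefl b * simpleRefl d)
        (f (simpleRefl d * simpleRefl b * simpleRefl a * w)) := by
  have h'' : p'' ≠ q'' := fun e => h' (by rw [← hp'', ← hq'', e])
  rw [tauOp_apply, tauOp_tauOp_apply b d h'' hp' hq', map_mul, map_mul,
    perm_factor a (lo_ne_hi b) h hp hq, perm_factor a h'' h' hp'' hq'', perm_perm]
  simp only [mul_assoc]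

/-- The rule for `tauOp` reflects `τ_a τ_{s_a w} = τ_w` if `s_a w` is shorter than `w`, and `τ_a²
τ_w = R τ_w` if it is longer. In the braid relation both sides have the factors of the same three
pairs of positions, in different orders; these are central. -/
theorem skRel_eq [Invertible (2 : k)] (hc : Function.Involutive c) (hQ : IsAdmissible c Q)
    (x x' : Module.End k (Equiv.Perm (Fin n) → MK k c n))
    (h : SKRel c Q n (Algebra.lsmul k k (Equiv.Perm (Fin n) → MK k c n)) (tauOp c Q) x x') :
    x = x' := by
  cases h with
  | map_add x x' => exact map_add _ _ _
  | map_mul x x' => exact map_mul _ _ _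
  | map_scalar r => exact AlgHom.commutes _ _
  | τ_τ a b h =>
    refine LinearMap.ext fun f => funext fun w => ?_
    obtain ⟨h1, h2, h3, h4⟩ := SK.Far.ne h
    rw [Module.End.mul_apply, Module.End.mul_apply,
      tauOp_tauOp_apply a b (lo_ne_hi b) (SK.simpleRefl_apply_of_ne h1 h2)
        (SK.simpleRefl_apply_of_ne h3 h4),
      tauOp_tauOp_apply b a (lo_ne_hi a) (SK.simpleRefl_apply_of_ne h1.symm h3.symm)
        (SK.simpleRefl_apply_of_ne h2.symm h4.symm), simpleRefl_comm h,
        (commute_factor hc hQ _ w _).eq]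
  | braid a b h =>
    refine LinearMap.ext fun f => funext fun w => ?_
    obtain ⟨hps, hqs, hab, a1, a2, a3, b1, b2, b3⟩ := simpleRefl_adjacent h
    simp only [Module.End.mul_apply]
    rw [tauOp_tauOp_tauOp_apply b a b hps (lo_ne_hi a) b1 b2 (by rw [hab, a2]) a3 b1 b3,
      tauOp_tauOp_tauOp_apply a b a hps hqs (by rw [hab, a2]) a3 b1 b2 a1 a3,
      simpleRefl_braid h]
    congr 1
    rw [mul_assoc, (commute_factor hc hQ (lo_ne_hi b) w _).eq]
    rw [(commute_factor hc hQ hps w _).eq]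
    simp only [hab]
  | τ_sq a =>
    refine LinearMap.ext fun f => funext fun w => ?_
    rw [pow_two, Module.End.mul_apply, tauOp_tauOp_apply a a (lo_ne_hi a).symm
      (Equiv.swap_apply_left _ _) (Equiv.swap_apply_right _ _), factor_mul_factor hc hQ,
      simpleRefl_mul_self, perm_one, one_mul]
    rfl
  | τ_ι a x =>
    refine LinearMap.ext fun f => funext fun w => ?_
    change factor c Q _ _ _ w * perm _ (x * f _) = perm _ x * (factor c Q _ _ _ w * perm _ (f _))
    rw [map_mul, ← mul_assoc, ← mul_assoc, (commute_factor hc hQ _ w _).eq]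

end MK

namespace SK

/-- The regular representation of `SK_n`, with the basis element of `w` corresponding to
`τ_w`. -/
def rep [Invertible (2 : k)] (hc : Function.Involutive c) (hQ : IsAdmissible c Q) :
    SK c Q n →ₐ[k] Module.End k (Equiv.Perm (Fin n) → MK k c n) :=
  lift (Algebra.lsmul k k (Equiv.Perm (Fin n) → MK k c n)) (MK.tauOp c Q) (MK.skRel_eq hc hQ)

end SK

end RegularRepresentation

/-! ### A spanning set -/

section Spanning

variable {k : Type*} [CommRing k] {A : Type*} [Ring A] [Algebra k A]

/-- The product `s_{j+m-1} ⋯ s_{j+1} s_j`. -/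
def descProd {A : Type*} [Monoid A] (s : ℕ → A) (j : ℕ) : ℕ → A
  | 0 => 1
  | m + 1 => s (j + m) * descProd s j m

theorem descProd_succ_eq_mul {A : Type*} [Monoid A] (s : ℕ → A) (j m : ℕ) :
    descProd s j (m + 1) = descProd s (j + 1) m * s j := by
  induction m with
  | zero => simp [descProd]
  | succ m ih =>
    rw [descProd, ih, descProd, mul_assoc, show j + (m + 1) = j + 1 + m by omega]

/-- The conditions on a subalgebra `M` and elements `s_0, …, s_{N-1}` of an algebra under which
the algebra that they generate is spanned over `M` by products indexed by permutations. -/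
structure IsHeckeLike (M : Subalgebra k A) (s : ℕ → A) (N : ℕ) : Prop where
  mul_mem : ∀ a < N, ∀ x ∈ M, ∃ x' ∈ M, ∃ x'' ∈ M, s a * x = x' * s a + x''
  sq_mem : ∀ a < N, s a * s a ∈ M
  comm : ∀ a b, a < N → b < N → a + 1 < b → s a * s b = s b * s a
  braid : ∀ a, a + 1 < N → s (a + 1) * s a * s (a + 1) - s a * s (a + 1) * s a ∈ M

/-- The subalgebra generated by `M` and `s_0, …, s_{r-1}`. -/
def levelAlg (M : Subalgebra k A) (s : ℕ → A) (r : ℕ) : Subalgebra k A :=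
  Algebra.adjoin k (M ∪ {x | ∃ a < r, x = s a})

theorem le_levelAlg (M : Subalgebra k A) (s : ℕ → A) (r : ℕ) : M ≤ levelAlg M s r :=
  fun _ hx => Algebra.subset_adjoin (Or.inl hx)

theorem mem_levelAlg (M : Subalgebra k A) (s : ℕ → A) {a r : ℕ} (h : a < r) :
    s a ∈ levelAlg M s r := Algebra.subset_adjoin (Or.inr ⟨a, h, rfl⟩)

theorem levelAlg_zero (M : Subalgebra k A) (s : ℕ → A) : levelAlg M s 0 = M := by
  simp [levelAlg, Algebra.adjoin_eq]

/-- The span over `levelAlg M s r` of the products `s_r ⋯ s_i` with `j ≤ i ≤ r + 1`. -/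
def cosetSpan (M : Subalgebra k A) (s : ℕ → A) (r j : ℕ) : Submodule (levelAlg M s r) A :=
  Submodule.span (levelAlg M s r) {x | ∃ i, j ≤ i ∧ i ≤ r + 1 ∧ x = descProd s i (r + 1 - i)}

variable {M : Subalgebra k A} {s : ℕ → A} {N r : ℕ}

theorem descProd_mem_cosetSpan {i j : ℕ} (h : j ≤ i) (hi : i ≤ r + 1) :
    descProd s i (r + 1 - i) ∈ cosetSpan M s r j := Submodule.subset_span ⟨i, h, hi, rfl⟩

theorem mul_mem_cosetSpan {j : ℕ} {x z : A} (hx : x ∈ levelAlg M s r)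
    (hz : z ∈ cosetSpan M s r j) : x * z ∈ cosetSpan M s r j :=
  Submodule.smul_mem _ (⟨x, hx⟩ : levelAlg M s r) hz

theorem cosetSpan_anti {i j : ℕ} (h : j ≤ i) : cosetSpan M s r i ≤ cosetSpan M s r j := by
  refine Submodule.span_mono ?_
  rintro _ ⟨l, h1, h2, rfl⟩
  exact ⟨l, h.trans h1, h2, rfl⟩

/-- To check that right multiplication by `x` maps one span into another, look at generators. -/
theorem cosetSpan_mul {i j : ℕ} {x : A}
    (h : ∀ l, i ≤ l → l ≤ r + 1 → descProd s l (r + 1 - l) * x ∈ cosetSpan M s r j)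
    {z : A} (hz : z ∈ cosetSpan M s r i) : z * x ∈ cosetSpan M s r j := by
  induction hz using Submodule.span_induction with
  | mem z hz => obtain ⟨l, h1, h2, rfl⟩ := hz; exact h l h1 h2
  | zero => rw [zero_mul]; exact zero_mem _
  | add z z' _ _ h1 h2 => rw [add_mul]; exact add_mem h1 h2
  | smul b z _ hz => rw [smul_mul_assoc]; exact Submodule.smul_mem _ _ hz

theorem descProd_comm (H : IsHeckeLike M s N) (hr : r < N) {i a : ℕ} (h : a + 1 < i)
    (hi : i ≤ r + 1) :
    descProd s i (r + 1 - i) * s a = s a * descProd s i (r + 1 - i) := by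
  have key : ∀ m, i + m ≤ r + 1 → descProd s i m * s a = s a * descProd s i m := by
    intro m
    induction m with
    | zero => intro _; simp [descProd]
    | succ m ih =>
      intro hm
      rw [descProd, mul_assoc, ih (by omega), ← mul_assoc, ← mul_assoc,
        H.comm a (i + m) (by omega) (by omega) (by omega)]
  exact key _ (by omega)

theorem descProd_eq {i : ℕ} (hi : i ≤ r) :
    descProd s i (r + 1 - i) = descProd s (i + 1) (r + 1 - (i + 1)) * s i := by
  rw [show r + 1 - i = (r - i) + 1 by omega, descProd_succ_eq_mul,
    show r + 1 - (i + 1) = r - i by omega]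

/-- Descending induction on `i`: pass `x` through the last factor `s_i`, then treat both resulting
elements of `M` by the case `i + 1`. Of the products so obtained, `s_r ⋯ s_{i+1}` is completed by
`s_i`, and the shorter ones commute with `s_i`, which goes into the coefficient. -/
theorem descProd_mul_mem (H : IsHeckeLike M s N) (hr : r < N) {i : ℕ} (hi : i ≤ r + 1) {x : A}
    (hx : x ∈ M) : descProd s i (r + 1 - i) * x ∈ cosetSpan M s r i := by
  obtain ⟨d, hd⟩ : ∃ d, i + d = r + 1 := ⟨r + 1 - i, by omega⟩
  induction d generalizing i x with
  | zero =>
    obtain rfl : i = r + 1 := by omega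
    have h1 := descProd_mem_cosetSpan (M := M) (s := s) (r := r) (le_refl (r + 1)) le_rfl
    rw [Nat.sub_self, descProd] at h1 ⊢
    rw [one_mul, ← mul_one x]
    exact mul_mem_cosetSpan (le_levelAlg M s r hx) h1
  | succ d ih =>
    obtain ⟨x', hx', x'', hx'', h⟩ := H.mul_mem i (by omega) x hx
    rw [descProd_eq (by omega), mul_assoc, h, mul_add, ← mul_assoc]
    refine add_mem ?_ (cosetSpan_anti (Nat.le_succ i) (ih (by omega) hx'' (by omega)))
    refine cosetSpan_mul (fun l h1 h2 => ?_) (ih (by omega) hx' (by omega))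
    obtain rfl | h3 := h1.eq_or_lt
    · rw [← descProd_eq (by omega)]
      exact descProd_mem_cosetSpan le_rfl (by omega)
    · rw [descProd_comm H hr h3 h2]
      exact mul_mem_cosetSpan (mem_levelAlg M s (by omega))
        (descProd_mem_cosetSpan (by omega) h2)

theorem descProd_add {A : Type*} [Monoid A] (s : ℕ → A) (j m m' : ℕ) :
    descProd s j (m + m') = descProd s (j + m) m' * descProd s j m := by
  induction m' with
  | zero => simp [descProd]
  | succ m' ih => rw [← add_assoc, descProd, ih, descProd, mul_assoc, add_assoc]

theorem descProd_mem_levelAlg {i m : ℕ} (h : i + m ≤ r) : descProd s i m ∈ levelAlg M s r := by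
  induction m with
  | zero => exact one_mem _
  | succ m ih => exact mul_mem (mem_levelAlg M s (by omega)) (ih (by omega))

theorem descProd_comm_of_lt (H : IsHeckeLike M s N) {i m b : ℕ} (h : i + m < b) (hb : b < N) :
    descProd s i m * s b = s b * descProd s i m := by
  induction m with
  | zero => simp [descProd]
  | succ m ih =>
    rw [descProd, mul_assoc, ih (by omega), ← mul_assoc, ← mul_assoc,
      H.comm (i + m) b (by omega) hb (by omega)]

theorem descProd_comm_descProd (H : IsHeckeLike M s N) {i m l m' : ℕ} (h : i + m < l)
    (hl : l + m' ≤ N) : descProd s i m * descProd s l m' = descProd s l m' * descProd s i m := by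
  induction m' with
  | zero => simp [descProd]
  | succ m' ih =>
    rw [descProd, ← mul_assoc, descProd_comm_of_lt H (by omega) (by omega), mul_assoc,
      ih (by omega), mul_assoc]

/-- The normal form of `s_r ⋯ s_i · s_a`: for `a + 1 < i` the factors commute, for `a + 1 = i` the
product is lengthened, for `a = i` a square appears, and for `a > i` the braid relation turns `s_a`
on the right into `s_{a-1}` on the left, up to a defect in `M`. -/
theorem descProd_mul_gen_mem (H : IsHeckeLike M s N) (hr : r < N) {i a : ℕ} (hi : i ≤ r + 1)
    (ha : a ≤ r) : descProd s i (r + 1 - i) * s a ∈ cosetSpan M s r 0 := by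
  obtain h | h := lt_or_ge a i
  · obtain h1 | h1 := (Nat.succ_le_of_lt h).eq_or_lt
    · subst h1
      rw [← descProd_eq ha]
      exact descProd_mem_cosetSpan (Nat.zero_le _) (by omega)
    · rw [descProd_comm H hr h1 hi]
      exact mul_mem_cosetSpan (mem_levelAlg M s (by omega))
        (descProd_mem_cosetSpan (Nat.zero_le _) hi)
  obtain rfl | h1 := h.eq_or_lt
  · rw [descProd_eq ha, mul_assoc]
    exact cosetSpan_anti (Nat.zero_le _) (descProd_mul_mem H hr (by omega) (H.sq_mem i (by omega)))
  obtain ⟨a, rfl⟩ : ∃ a', a = a' + 1 := ⟨a - 1, by omega⟩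
  obtain ⟨d, rfl⟩ : ∃ d, a = i + d := ⟨a - i, by omega⟩
  -- From here the generator is `s_{a+1}` with `a = i + d`, and the product splits as `D · s_{a+1}
  -- s_a · t`, where `D` has only indices above `a + 1` and `t` only indices below `a`.
  set t := descProd s i d with ht0
  set a := i + d with ha0
  have ht : t ∈ levelAlg M s r := descProd_mem_levelAlg (by omega)
  have ht2 : t * s (a + 1) = s (a + 1) * t := descProd_comm_of_lt H (by omega) (by omega)
  have ht1 : ∀ l, a + 1 < l → l ≤ r + 1 →
      descProd s l (r + 1 - l) * t = t * descProd s l (r + 1 - l) := fun l h1 h2 =>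
    (descProd_comm_descProd H (by omega) (by omega)).symm
  have ht3 : descProd s i (r + 1 - i) =
      descProd s (a + 1 + 1) (r + 1 - (a + 1 + 1)) * (s (a + 1) * s a) * t := by
    rw [show r + 1 - i = d + ((r - a - 1) + 1 + 1) by omega, descProd_add, ← ha0, ← ht0,
      descProd_succ_eq_mul, descProd_succ_eq_mul, show r + 1 - (a + 1 + 1) = r - a - 1 by omega]
    simp only [mul_assoc]
  set D := descProd s (a + 1 + 1) (r + 1 - (a + 1 + 1)) with hD
  have e1 : descProd s i (r + 1 - i) * s (a + 1) =
      s a * descProd s i (r + 1 - i) +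
        D * (s (a + 1) * s a * s (a + 1) - s a * s (a + 1) * s a) * t := by
    rw [ht3, mul_assoc _ t, ht2]
    have : D * s a = s a * D := descProd_comm H hr (by omega) (by omega)
    have : s a * (D * (s (a + 1) * s a) * t) = D * s a * (s (a + 1) * s a) * t := by
      rw [this]; noncomm_ring
    rw [this]; noncomm_ring
  rw [e1]
  refine add_mem (mul_mem_cosetSpan (mem_levelAlg M s (by omega))
    (descProd_mem_cosetSpan (Nat.zero_le _) hi)) ?_
  -- The defect lies in `M`, so `D` times the defect involves only products with all indices above
  -- `a + 1`; these commute with `t`, which then joins the coefficients.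
  refine cosetSpan_mul (fun l h1 h2 => ?_)
    (descProd_mul_mem H hr (i := a + 1 + 1) (by omega) (H.braid a (by omega)))
  rw [ht1 l h1 h2]
  exact mul_mem_cosetSpan ht (descProd_mem_cosetSpan (Nat.zero_le _) h2)

/-- The span contains `1`, as the empty product `i = r + 1`, and is stable under right
multiplication by the generators. -/
theorem levelAlg_succ_le (H : IsHeckeLike M s N) (hr : r < N) {x : A}
    (hx : x ∈ levelAlg M s (r + 1)) : x ∈ cosetSpan M s r 0 := by
  have h1 : (1 : A) ∈ cosetSpan M s r 0 := by
    have := descProd_mem_cosetSpan (M := M) (s := s) (r := r) (Nat.zero_le (r + 1)) le_rfl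
    rwa [Nat.sub_self, descProd] at this
  have key : ∀ z ∈ cosetSpan M s r 0, z * x ∈ cosetSpan M s r 0 := by
    induction hx using Algebra.adjoin_induction with
    | mem x hx =>
      intro z hz
      refine cosetSpan_mul (fun l h1 h2 => ?_) hz
      obtain hx | ⟨a, ha, rfl⟩ := hx
      · exact cosetSpan_anti (Nat.zero_le _) (descProd_mul_mem H hr h2 hx)
      · exact descProd_mul_gen_mem H hr h2 (by omega)
    | algebraMap c =>
      intro z hz
      rw [← Algebra.commutes]
      exact mul_mem_cosetSpan (Subalgebra.algebraMap_mem _ c) hz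
    | add x y _ _ hx hy => intro z hz; rw [mul_add]; exact add_mem (hx z hz) (hy z hz)
    | mul x y _ _ hx hy => intro z hz; rw [← mul_assoc]; exact hy _ (hx z hz)
  simpa using key 1 h1

end Spanning

/-! ### `RC_n` is spanned by products over permutations -/

section RCSpanning

theorem exists_sum_of_mem_cosetSpan {k A : Type*} [CommRing k] [Ring A] [Algebra k A]
    {M : Subalgebra k A} {s : ℕ → A} {r : ℕ} {x : A}
    (hx : x ∈ cosetSpan M s r 0) :
    ∃ b : ℕ → A, (∀ i, b i ∈ levelAlg M s r) ∧
      x = ∑ i ∈ Finset.range (r + 2), b i * descProd s i (r + 1 - i) := by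
  induction hx using Submodule.span_induction with
  | mem x hx =>
    obtain ⟨i, -, hi, rfl⟩ := hx
    refine ⟨Pi.single i 1, fun l => ?_, ?_⟩
    · by_cases h : l = i
      · subst h; rw [Pi.single_eq_same]; exact one_mem _
      · rw [Pi.single_eq_of_ne h]; exact zero_mem _
    · rw [Finset.sum_eq_single i]
      · rw [Pi.single_eq_same, one_mul]
      · intro l _ hl; rw [Pi.single_eq_of_ne hl, zero_mul]
      · intro h; exact absurd (Finset.mem_range.mpr (by omega)) h
  | zero => exact ⟨0, fun _ => zero_mem _, by simp⟩
  | add x x' _ _ h h' =>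
    obtain ⟨b, hb, rfl⟩ := h
    obtain ⟨b', hb', rfl⟩ := h'
    refine ⟨b + b', fun i => add_mem (hb i) (hb' i), ?_⟩
    rw [← Finset.sum_add_distrib]
    exact Finset.sum_congr rfl fun i _ => by rw [Pi.add_apply, add_mul]
  | smul t x _ h =>
    obtain ⟨b, hb, rfl⟩ := h
    refine ⟨fun i => t * b i, fun i => mul_mem t.2 (hb i), ?_⟩
    rw [Finset.smul_sum]
    exact Finset.sum_congr rfl fun i _ => (mul_assoc _ _ _).symm

variable {k : Type u} [CommRing k] {J : Type v} {c : J → J} [Fintype J] [DecidableEq J]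
  {Q : J → J → MvPolynomial (Fin 2) k} {n : ℕ}

namespace RC

variable (c Q n) in
/-- The canonical homomorphism `MA_n → RC_n`. -/
def ofMA : MA k c n →ₐ[k] RC c Q n :=
  MA.lift (y c Q) (cl c Q) (e c Q) fun _ _ h => rel _ _ (.ma _ _ h)

@[simp] theorem ofMA_y (p : Fin n) : ofMA c Q n (MA.y k c p) = y c Q p := MA.lift_y ..

@[simp] theorem ofMA_cl (p : Fin n) : ofMA c Q n (MA.cl k c p) = cl c Q p := MA.lift_cl ..

@[simp] theorem ofMA_e (ν : Fin n → J) : ofMA c Q n (MA.e k c ν) = e c Q ν := MA.lift_e ..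

/-- The relations with correction terms are only given after multiplication by the idempotents
`e(ν)`, whose sum is `1`. -/
theorem mem_range_of_mul_e {x : RC c Q n}
    (h : ∀ ν, x * e c Q ν ∈ (ofMA c Q n).range) : x ∈ (ofMA c Q n).range := by
  rw [← mul_one x, rel _ _ (.ma _ _ .sum_e), Finset.mul_sum]
  exact sum_mem fun ν _ => h ν

variable (c Q n) in
/-- The elements `σ_a`, extended by `0` to all indices. -/
def sigmaNat (a : ℕ) : RC c Q n := if h : a < n - 1 then σ c Q ⟨a, h⟩ else 0

theorem sigmaNat_of_lt {a : ℕ} (h : a < n - 1) : sigmaNat c Q n a = σ c Q ⟨a, h⟩ := dif_pos h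

theorem exists_σ_mul (a : Fin (n - 1)) (z : MA k c n) :
    ∃ z' z'' : MA k c n, σ c Q a * ofMA c Q n z = ofMA c Q n z' * σ c Q a + ofMA c Q n z'' := by
  obtain ⟨z, rfl⟩ := MA.mk_surjective k c z
  induction z using FreeAlgebra.induction with
  | grade0 r =>
    refine ⟨algebraMap k _ r, 0, ?_⟩
    rw [AlgHom.commutes, AlgHom.commutes, map_zero, add_zero, Algebra.commutes]
  | add z1 z2 h1 h2 =>
    obtain ⟨z1', z1'', h1⟩ := h1
    obtain ⟨z2', z2'', h2⟩ := h2
    refine ⟨z1' + z2', z1'' + z2'', ?_⟩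
    rw [map_add, map_add, mul_add, h1, h2, map_add, map_add, add_mul]
    abel
  | mul z1 z2 h1 h2 =>
    obtain ⟨z1', z1'', h1⟩ := h1
    obtain ⟨z2', z2'', h2⟩ := h2
    refine ⟨z1' * z2', z1' * z2'' + z1'' * MA.mk k c n z2, ?_⟩
    rw [map_mul, map_mul, ← mul_assoc, h1, add_mul, mul_assoc, h2]
    simp only [map_mul, map_add]
    noncomm_ring
  | grade1 g =>
    cases g with
    | e ν =>
      refine ⟨MA.e k c (permSeq (simpleRefl a) ν), 0, ?_⟩
      rw [map_zero, add_zero, ofMA_e]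
      exact (congrArg _ (ofMA_e ν)).trans (rel _ _ (.σ_e a ν))
    | cl p =>
      refine ⟨MA.cl k c (simpleRefl a p), 0, ?_⟩
      rw [map_zero, add_zero, ofMA_cl]
      exact (congrArg _ (ofMA_cl p)).trans (rel _ _ (.σ_cl a p))
    | y p =>
      change ∃ z' z'' : MA k c n, σ c Q a * ofMA c Q n (MA.y k c p) = _
      rw [ofMA_y]
      by_cases h1 : p = lo a
      · subst h1
        have : y c Q (hi a) * σ c Q a - σ c Q a * y c Q (lo a) ∈ (ofMA c Q n).range := by
          refine mem_range_of_mul_e fun ν => ?_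
          rw [rel _ _ (.y_hi_σ a ν)]
          refine ⟨(if ν (lo a) = ν (hi a) then MA.e k c ν else 0) + (if ν (lo a) = c (ν (hi a))
            then MA.cl k c (lo a) * MA.cl k c (hi a) * MA.e k c ν else 0), ?_⟩
          split_ifs <;> simp
        obtain ⟨z, hz⟩ := this
        refine ⟨MA.y k c (hi a), -z, ?_⟩
        rw [map_neg]
        refine Eq.trans ?_ (congrArg (fun t => _ + -t) hz.symm)
        rw [ofMA_y]; abel
      by_cases h2 : p = hi a
      · subst h2
        have : σ c Q a * y c Q (hi a) - y c Q (lo a) * σ c Q a ∈ (ofMA c Q n).range := by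
          refine mem_range_of_mul_e fun ν => ?_
          rw [rel _ _ (.σ_y_hi a ν)]
          refine ⟨(if ν (lo a) = ν (hi a) then MA.e k c ν else 0) - (if ν (lo a) = c (ν (hi a))
            then MA.cl k c (lo a) * MA.cl k c (hi a) * MA.e k c ν else 0), ?_⟩
          split_ifs <;> simp
        obtain ⟨z, hz⟩ := this
        refine ⟨MA.y k c (lo a), z, ?_⟩
        refine Eq.trans ?_ (congrArg (fun t => _ + t) hz.symm)
        rw [ofMA_y]; abel
      · refine ⟨MA.y k c p, 0, ?_⟩
        rw [map_zero, add_zero, ofMA_y, ← mul_one (σ c Q a * _), ← mul_one (y c Q p * _),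
          rel _ _ (.ma _ _ .sum_e), Finset.mul_sum, Finset.mul_sum]
        exact Finset.sum_congr rfl fun ν _ => rel _ _ (.σ_y a p ν h1 h2)

variable (c Q n) in
theorem isHeckeLike : IsHeckeLike (ofMA c Q n).range (sigmaNat c Q n) (n - 1) where
  mul_mem a ha x hx := by
    obtain ⟨z, rfl⟩ := hx
    obtain ⟨z', z'', h⟩ := exists_σ_mul (Q := Q) ⟨a, ha⟩ z
    rw [sigmaNat_of_lt ha]
    exact ⟨_, ⟨z', rfl⟩, _, ⟨z'', rfl⟩, h⟩
  sq_mem a ha := by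
    rw [sigmaNat_of_lt ha]
    refine mem_range_of_mul_e fun ν => ?_
    rw [← pow_two, rel _ _ (.σ_sq _ ν)]
    exact ⟨evalAt (Q _ _) (MA.y k c _) (MA.y k c _) * MA.e k c ν, by simp [map_evalAt]; rfl⟩
  comm a b ha hb hab := by
    rw [sigmaNat_of_lt ha, sigmaNat_of_lt hb]
    exact rel _ _ (.σ_σ _ _ (Or.inl hab))
  braid a ha := by
    rw [sigmaNat_of_lt ha, sigmaNat_of_lt (show a < n - 1 by omega)]
    refine mem_range_of_mul_e fun ν => ?_
    rw [rel _ _ (.braid ⟨a, by omega⟩ ⟨a + 1, ha⟩ ν rfl)]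
    refine add_mem ?_ ?_ <;> split_ifs
    · exact ⟨divDiff (Q _ _) (MA.y k c _) (MA.y k c _) (MA.y k c _) * MA.e k c ν, by
        simp [map_divDiff]; rfl⟩
    · exact zero_mem _
    · exact ⟨divDiff (Q _ _) (MA.y k c _) (-MA.y k c _) (MA.y k c _) *
        (MA.cl k c _ * MA.cl k c _) * MA.e k c ν, by simp [map_divDiff]; rfl⟩
    · exact zero_mem _

theorem levelAlg_eq_top : levelAlg (ofMA c Q n).range (sigmaNat c Q n) (n - 1) = ⊤ := by
  refine eq_top_iff.mpr fun x _ => ?_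
  obtain ⟨x, rfl⟩ := RingQuot.mkAlgHom_surjective k (rcRel c Q n) x
  change mk c Q n x ∈ _
  have hM := fun z => le_levelAlg (ofMA c Q n).range (sigmaNat c Q n) (n - 1)
    (⟨z, rfl⟩ : ofMA c Q n z ∈ (ofMA c Q n).range)
  induction x using FreeAlgebra.induction with
  | grade0 r => rw [AlgHom.commutes]; exact Subalgebra.algebraMap_mem _ r
  | add a b ha hb => rw [map_add]; exact add_mem (ha trivial) (hb trivial)
  | mul a b ha hb => rw [map_mul]; exact mul_mem (ha trivial) (hb trivial)
  | grade1 g =>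
    cases g with
    | y p => have := hM (MA.y k c p); rwa [ofMA_y] at this
    | cl p => have := hM (MA.cl k c p); rwa [ofMA_cl] at this
    | e ν => have := hM (MA.e k c ν); rwa [ofMA_e] at this
    | σ a =>
      have := mem_levelAlg (ofMA c Q n).range (sigmaNat c Q n) a.2
      rwa [sigmaNat_of_lt a.2] at this

variable [Invertible (2 : k)] (hc : Function.Involutive c) (hQ : IsAdmissible c Q)

/-- The homomorphism `RC_n → SK_n`. -/
def toSK : RC c Q n →ₐ[k] SK c Q n :=
  lift (SK.y c Q) (SK.cl c Q) (SK.e c Q) (SK.sigma c Q) (SK.rcRel_eq hc hQ)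

theorem toSK_ofMA (z : MA k c n) : toSK hc hQ (ofMA c Q n z) = SK.of c Q n (MK.of k c n z) := by
  have : (toSK hc hQ).comp (ofMA c Q n) = (SK.of c Q n).comp (MK.of k c n) := by
    apply MA.hom_ext <;> intro
    · simp only [AlgHom.comp_apply, ofMA_y, toSK, lift_y]; rfl
    · simp only [AlgHom.comp_apply, ofMA_cl, toSK, lift_cl]; rfl
    · simp only [AlgHom.comp_apply, ofMA_e, toSK, lift_e]; rfl
  exact DFunLike.congr_fun this z

/-- The action of `RC_n` on the regular representation of `SK_n`. -/
def rep : RC c Q n →ₐ[k] Module.End k (Equiv.Perm (Fin n) → MK k c n) :=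
  (SK.rep hc hQ).comp (toSK hc hQ)

theorem rep_ofMA (z : MA k c n) (f : Equiv.Perm (Fin n) → MK k c n) (w : Equiv.Perm (Fin n)) :
    rep hc hQ (ofMA c Q n z) f w = MK.of k c n z * f w := by
  rw [rep, AlgHom.comp_apply, toSK_ofMA, SK.rep, SK.lift_of]
  rfl

theorem rep_σ (a : Fin (n - 1)) (f : Equiv.Perm (Fin n) → MK k c n) (w : Equiv.Perm (Fin n)) :
    rep hc hQ (σ c Q a) f w =
      MK.tauOp c Q a f w + MK.rMatrix k c (lo a) (hi a) (lo_ne_hi a) * f w := by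
  rw [rep, AlgHom.comp_apply, toSK, lift_σ, SK.sigma_eq hc, map_add, SK.rElem, SK.rep,
    SK.lift_τ, SK.lift_of]
  rfl

end RC
end RCSpanning

/-! ### Independence -/

section Independence

variable {n : ℕ}

/-- The simple reflections, extended by `1` to all indices. -/
def reflNat (n a : ℕ) : Equiv.Perm (Fin n) := if h : a < n - 1 then simpleRefl ⟨a, h⟩ else 1

theorem reflNat_of_lt {a : ℕ} (h : a < n - 1) : reflNat n a = simpleRefl ⟨a, h⟩ := dif_pos h

theorem val_simpleRefl_apply (a : Fin (n - 1)) (p : Fin n) : (simpleRefl a p).1 =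
    if p.1 = a.1 then a.1 + 1 else if p.1 = a.1 + 1 then a.1 else p.1 := by
  by_cases h1 : p = lo a
  · subst h1; simp [simpleRefl, lo, hi]
  by_cases h2 : p = hi a
  · subst h2; simp [simpleRefl, lo, hi]
  · have h1' : p.1 ≠ a.1 := fun h => h1 (Fin.ext h)
    have h2' : p.1 ≠ a.1 + 1 := fun h => h2 (Fin.ext h)
    rw [SK.simpleRefl_apply_of_ne h1 h2, if_neg h1', if_neg h2']

/-- The inverse is the cycle sending `j + m` to `j` and raising `j, …, j + m - 1` by one. In
particular the preimage of the top position recovers `j`, so it separates the coset representatives,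
and the inverse is increasing on the positions below the top. -/
theorem val_descProd_inv_apply {j m : ℕ} (h : j + m ≤ n - 1) (p : Fin n) :
    ((descProd (reflNat n) j m)⁻¹ p).1 = if p.1 = j + m then j else
      if j ≤ p.1 ∧ p.1 < j + m then p.1 + 1 else p.1 := by
  induction m generalizing p with
  | zero =>
    simp only [descProd, inv_one, Equiv.Perm.one_apply, add_zero]
    split_ifs <;> omega
  | succ m ih =>
    rw [descProd, mul_inv_rev, Equiv.Perm.mul_apply, ih (by omega),
      reflNat_of_lt (by omega), simpleRefl_inv, val_simpleRefl_apply]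
    dsimp only
    split_ifs <;> omega

variable {k : Type u} [CommRing k] {J : Type v} {c : J → J} [Fintype J] [DecidableEq J]
  {Q : J → J → MvPolynomial (Fin 2) k}

/-- `f` vanishes at all `w` with `w⁻¹ p ∉ S`. -/
def SuppAt (p : Fin n) (S : Set (Fin n)) (f : Equiv.Perm (Fin n) → MK k c n) : Prop :=
  ∀ w, w⁻¹ p ∉ S → f w = 0

theorem SuppAt.add {p : Fin n} {S : Set (Fin n)} {f g : Equiv.Perm (Fin n) → MK k c n}
    (hf : SuppAt p S f) (hg : SuppAt p S g) : SuppAt p S (f + g) := fun w hw => by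
  rw [Pi.add_apply, hf w hw, hg w hw, add_zero]

theorem suppAt_single {p : Fin n} {S : Set (Fin n)} {w : Equiv.Perm (Fin n)} (h : w⁻¹ p ∈ S)
    (x : MK k c n) : SuppAt p S (Pi.single w x) := fun w' hw' => by
  rw [Pi.single_eq_of_ne]
  rintro rfl
  exact hw' h

theorem suppAt_tauOp {a : Fin (n - 1)} {p p' : Fin n} (hp : simpleRefl a p' = p)
    {S : Set (Fin n)} {f : Equiv.Perm (Fin n) → MK k c n} (hf : SuppAt p S f) :
    SuppAt p' S (MK.tauOp c Q a f) := fun w hw => by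
  rw [MK.tauOp_apply, hf, map_zero, mul_zero]
  rwa [mul_inv_rev, simpleRefl_inv, Equiv.Perm.mul_apply, ← hp,
    ← Equiv.Perm.mul_apply (simpleRefl a), simpleRefl_mul_self]

/-- The length-increasing case `τ_a τ_w = τ_{s_a w}`, where no factor `R` arises. -/
theorem tauOp_single {a : Fin (n - 1)} {w : Equiv.Perm (Fin n)} (h : w⁻¹ (lo a) < w⁻¹ (hi a)) :
    MK.tauOp c Q a (Pi.single w 1) = Pi.single (simpleRefl a * w) 1 := by
  funext w'
  rw [MK.tauOp_apply]
  by_cases hw : w' = simpleRefl a * w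
  · subst hw
    have h1 : (simpleRefl a * w)⁻¹ (lo a) = w⁻¹ (hi a) := by
      rw [mul_inv_rev, simpleRefl_inv, Equiv.Perm.mul_apply, simpleRefl, Equiv.swap_apply_left]
    have h2 : (simpleRefl a * w)⁻¹ (hi a) = w⁻¹ (lo a) := by
      rw [mul_inv_rev, simpleRefl_inv, Equiv.Perm.mul_apply, simpleRefl, Equiv.swap_apply_right]
    rw [simpleRefl_mul_cancel, Pi.single_eq_same, Pi.single_eq_same, map_one, mul_one, MK.factor,
      h1, h2, if_neg h.asymm]
  · rw [Pi.single_eq_of_ne hw, Pi.single_eq_of_ne, map_zero, mul_zero]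
    rintro rfl
    exact hw (simpleRefl_mul_cancel a w').symm

/-- Right translation of functions on the symmetric group. -/
def translate (v : Equiv.Perm (Fin n)) :
    (Equiv.Perm (Fin n) → MK k c n) →ₗ[k] (Equiv.Perm (Fin n) → MK k c n) where
  toFun f w := f (w * v⁻¹)
  map_add' _ _ := rfl
  map_smul' _ _ := rfl

theorem translate_apply (v : Equiv.Perm (Fin n)) (f : Equiv.Perm (Fin n) → MK k c n)
    (w : Equiv.Perm (Fin n)) : translate v f w = f (w * v⁻¹) := rfl

theorem translate_single (v : Equiv.Perm (Fin n)) (x : MK k c n) :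
    translate v (Pi.single 1 x) = Pi.single v x := by
  funext w
  rw [translate_apply]
  by_cases h : w = v
  · subst h; simp
  · rw [Pi.single_eq_of_ne h, Pi.single_eq_of_ne]
    exact fun h' => h (mul_inv_eq_one.mp h')

/-- The hypothesis on `v` says that it is a minimal representative of its coset for the permutations
of the positions `0, …, r`. Right multiplication by it does not affect which of the reflections
`s_a`, `a < r`, increase the length, so the factors in `tauOp` agree. -/
theorem tauOp_translate {r : ℕ} {a : Fin (n - 1)} (ha : a.1 < r) {v : Equiv.Perm (Fin n)}
    (hv : ∀ p q : Fin n, p < q → q.1 ≤ r → v⁻¹ p < v⁻¹ q)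
    {f : Equiv.Perm (Fin n) → MK k c n} (hf : ∀ p : Fin n, r < p.1 → SuppAt p {p} f) :
    MK.tauOp c Q a (translate v f) = translate v (MK.tauOp c Q a f) := by
  funext w
  rw [MK.tauOp_apply, translate_apply, translate_apply, MK.tauOp_apply, mul_assoc]
  by_cases h0 : f (simpleRefl a * (w * v⁻¹)) = 0
  · rw [h0, map_zero, mul_zero, mul_zero]
  congr 1
  set u := w * v⁻¹ with hu
  -- Where `f` does not vanish, `u` fixes all positions above `r`, hence preserves `0, …, r`, and
  -- there `v⁻¹` is increasing.
  have hfix : ∀ p : Fin n, r < p.1 → u⁻¹ p = p := by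
    intro p hp
    have h1 : (simpleRefl a * u)⁻¹ p = p := by
      by_contra h
      exact h0 (hf p hp _ h)
    rw [mul_inv_rev, simpleRefl_inv, Equiv.Perm.mul_apply, SK.simpleRefl_apply_of_ne] at h1
    · exact h1
    · intro h; rw [h] at hp; simp only [lo] at hp; omega
    · intro h; rw [h] at hp; simp only [hi] at hp; omega
  have hle : ∀ p : Fin n, p.1 ≤ r → (u⁻¹ p).1 ≤ r := by
    intro p hp
    by_contra h
    have := u⁻¹.injective (hfix _ (not_le.mp h))
    rw [this] at h
    exact h hp
  have hw : ∀ p, w⁻¹ p = v⁻¹ (u⁻¹ p) := fun p => by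
    rw [hu, mul_inv_rev, inv_inv, Equiv.Perm.mul_apply, ← Equiv.Perm.mul_apply v⁻¹,
      inv_mul_cancel, Equiv.Perm.one_apply]
  have hlo : (u⁻¹ (lo a)).1 ≤ r := hle _ (by simp only [lo]; omega)
  have hhi : (u⁻¹ (hi a)).1 ≤ r := hle _ (by simp only [hi]; omega)
  have : w⁻¹ (lo a) < w⁻¹ (hi a) ↔ u⁻¹ (lo a) < u⁻¹ (hi a) := by
    rw [hw, hw]
    refine ⟨fun h => ?_, fun h => hv _ _ h hhi⟩
    by_contra h'
    rcases (not_lt.mp h').eq_or_lt with h'' | h''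
    · rw [h''] at h; exact lt_irrefl _ h
    · exact lt_asymm h (hv _ _ h'' hlo)
  rw [MK.factor, MK.factor, if_congr this rfl rfl]

/-! ### Triangularity of the action of `RC_n` and injectivity. -/

namespace RC

variable [Invertible (2 : k)] (hc : Function.Involutive c) (hQ : IsAdmissible c Q)

/-- The reflections `s_a` with `a < r` move only positions up to `r`, so the value of `w⁻¹` at a
later position is a grading preserved by the subalgebra. -/
theorem suppAt_rep {r : ℕ} {p : Fin n} (hp : r < p.1) {S : Set (Fin n)} {x : RC c Q n}
    (hx : x ∈ levelAlg (ofMA c Q n).range (sigmaNat c Q n) r)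
    {f : Equiv.Perm (Fin n) → MK k c n} (hf : SuppAt p S f) : SuppAt p S (rep hc hQ x f) := by
  induction hx using Algebra.adjoin_induction generalizing f with
  | mem x hx =>
    obtain ⟨z, rfl⟩ | ⟨a, ha, rfl⟩ := hx
    · intro w hw
      refine (rep_ofMA hc hQ z f w).trans ?_
      rw [hf w hw, mul_zero]
    · have han : a < n - 1 := by omega
      rw [sigmaNat_of_lt han]
      intro w hw
      rw [rep_σ, hf w hw, mul_zero, add_zero]
      refine suppAt_tauOp ?_ hf w hw
      refine SK.simpleRefl_apply_of_ne (fun h => ?_) (fun h => ?_)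
      · rw [h] at hp; simp only [lo] at hp; omega
      · rw [h] at hp; simp only [hi] at hp; omega
  | algebraMap t =>
    intro w hw
    rw [AlgHom.commutes, Module.algebraMap_end_apply, Pi.smul_apply, hf w hw, smul_zero]
  | add x x' _ _ h h' => rw [map_add, LinearMap.add_apply]; exact (h hf).add (h' hf)
  | mul x x' _ _ h h' => rw [map_mul, Module.End.mul_apply]; exact h (h' hf)

theorem rep_translate {r : ℕ} {x : RC c Q n} (hr : r ≤ n - 1)
    (hx : x ∈ levelAlg (ofMA c Q n).range (sigmaNat c Q n) r) {v : Equiv.Perm (Fin n)}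
    (hv : ∀ p q : Fin n, p < q → q.1 ≤ r → v⁻¹ p < v⁻¹ q)
    {f : Equiv.Perm (Fin n) → MK k c n} (hf : ∀ p : Fin n, r < p.1 → SuppAt p {p} f) :
    rep hc hQ x (translate v f) = translate v (rep hc hQ x f) := by
  induction hx using Algebra.adjoin_induction generalizing f with
  | mem x hx =>
    obtain ⟨z, rfl⟩ | ⟨a, ha, rfl⟩ := hx
    · funext w
      exact (rep_ofMA hc hQ z _ w).trans (rep_ofMA hc hQ z f (w * v⁻¹)).symm
    · have han : a < n - 1 := by omega
      rw [sigmaNat_of_lt han]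
      funext w
      rw [rep_σ, tauOp_translate ha hv hf, translate_apply, translate_apply, translate_apply,
        rep_σ]
  | algebraMap t =>
    rw [AlgHom.commutes, Module.algebraMap_end_apply, Module.algebraMap_end_apply, map_smul]
  | add x x' _ _ h h' =>
    rw [map_add, LinearMap.add_apply, LinearMap.add_apply, h hf, h' hf, map_add]
  | mul x x' _ hx' h h' =>
    rw [map_mul, Module.End.mul_apply, Module.End.mul_apply, h' hf,
      h fun p hp => suppAt_rep hc hQ hp hx' (hf p hp)]

/-- The permutation of the product has `w⁻¹(j + m) = j`; the error terms have a larger value there.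
This is the triangularity that separates the products with different `j` and the same `j + m`. -/
theorem rep_descProd {j m : ℕ} (h : j + m ≤ n - 1) : ∃ g : Equiv.Perm (Fin n) → MK k c n,
    rep hc hQ (descProd (sigmaNat c Q n) j m) (Pi.single 1 1) =
      Pi.single (descProd (reflNat n) j m) 1 + g ∧
    (∀ p : Fin n, j + m < p.1 → SuppAt p {p} g) ∧
    (∀ p : Fin n, p.1 = j + m → SuppAt p {q | j < q.1} g) := by
  induction m with
  | zero =>
    refine ⟨0, ?_, fun _ _ _ _ => rfl, fun _ _ _ _ => rfl⟩
    rw [descProd, descProd, map_one, Module.End.one_apply, add_zero]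
  | succ m ih =>
    obtain ⟨g, hg, hg1, hg2⟩ := ih (by omega)
    have ha : j + m < n - 1 := by omega
    set a : Fin (n - 1) := ⟨j + m, ha⟩
    set d := descProd (reflNat n) j m with hd
    have hlt : d⁻¹ (lo a) < d⁻¹ (hi a) := by
      rw [Fin.lt_def, hd, val_descProd_inv_apply (by omega), val_descProd_inv_apply (by omega)]
      have h1 : (lo a).1 = j + m := rfl
      have h2 : (hi a).1 = j + m + 1 := rfl
      rw [h1, h2, if_pos rfl, if_neg (by omega), if_neg (by omega)]
      omega
    set r := MK.rMatrix k c (lo a) (hi a) (lo_ne_hi a)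
    -- The new error collects the `r`-part acting on the main term and both parts of `σ_a` acting on
    -- the old error. At the new top position, `τ_a` brings in the bound for the old one, while the
    -- `r`-parts leave that position fixed, and `j + m + 1 > j`.
    refine ⟨Pi.single d r + (MK.tauOp c Q a g + r • g), ?_, fun p hp => ?_, fun p hp => ?_⟩
    · rw [descProd, map_mul, Module.End.mul_apply, hg, sigmaNat_of_lt ha, descProd,
        reflNat_of_lt ha, ← tauOp_single hlt]
      funext w
      rw [rep_σ, map_add]
      simp only [Pi.add_apply, Pi.smul_apply, smul_eq_mul, mul_add]
      have : r * (Pi.single d 1 : Equiv.Perm (Fin n) → MK k c n) w =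
          (Pi.single d r : Equiv.Perm (Fin n) → MK k c n) w := by
        by_cases hw : w = d
        · subst hw; rw [Pi.single_eq_same, Pi.single_eq_same, mul_one]
        · rw [Pi.single_eq_of_ne hw, Pi.single_eq_of_ne hw, mul_zero]
      rw [this]
      abel
    · have hgp := hg1 p (by omega)
      refine (suppAt_single ?_ r).add ((suppAt_tauOp ?_ hgp).add fun w hw => ?_)
      · rw [Set.mem_singleton_iff, Fin.ext_iff, hd, val_descProd_inv_apply (by omega)]
        split_ifs <;> omega
      · rw [Fin.ext_iff, val_simpleRefl_apply]
        simp only [a]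
        split_ifs <;> omega
      · rw [Pi.smul_apply, hgp w hw, smul_zero]
    · have hgp := hg1 p (by omega)
      have hp' : p = hi a := Fin.ext (by simp only [hi, a]; omega)
      refine (suppAt_single ?_ r).add ((suppAt_tauOp (p := lo a) ?_ (hg2 _ rfl)).add
        fun w hw => ?_)
      · change j < _
        rw [hd, val_descProd_inv_apply (by omega)]
        split_ifs <;> omega
      · rw [hp', simpleRefl, Equiv.swap_apply_right]
      · rw [Pi.smul_apply, hgp w, smul_zero]
        rintro h'
        apply hw
        rw [Set.mem_singleton_iff.mp h']
        change j < _
        omega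

/-- Write `x = ∑ b_i σ_r ⋯ σ_i` with `b_i` one level below and look at the functions on the part
where `w⁻¹` takes the value `i` at position `r + 1`. Terms with `l > i` and the error of the `i`-th
term live on larger values, and terms with `l < i` have already been removed. So `b_i` kills the
delta function at `d i`, hence by translation the one at `1`, and induction on the level applies. -/
theorem eq_zero_of_rep {r : ℕ} (hr : r ≤ n - 1) {x : RC c Q n}
    (hx : x ∈ levelAlg (ofMA c Q n).range (sigmaNat c Q n) r)
    (h : rep hc hQ x (Pi.single 1 1) = 0) : x = 0 := by
  induction r generalizing x with
  | zero =>
    rw [levelAlg_zero] at hx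
    obtain ⟨z, rfl⟩ := hx
    have h1 := (rep_ofMA hc hQ z (Pi.single 1 1) 1).symm.trans (congrFun h 1)
    rw [Pi.single_eq_same, mul_one, Pi.zero_apply, ← map_zero (MK.of k c n)] at h1
    -- At level `0` the action is left multiplication on `MK_n`, so injectivity of `MA_n → MK_n`
    -- suffices.
    rw [MA.of_injective c hc h1]
    exact map_zero _
  | succ r ih =>
    obtain ⟨b, hb, rfl⟩ := exists_sum_of_mem_cosetSpan
      (levelAlg_succ_le (isHeckeLike c Q n) (by omega) hx)
    set P : Fin n := ⟨r + 1, by omega⟩ with hP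
    choose g hg hg1 hg2 using fun i (hi : i ≤ r + 1) =>
      rep_descProd (n := n) hc hQ (j := i) (m := r + 1 - i) (by omega)
    set d : ℕ → Equiv.Perm (Fin n) := fun i => descProd (reflNat n) i (r + 1 - i) with hd
    have dP : ∀ i, i ≤ r + 1 → ((d i)⁻¹ P).1 = i := fun i hi => by
      rw [hd]
      dsimp only
      rw [val_descProd_inv_apply (by omega), if_pos (by simp only [hP]; omega)]
    have hsum : ∀ w, ∑ i ∈ Finset.range (r + 2),
        rep hc hQ (b i * descProd (sigmaNat c Q n) i (r + 1 - i)) (Pi.single 1 1) w = 0 := by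
      intro w
      have := congrFun h w
      rwa [map_sum, LinearMap.sum_apply, Finset.sum_apply] at this
    have key : ∀ i, i ≤ r + 1 → b i = 0 := by
      intro i
      induction i using Nat.strong_induction_on with
      | _ i ih' =>
        intro hi
        refine ih (by omega) (hb i) ?_
        have hmono : ∀ p q : Fin n, p < q → q.1 ≤ r → (d i)⁻¹ p < (d i)⁻¹ q := by
          intro p q hpq hq
          rw [Fin.lt_def] at hpq ⊢
          rw [hd]
          dsimp only
          rw [val_descProd_inv_apply (by omega), val_descProd_inv_apply (by omega)]
          split_ifs <;> omega
        have htrans := rep_translate hc hQ (x := b i) (by omega) (hb i) hmono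
          (f := Pi.single 1 1) fun p _ => suppAt_single (by simp) 1
        rw [translate_single] at htrans
        have hzero : rep hc hQ (b i) (Pi.single (d i) 1) = 0 := by
          funext w
          by_cases hw : (w⁻¹ P).1 = i
          · have h1 := hsum w
            rw [Finset.sum_eq_single i] at h1
            · rw [map_mul, Module.End.mul_apply, hg i hi, map_add, Pi.add_apply] at h1
              have h2 : rep hc hQ (b i) (g i hi) w = 0 := by
                refine suppAt_rep hc hQ (p := P) (S := {q | i < q.1}) (by simp [hP]) (hb i)
                  (hg2 i hi P (by simp only [hP]; omega)) w fun hmem => ?_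
                have : i < (w⁻¹ P).1 := hmem
                omega
              rwa [h2, add_zero] at h1
            · intro l hl hli
              have hl' : l ≤ r + 1 := by rw [Finset.mem_range] at hl; omega
              obtain h3 | h3 := lt_or_gt_of_ne hli
              · rw [ih' l h3 hl', zero_mul, map_zero]; rfl
              · rw [map_mul, Module.End.mul_apply, hg l hl']
                refine suppAt_rep hc hQ (p := P) (S := {q | i < q.1}) (by simp [hP]) (hb l)
                  (SuppAt.add (suppAt_single ?_ 1) fun w' hw' => ?_) w fun hmem => ?_
                · change i < _
                  rw [dP l hl']; exact h3
                · refine hg2 l hl' P (by simp only [hP]; omega) w' fun hmem => hw' ?_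
                  exact h3.trans hmem
                · have : i < (w⁻¹ P).1 := hmem
                  omega
            · intro h4; exact absurd (Finset.mem_range.mpr (by omega)) h4
          -- Away from the value `i` the function vanishes for support reasons alone.
          · refine suppAt_rep hc hQ (p := P) (S := {q | q.1 = i}) (by simp [hP]) (hb i)
              (suppAt_single (dP i hi) 1) w hw
        rw [hzero] at htrans
        funext w
        -- Evaluating at `w * d i` undoes the translation.
        have h5 := congrFun htrans (w * d i)
        rw [translate_apply, mul_inv_cancel_right] at h5
        exact h5.symm
    exact Finset.sum_eq_zero fun i hi => by
      rw [key i (by rw [Finset.mem_range] at hi; omega), zero_mul]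

theorem toSK_injective : Function.Injective (toSK (n := n) hc hQ) := by
  refine (injective_iff_map_eq_zero _).mpr fun x hx => ?_
  refine eq_zero_of_rep hc hQ le_rfl (x := x) (by rw [levelAlg_eq_top]; trivial) ?_
  rw [rep, AlgHom.comp_apply, hx, map_zero, LinearMap.zero_apply]

/-- The only point is that `r` is even: its Clifford generators occur in pairs. -/
theorem parity_toSK (x : RC c Q n) : SK.parity (toSK hc hQ x) = toSK hc hQ (parity x) := by
  have hof : ∀ z : MK k c n, SK.parity (SK.of c Q n z) = SK.of c Q n (MK.parity z) := fun z =>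
    SK.lift_of _ _ _ z
  have : (SK.parity).comp (toSK (n := n) hc hQ) = (toSK hc hQ).comp parity := by
    apply hom_ext
    · intro p
      simp only [AlgHom.comp_apply, toSK, parity, lift_y, SK.y, hof, MK.parity_y]
    · intro p
      simp only [AlgHom.comp_apply, toSK, parity, lift_cl, map_neg, SK.cl, hof, MK.parity_cl]
    · intro ν
      simp only [AlgHom.comp_apply, toSK, parity, lift_e, SK.e, hof, MK.parity_e]
    · intro a
      have hr : MK.parity (MK.rMatrix k c (lo a) (hi a) (lo_ne_hi a)) =
          MK.rMatrix k c (lo a) (hi a) (lo_ne_hi a) := by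
        simp only [MK.rMatrix, MK.rCoeff, MK.clcl, map_sum, map_mul, map_sub,
          apply_ite MK.parity, map_zero, MK.parity_invAdd, MK.parity_invSub, MK.parity_cl,
          MK.parity_e, neg_mul_neg]
      simp only [AlgHom.comp_apply, toSK, parity, lift_σ, SK.sigma_eq hc, map_add, SK.rElem, hof,
        hr]
      rw [SK.parity, SK.lift_τ]
  exact DFunLike.congr_fun this x

end RC
end Independence

end QHC

end

theorem theorem3p5 {k : Type*} [CommRing k] [Invertible (2 : k)]
    {J : Type*} [Fintype J] [DecidableEq J] (c : J → J) (hc : Function.Involutive c)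
    (Q : J → J → MvPolynomial (Fin 2) k) (hQ : QHC.IsAdmissible c Q) (n : ℕ) :
    (∀ x x' : QHC.SK c Q n,
      QHC.RCRel c Q (QHC.SK.y c Q) (QHC.SK.cl c Q) (QHC.SK.e c Q) (QHC.SK.sigma c Q) x x' →
        x = x') ∧
    ∃ F : QHC.RC.part c Q n →ₐᵍ[k] QHC.SK.part c Q n,
      (∀ p, F (QHC.RC.y c Q p) = QHC.SK.y c Q p) ∧
      (∀ p, F (QHC.RC.cl c Q p) = QHC.SK.cl c Q p) ∧
      (∀ ν, F (QHC.RC.e c Q ν) = QHC.SK.e c Q ν) ∧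
      (∀ a, F (QHC.RC.σ c Q a) = QHC.SK.sigma c Q a) ∧
      Function.Injective F := by
  refine ⟨QHC.SK.rcRel_eq hc hQ, { QHC.RC.toSK hc hQ with map_mem := ?_ },
    QHC.RC.lift_y _ _ _ _ (QHC.SK.rcRel_eq hc hQ), QHC.RC.lift_cl _ _ _ _ (QHC.SK.rcRel_eq hc hQ),
    QHC.RC.lift_e _ _ _ _ (QHC.SK.rcRel_eq hc hQ), QHC.RC.lift_σ _ _ _ _ (QHC.SK.rcRel_eq hc hQ),
    QHC.RC.toSK_injective hc hQ⟩
  intro ε x hx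
  have hx' := QHC.mem_parityPart.mp hx
  refine QHC.mem_parityPart.mpr ((QHC.RC.parity_toSK hc hQ x).trans ?_)
  rw [hx']
  split_ifs
  · rfl
  · exact map_neg _ _
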